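/- **Notation.** Let $\mathfrak g=\mathfrak{sl}(2,\mathbb R)$ with $\langle X,Y\rangle=\tfrac12\operatorname{tr}(XY)$, $G=\mathrm{SL}(2,\mathbb R)$, $\mathbf k'=\operatorname{diag}(-1,1)$, $\mathfrak k=\mathbb R\mathbf k'$, let $\mathfrak m$ be the space of off-diagonal real $2\times2$ matrices, and $S^2_1=\{X\in\mathfrak g:\langle X,X\rangle=1\}=G/K$, where $K$ is the stabilizer of $\mathbf k'$ under $\mathrm{Ad}$ and $\mathbf k'$ is the coset $K$. Let $\mathbb D\ni(0,0)$ be a simply connected region of the plane with null coordinates $(x,y)$ and metric $dx\,dy$. A smooth map $\psi:\mathbb D\to S^2_1$ is harmonic if its tension field vanishes. Let $\tilde\Lambda G_\sigma$ be the group of loops $\gamma(\lambda)=\sum_{j\in\mathbb Z}\gamma_j\lambda^j$ with real $2\times2$ matrix coefficients, convergent for all $\lambda\in\mathbb C^*$, with $\det\gamma(\lambda)=1$ and $\mathrm{Ad}(\mathbf k')\gamma(\lambda)=\gamma(-\lambda)$. Let $\tilde\Lambda^{+}G_\sigma$ (resp. $\tilde\Lambda^-G_\sigma$) be the subgroup of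 loops with $\gamma_j=0$ for $j<0$ (resp. $j>0$), and $\tilde\Lambda^\pm_*G_\sigma$ the subgroup of $\tilde\Lambda^{\pm}G_\sigma$ with $\gamma_0=\mathbf 1$. A loop-valued map is called smooth if it is smooth jointly in the point and in $\lambda\in\mathbb C^*$. An *extended framing* of $\psi$ on an open set $U\ni(0,0)$ is a smooth map $\Psi:U\to\tilde\Lambda G_\sigma$ with $\Psi(0,0)=\mathbf 1$, $\psi=\mathrm{Ad}(\Psi|_{\lambda=1})\mathbf k'$ and $$\Psi^{-1}\Psi_x=A+\lambda B,\qquad \Psi^{-1}\Psi_y=C+\lambda^{-1}E,$$ where $A,C$ are $\mathfrak k$-valued and $B,E$ are $\mathfrak m$-valued and independent of $\lambda$. The regular set $\mathbb D\setminus\mathcal S$ of an extended framing $\Psi$ on $\mathbb D$ is the set of points at which $\Psi$ lies in both $\tilde\Lambda^-_*G_\sigma\cdot\tilde\Lambda^+G_\sigma$ and $\tilde\Lambda^+_*G_\sigma\cdot\tilde\Lambda^-G_\sigma$. A smooth $1$-form is (Lorentz) holomorphic if it is $h\,dx$ with $h_y=0$, and antiholomorphic if it is $h\,dy$ with $h_x=0$.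 The *Weierstraß representation* constructs $\psi$ on $U$ from loop-algebra-valued $1$-forms $\xi',\xi''$ if there are smooth solutions $\Psi',\Psi'':U\to\tilde\Lambda G_\sigma$ of $d\Psi'=\Psi'\xi'$, $d\Psi''=\Psi''\xi''$, $\Psi'(0,0)=\Psi''(0,0)=\mathbf 1$, which decompose at every point of $U$ as $\Psi'=\Psi L_-^{-1}$, $\Psi''=\Psi L_+^{-1}$ with $L_-\in\tilde\Lambda^-_*G_\sigma$ and $L_+\in\tilde\Lambda^+G_\sigma$, such that $\Psi$ is an extended framing of $\psi$ on $U$. **Theorem 4.4 (The normalized potentials).** Let $\psi:\mathbb D\to S^2_1$ be a harmonic map with $\psi(0,0)=\mathbf k'$ (that is, $\psi(0,0)=K$). Then there are an open set $R\subseteq\mathbb D$ containing $(0,0)$, an $\mathfrak m$-valued holomorphic $1$-form $\eta'$ on $R$ and an $\mathfrak m$-valued antiholomorphic $1$-form $\eta''$ on $R$ with the following properties. 1. For every extended framing $\Psi$ of $\psi$ on $\mathbb D$, the regular set $\mathbb D\setminus\mathcal S$ of $\Psi$ is $R$, and on $R$ $$\Psi=\Psi_-L_+=\Psi_+L_-,\qquad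 \Psi_\pm\in\tilde\Lambda^\pm_*G_\sigma,\quad L_\pm\in\tilde\Lambda^\pm G_\sigma,$$ with smooth factors that are unique at every point, and $$\eta'=\lambda^{-1}\,\Psi_+^{-1}d\Psi_+,\qquad \eta''=\lambda\,\Psi_-^{-1}d\Psi_- .$$ 2. Conversely, for every connected open set $U\subseteq R$ containing $(0,0)$, the Weierstraß representation constructs $\psi$ on $U$ from the potentials $\xi'=\lambda\eta'$ and $\xi''=\lambda^{-1}\eta''$, and $(\eta'|_U,\eta''|_U)$ is the only pair of an $\mathfrak m$-valued holomorphic and an $\mathfrak m$-valued antiholomorphic $1$-form on $U$ with this property. -/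

import Mathlib

open scoped ContDiff

noncomputable section

namespace TimelikeHarmonic

/-- Real `2 × 2` matrices; they contain `𝔤 = 𝔰𝔩(2, ℝ)`, i.e. Minkowski `3`-space. -/
abbrev MatR : Type := Matrix (Fin 2) (Fin 2) ℝ

/-- Complex `2 × 2` matrices, the values of loops at a complex loop parameter. -/
abbrev MatC : Type := Matrix (Fin 2) (Fin 2) ℂ

/-- The null coordinate plane, with coordinates `(x, y)` and metric `dx dy`. -/
abbrev Plane : Type := ℝ × ℝ

/-- `MatR`-valued `1`-forms on the plane. -/
abbrev Form : Type := Plane → (Plane →ₗ[ℝ] MatR)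

/-- The basis vector `𝐢` of `𝔰𝔩(2, ℝ)`. -/
def matI : MatR := !![0, -1; 1, 0]

/-- The basis vector `𝐣'` of `𝔰𝔩(2, ℝ)`. -/
def matJ : MatR := !![0, 1; 1, 0]

/-- The basis vector `𝐤'` of `𝔰𝔩(2, ℝ)`; it is the base point of `S²₁ = G/K`, the coset `K`. -/
def matK : MatR := !![-1, 0; 0, 1]

/-- The Lie algebra `𝔨 = ℝ 𝐤'` of the isotropy group of `𝐤'`. -/
def kPart : Submodule ℝ MatR := Submodule.span ℝ {matK}

/-- The complement `𝔪 = ℝ 𝐢 ⊕ ℝ 𝐣'`. -/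
def mPart : Submodule ℝ MatR := Submodule.span ℝ {matI, matJ}

/-- The Lorentzian scalar product `⟨X, Y⟩ = tr (X Y) / 2`. -/
def scalarProd (X Y : MatR) : ℝ := (1 / 2) * (X * Y).trace

/-- The pseudosphere `S²₁`: the `X ∈ 𝔰𝔩(2, ℝ)` with `⟨X, X⟩ = 1`. -/
def pseudosphere : Set MatR := {X | X.trace = 0 ∧ scalarProd X X = 1}

/-- A real matrix regarded as a complex one. -/
def toC (X : MatR) : MatC := X.map (fun t : ℝ => (t : ℂ))

/-- `Ad (g) X = g X g⁻¹`. -/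
def adAct (g X : MatC) : MatC := g * X * g⁻¹

section Calculus

variable {𝕂 : Type*} [NormedAddCommGroup 𝕂] [NormedSpace ℝ 𝕂]

/-- Matrix-valued maps that are (real) `C^∞` on a set, entry by entry. -/
def IsSmoothOn {X : Type*} [NormedAddCommGroup X] [NormedSpace ℝ X]
    (F : X → Matrix (Fin 2) (Fin 2) 𝕂) (U : Set X) : Prop :=
  ∀ i j, ContDiffOn ℝ ∞ (fun q => F q i j) U

/-- The differential `dF_p(v)` of a matrix-valued map, entry by entry. -/
def matDeriv (F : Plane → Matrix (Fin 2) (Fin 2) 𝕂) (p v : Plane) : Matrix (Fin 2) (Fin 2) 𝕂 :=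
  Matrix.of fun i j => fderiv ℝ (fun q => F q i j) p v

/-- `∂F/∂x`. -/
def partialX (F : Plane → Matrix (Fin 2) (Fin 2) 𝕂) (p : Plane) : Matrix (Fin 2) (Fin 2) 𝕂 :=
  matDeriv F p (1, 0)

/-- `∂F/∂y`. -/
def partialY (F : Plane → Matrix (Fin 2) (Fin 2) 𝕂) (p : Plane) : Matrix (Fin 2) (Fin 2) 𝕂 :=
  matDeriv F p (0, 1)

end Calculus

/-! ### Harmonic maps -/

/-- Orthogonal projection of the ambient space onto the tangent space of `S²₁` at `X`. -/
def tangentProj (X V : MatR) : MatR := V - scalarProd V X • X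

/-- The tension field `tr (∇ dψ)` of a map into `S²₁`. The Levi-Civita connection of `S²₁` is the
tangential part of the flat one, and for the metric `dx dy` (so `g(∂x, ∂y) = 1/2`) the trace of a
symmetric bilinear form `h` is `4 h(∂x, ∂y)`. -/
def tension (ψ : Plane → MatR) (p : Plane) : MatR :=
  (4 : ℝ) • tangentProj (ψ p) (partialX (partialY ψ) p)

/-- `ψ` is, on the open set `D`, a (smooth) harmonic map into `S²₁`. -/
structure IsHarmonicMap (D : Set Plane) (ψ : Plane → MatR) : Prop where
  smooth : IsSmoothOn ψ D
  mem : ∀ p ∈ D, ψ p ∈ pseudosphere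
  harmonic : ∀ p ∈ D, tension ψ p = 0

/-! ### Loop groups

A loop that extends analytically to `ℂ^*` is given by this extension. Only its values at nonzero
parameters matter. -/

/-- Loops, as functions of the loop parameter `λ ∈ ℂ^*`. -/
abbrev Loop : Type := ℂ → MatC

/-- Equality of loops on `ℂ^*`. -/
def LoopEq (γ δ : Loop) : Prop := ∀ z : ℂ, z ≠ 0 → γ z = δ z

/-- `γ(λ) = ∑ cⱼ λʲ` on `ℂ^*`, with real coefficient matrices. Such a series converges absolutely
at every nonzero parameter. -/
def HasLaurent (γ : Loop) (c : ℤ → MatR) : Prop :=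
  ∀ z : ℂ, z ≠ 0 → HasSum (fun j : ℤ => z ^ j • toC (c j)) (γ z)

/-- The twisted analytic loop group: real Laurent coefficients, analytic on `ℂ^*`, determinant
one, and `σ(γ(λ)) = γ(-λ)` with `σ = Ad 𝐤'`. -/
def loopGroup : Set Loop :=
  {γ | (∃ c, HasLaurent γ c) ∧ (∀ z : ℂ, z ≠ 0 → (γ z).det = 1) ∧
    ∀ z : ℂ, z ≠ 0 → adAct (toC matK) (γ z) = γ (-z)}

/-- Loops of the twisted group with nonnegative powers of `λ` only. -/
def loopPos : Set Loop :=
  {γ | γ ∈ loopGroup ∧ ∃ c, HasLaurent γ c ∧ ∀ j : ℤ, j < 0 → c j = 0}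

/-- Loops of the twisted group with nonpositive powers of `λ` only. -/
def loopNeg : Set Loop :=
  {γ | γ ∈ loopGroup ∧ ∃ c, HasLaurent γ c ∧ ∀ j : ℤ, 0 < j → c j = 0}

/-- Loops `𝟏 + ∑_{j > 0} cⱼ λʲ` of the twisted group. -/
def loopPosStar : Set Loop :=
  {γ | γ ∈ loopGroup ∧ ∃ c, HasLaurent γ c ∧ (∀ j : ℤ, j < 0 → c j = 0) ∧ c 0 = 1}

/-- Loops `𝟏 + ∑_{j < 0} cⱼ λʲ` of the twisted group. -/
def loopNegStar : Set Loop :=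
  {γ | γ ∈ loopGroup ∧ ∃ c, HasLaurent γ c ∧ (∀ j : ℤ, 0 < j → c j = 0) ∧ c 0 = 1}

/-- `γ = a · b` as loops. -/
def Splits (γ a b : Loop) : Prop := ∀ z : ℂ, z ≠ 0 → γ z = a z * b z

/-- The big cell of loops `γ₋ ℓ₊` with `γ₋` normalized. -/
def bigCellNegPos : Set Loop :=
  {γ | ∃ a ∈ loopNegStar, ∃ b ∈ loopPos, Splits γ a b}

/-- The big cell of loops `γ₊ ℓ₋` with `γ₊` normalized. -/
def bigCellPosNeg : Set Loop :=
  {γ | ∃ a ∈ loopPosStar, ∃ b ∈ loopNeg, Splits γ a b}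

/-- Smooth maps from the open set `U` to loops on `ℂ^*`: smooth jointly in the point and the
parameter. For loops analytic on `ℂ^*` this is smoothness for uniform convergence on compact
subsets of `ℂ^*`; it implies smoothness for the norm `∑ |cⱼ|`. -/
def IsSmoothLoopMap (U : Set Plane) (Ψ : Plane → Loop) : Prop :=
  IsSmoothOn (fun q : Plane × ℂ => Ψ q.1 q.2) (U ×ˢ {z : ℂ | z ≠ 0})

/-! ### Extended framings -/

/-- `Ψ` is, on the open set `D`, an extended framing of `ψ`. -/
structure IsExtendedFraming (D : Set Plane) (ψ : Plane → MatR) (Ψ : Plane → Loop) : Prop where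
  smooth : IsSmoothLoopMap D Ψ
  mem : ∀ p ∈ D, Ψ p ∈ loopGroup
  base : LoopEq (Ψ (0, 0)) (fun _ => 1)
  /-- The Maurer-Cartan form is `α₀ + λ α₁' + λ⁻¹ α₁''`, where `α₀ = A dx + C dy` is
  `𝔨`-valued, and `α₁' = B dx` and `α₁'' = E dy` are `𝔪`-valued. -/
  maurerCartan : ∃ A B C E : Plane → MatR, ∀ p ∈ D,
    A p ∈ kPart ∧ B p ∈ mPart ∧ C p ∈ kPart ∧ E p ∈ mPart ∧
    ∀ z : ℂ, z ≠ 0 →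
      (Ψ p z)⁻¹ * partialX (fun q => Ψ q z) p = toC (A p) + z • toC (B p) ∧
      (Ψ p z)⁻¹ * partialY (fun q => Ψ q z) p = toC (C p) + z⁻¹ • toC (E p)
  framing : ∀ p ∈ D, toC (ψ p) = adAct (Ψ p 1) (toC matK)

/-- The points of `D` at which `Ψ` lies in both big cells (the complement of the singular set). -/
def regularSet (D : Set Plane) (Ψ : Plane → Loop) : Set Plane :=
  {p | p ∈ D ∧ Ψ p ∈ bigCellNegPos ∧ Ψ p ∈ bigCellPosNeg}

/-- `Ψ = Ψ₋ L₊ = Ψ₊ L₋` on `U`, with smooth factors, and these are the only factors at each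
point. -/
structure IsBirkhoffSplitting (U : Set Plane) (Ψ Ψm Lp Ψp Lm : Plane → Loop) : Prop where
  smooth_Ψm : IsSmoothLoopMap U Ψm
  smooth_Lp : IsSmoothLoopMap U Lp
  smooth_Ψp : IsSmoothLoopMap U Ψp
  smooth_Lm : IsSmoothLoopMap U Lm
  mem : ∀ p ∈ U, Ψm p ∈ loopNegStar ∧ Lp p ∈ loopPos ∧ Ψp p ∈ loopPosStar ∧ Lm p ∈ loopNeg
  splits : ∀ p ∈ U, Splits (Ψ p) (Ψm p) (Lp p) ∧ Splits (Ψ p) (Ψp p) (Lm p)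
  unique_negPos : ∀ p ∈ U, ∀ a ∈ loopNegStar, ∀ b ∈ loopPos, Splits (Ψ p) a b →
    LoopEq a (Ψm p) ∧ LoopEq b (Lp p)
  unique_posNeg : ∀ p ∈ U, ∀ a ∈ loopPosStar, ∀ b ∈ loopNeg, Splits (Ψ p) a b →
    LoopEq a (Ψp p) ∧ LoopEq b (Lm p)

/-! ### Holomorphic and antiholomorphic forms -/

/-- An `𝔪`-valued Lorentz holomorphic `1`-form `η = h dx`, `∂h/∂y = 0`, on the open set `U`. -/
structure IsHolomorphicForm (U : Set Plane) (η : Form) : Prop where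
  smooth : ∀ v : Plane, IsSmoothOn (fun q => η q v) U
  mem : ∀ p ∈ U, ∀ v, η p v ∈ mPart
  type : ∀ p ∈ U, η p (0, 1) = 0
  holo : ∀ p ∈ U, partialY (fun q => η q (1, 0)) p = 0

/-- An `𝔪`-valued Lorentz antiholomorphic `1`-form `η = h dy`, `∂h/∂x = 0`, on the open
set `U`. -/
structure IsAntiholomorphicForm (U : Set Plane) (η : Form) : Prop where
  smooth : ∀ v : Plane, IsSmoothOn (fun q => η q v) U
  mem : ∀ p ∈ U, ∀ v, η p v ∈ mPart
  type : ∀ p ∈ U, η p (1, 0) = 0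
  antiholo : ∀ p ∈ U, partialX (fun q => η q (0, 1)) p = 0

/-! ### The Weierstraß representation -/

/-- Loop-valued `1`-forms `ξ`; the arguments of `ξ` are the point, the tangent vector and the
loop parameter. -/
abbrev LoopForm : Type := Plane → Plane → Loop

/-- `F` solves `dF = F ξ`, `F(0, 0) = 𝟏` on `U`, in the twisted loop group. If `ξ = h dx`, then
`F` does not depend on `y` locally and `∂F/∂x = F h`, and similarly for `ξ = h dy`. -/
structure IsIntegral (U : Set Plane) (ξ : LoopForm) (F : Plane → Loop) : Prop where
  smooth : IsSmoothLoopMap U F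
  mem : ∀ p ∈ U, F p ∈ loopGroup
  base : LoopEq (F (0, 0)) (fun _ => 1)
  eqn : ∀ p ∈ U, ∀ v : Plane, ∀ z : ℂ, z ≠ 0 →
    matDeriv (fun q => F q z) p v = F p z * ξ p v z

/-- `ψ` is constructed on `U` from the potentials `ξ'` and `ξ''`: the solutions `Ψ'`, `Ψ''` of the
two initial value problems exist on `U`, have at every point the Iwasawa decomposition
`(Ψ', Ψ'') = (Ψ, Ψ) (L₋⁻¹, L₊⁻¹)` with `L₋` normalized, and `Ψ` is an extended framing of `ψ`.
(On a connected open `U` these solutions and the decomposition are unique.) -/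
def WeierstrassConstructs (U : Set Plane) (ξ' ξ'' : LoopForm) (ψ : Plane → MatR) : Prop :=
  ∃ Ψ' Ψ'' : Plane → Loop, IsIntegral U ξ' Ψ' ∧ IsIntegral U ξ'' Ψ'' ∧
    ∃ Ψ Lm Lp : Plane → Loop,
      (∀ p ∈ U, Lm p ∈ loopNegStar ∧ Lp p ∈ loopPos ∧
        Splits (Ψ' p) (Ψ p) (fun z => (Lm p z)⁻¹) ∧
        Splits (Ψ'' p) (Ψ p) (fun z => (Lp p z)⁻¹)) ∧
      IsExtendedFraming U ψ Ψ

/-- The potential `λ η`. -/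
def potentialX (η : Form) : LoopForm := fun p v z => z • toC (η p v)

/-- The potential `λ⁻¹ η`. -/
def potentialY (η : Form) : LoopForm := fun p v z => z⁻¹ • toC (η p v)

end TimelikeHarmonic

end

open TimelikeHarmonic

open scoped ContDiff Topology BoundedContinuousFunction
open TimelikeHarmonic
open Set Filter Metric

set_option linter.unusedSectionVars false

/-! ### Parametrized functions as maps into spaces of continuous functions -/

section Slices

variable {E G M N : Type} [NormedAddCommGroup E] [NormedSpace ℝ E] [NormedAddCommGroup G]
  [NormedSpace ℝ G] [NormedAddCommGroup M] [NormedSpace ℝ M]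
  [NormedAddCommGroup N] [NormedSpace ℝ N]

/-! Seen as a field of matrices, a harmonic map is an f with f² = 1 and f_xy proportional to f. Put
X = -(1/2) f f_x and Y = -(1/2) f f_y. The form (z - 1) X dx + (z⁻¹ - 1) Y dy is flat for every z ≠
0, because the scalars a = z - 1 and b = z⁻¹ - 1 satisfy a + b + ab = 0
(`IsHarmonicInvolution.isFlatOn`). Integrating it over the simply connected region gives the
associated family F, with F = 1 at z = 1 (`exists_associatedFamily`). Multiplied by a classical
frame of ψ (`exists_frame`), F becomes an extended framing P (`exists_isFramingB`). For any extended
framing, P(z) P(1)⁻¹ solves this same flat equation, so two framings differ by a right factor κ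
independent of z (`IsFramingB.eq_mul`).

The loop groups become groups of holomorphic functions on ℂ^*: nonnegative powers only means a limit
at 0, nonpositive powers only a limit at ∞, and z ↦ z⁻¹ exchanges the two cases. Uniqueness of
Birkhoff factors is then Liouville's theorem (`IsNegPos.unique`), and it forces the factors to
inherit the reality and twisting conditions (`IsNegPos.isLoop`). Openness of the big cell and smooth
dependence of the factors reduce by translation to a neighbourhood of the loop 1 (`exists_negPos`).
There the factor comes from inverting a Toeplitz operator, which is the identity for the loop 1
(`exists_local_birkhoff`).

Let P = a b with a = 1 at ∞. Since P⁻¹ dP has at most a simple pole at 0, z a⁻¹ da has limits at 0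
and at ∞ and is therefore independent of z (`logDeriv_of_isNegPos`). Its value is b₀ E b₀⁻¹ dy,
where b₀ = b(0) and E is the coefficient of the pole; this is the antiholomorphic potential, and z ↦
z⁻¹ gives the holomorphic one (`exists_normalizedPotential`). A right factor κ changes neither the
big cells nor the left factors, so R and the potentials are the same for all framings.

Conversely, the left factors Ψ₊ and Ψ₋ themselves solve the two initial value problems, and a gauge
transformation of P normalizes L₋. For uniqueness, a solution of dF = F z β tends to 1 at z = 0
(`limAt_of_solvesAt`). Hence any decomposition in the Weierstraß representation is a pair of
Birkhoff splittings of an extended framing, its solutions are Ψ₊ and Ψ₋, and logarithmic derivatives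
recover the potentials.

Smoothness jointly in the point and the loop parameter is handled throughout by maps into Banach
spaces of continuous functions on a circle or disc, combined with Cauchy's formula
(`contDiffOn_slice`, `contDiffOn_of_slice`). -/

open Classical in
/-- The restriction of `f (p, ·)` to `K`, as a continuous function. -/
noncomputable def slice (K : Set G) (f : E × G → M) (p : E) : C(K, M) :=
  if h : Continuous (fun k : K => f (p, k)) then ⟨_, h⟩ else 0

theorem slice_apply {K : Set G} {f : E × G → M} {V : Set E} {W : Set (E × G)}
    (hf : ContinuousOn f W) (hVW : V ×ˢ K ⊆ W) {p : E} (hp : p ∈ V) (k : K) :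
    slice K f p k = f (p, k) := by
  have h : Continuous (fun k : K => f (p, k)) :=
    hf.comp_continuous (by fun_prop) fun k => hVW ⟨hp, k.2⟩
  simp [slice, h]

theorem continuousOn_slice {K : Set G} [CompactSpace K] {f : E × G → M} {V : Set E}
    {W : Set (E × G)} (hf : ContinuousOn f W) (hVW : V ×ˢ K ⊆ W) :
    ContinuousOn (slice K f) V := by
  rw [continuousOn_iff_continuous_domRestrict]
  let F : C(V × K, M) := ⟨fun q => f (q.1, q.2),
    hf.comp_continuous (by fun_prop) fun q => hVW ⟨q.1.2, q.2.2⟩⟩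
  have : V.domRestrict (slice K f) = F.curry := by
    funext p
    ext k
    simp only [Set.domRestrict_apply]
    rw [slice_apply hf hVW p.2]
    rfl
  rw [this]
  exact F.curry.continuous

/-- Pointwise evaluation of a continuous family of operators. -/
noncomputable def familyToOperator (K : Set G) [CompactSpace K] :
    C(K, E →L[ℝ] M) →L[ℝ] (E →L[ℝ] C(K, M)) :=
  LinearMap.mkContinuous₂
    (LinearMap.mk₂ ℝ (fun (φ : C(K, E →L[ℝ] M)) (e : E) =>
        (⟨fun k => φ k e, by fun_prop⟩ : C(K, M)))
      (by intros; ext; simp) (by intros; ext; simp) (by intros; ext; simp)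
      (by intros; ext; simp)) 1
    (by
      intro φ e
      rw [ContinuousMap.norm_le _ (by positivity)]
      intro k
      calc ‖φ k e‖ ≤ ‖φ k‖ * ‖e‖ := (φ k).le_opNorm e
        _ ≤ 1 * ‖φ‖ * ‖e‖ := by
          rw [one_mul]; gcongr; exact φ.norm_coe_le_norm k)

@[simp] theorem familyToOperator_apply (K : Set G) [CompactSpace K] (φ : C(K, E →L[ℝ] M))
    (e : E) (k : K) : familyToOperator K φ e k = φ k e := rfl

/-- The slice of the partial derivative varies continuously in the uniform norm, so the mean value
inequality bounds the remainder uniformly in k. -/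
theorem hasFDerivAt_slice {K : Set G} [CompactSpace K] {f : E × G → M} {V : Set E}
    {W : Set (E × G)} (hV : IsOpen V) (hW : IsOpen W) (hf : ContDiffOn ℝ 1 f W)
    (hVW : V ×ˢ K ⊆ W) {p : E} (hp : p ∈ V) :
    HasFDerivAt (slice K f) (familyToOperator K (slice K
      (fun q => (fderiv ℝ f q).comp (ContinuousLinearMap.inl ℝ E G)) p)) p := by
  set g : E × G → (E →L[ℝ] M) := fun q => (fderiv ℝ f q).comp (ContinuousLinearMap.inl ℝ E G)
  have hg : ContinuousOn g W := by
    have := hf.continuousOn_fderiv_of_isOpen hW le_rfl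
    exact this.clm_comp continuousOn_const
  have hgs := (continuousOn_slice hg hVW).continuousAt (hV.mem_nhds hp)
  refine HasFDerivAt.of_isLittleO (Asymptotics.isLittleO_iff.2 fun c hc => ?_)
  have h1 : ∀ᶠ q in 𝓝 p, q ∈ V ∧ ‖slice K g q - slice K g p‖ ≤ c := by
    refine (show ∀ᶠ q in 𝓝 p, q ∈ V from hV.mem_nhds hp).and ?_
    filter_upwards [Metric.tendsto_nhds.1 hgs c hc] with q hq
    rw [dist_eq_norm_sub] at hq
    exact hq.le
  obtain ⟨δ, hδ, hball⟩ := Metric.eventually_nhds_iff_ball.1 h1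
  filter_upwards [ball_mem_nhds p hδ] with q hq
  rw [ContinuousMap.norm_le _ (by positivity)]
  intro k
  have hqV := (hball q hq).1
  simp only [ContinuousMap.sub_apply, familyToOperator_apply]
  rw [slice_apply hf.continuousOn hVW hqV, slice_apply hf.continuousOn hVW hp,
    slice_apply hg hVW hp]
  -- For fixed k the derivative of f(·, k) stays within c of its value at p on the whole ball, and c
  -- does not depend on k.
  refine Convex.norm_image_sub_le_of_norm_hasFDerivWithin_le' (f := fun q => f (q, (k : G)))
    (f' := fun q => g (q, k)) (s := ball p δ) ?_ ?_ (convex_ball p δ) (mem_ball_self hδ) hq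
  · intro x hx
    have hxW : (x, (k : G)) ∈ W := hVW ⟨(hball x hx).1, k.2⟩
    have hd := ((hf.differentiableOn one_ne_zero).differentiableAt (hW.mem_nhds hxW)).hasFDerivAt
    exact (hd.comp x (hasFDerivAt_prodMk_left x (k : G))).hasFDerivWithinAt
  · intro x hx
    have h2 := (slice K g x - slice K g p).norm_coe_le_norm k
    rw [ContinuousMap.sub_apply, slice_apply hg hVW (hball x hx).1, slice_apply hg hVW hp] at h2
    exact h2.trans (hball x hx).2

theorem contDiffOn_slice {K : Set G} [CompactSpace K] {f : E × G → M} {V : Set E}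
    {W : Set (E × G)} (hV : IsOpen V) (hW : IsOpen W) (hf : ContDiffOn ℝ ∞ f W)
    (hVW : V ×ˢ K ⊆ W) : ContDiffOn ℝ ∞ (slice K f) V := by
  rw [contDiffOn_infty]
  intro n
  -- The target has to vary: the derivative is the slice of a family with values in `E →L[ℝ] M`.
  induction n generalizing M with
  | zero => exact contDiffOn_zero.2 (continuousOn_slice hf.continuousOn hVW)
  | succ n ih =>
    have hd := fun p hp => hasFDerivAt_slice (p := p) hV hW (hf.of_le (by simp)) hVW hp
    push_cast
    rw [contDiffOn_succ_iff_fderiv_of_isOpen hV]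
    refine ⟨fun p hp => (hd p hp).differentiableAt.differentiableWithinAt, by simp, ?_⟩
    have hg : ContDiffOn ℝ ∞
        (fun q => (fderiv ℝ f q).comp (ContinuousLinearMap.inl ℝ E G)) W :=
      (hf.fderiv_of_isOpen hW (by simp)).clm_comp contDiffOn_const
    refine ContDiffOn.congr ?_ fun p hp => (hd p hp).fderiv
    exact (familyToOperator K).contDiff.comp_contDiffOn (ih hg)

end Slices

/-! ### The Cauchy integral on continuous functions on a circle -/

section Cauchy

variable {M : Type} [NormedAddCommGroup M] [NormedSpace ℂ M]

instance (z₀ : ℂ) (r : ℝ) : CompactSpace (sphere z₀ r) :=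
  isCompact_iff_compactSpace.1 (isCompact_sphere z₀ r)

/-- `(2πi)⁻¹ ∮ φ` as a linear functional on continuous functions on a circle. -/
noncomputable def circleAux (z₀ : ℂ) (r : ℝ) (hr : 0 ≤ r) : C(sphere z₀ r, M) →ₗ[ℂ] M where
  toFun := fun φ => (2 * Real.pi * Complex.I : ℂ)⁻¹ • ∫ θ in (0 : ℝ)..2 * Real.pi,
    deriv (circleMap z₀ r) θ • φ ⟨circleMap z₀ r θ, circleMap_mem_sphere z₀ hr θ⟩
  map_add' := by
    intro φ χ
    rw [← smul_add, ← intervalIntegral.integral_add]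
    · simp
    all_goals
      apply Continuous.intervalIntegrable
      simp only [deriv_circleMap]
      fun_prop
  map_smul' := by
    intro c φ
    simp only [RingHom.id_apply, ContinuousMap.smul_apply,
      smul_comm (deriv (circleMap z₀ r) _) c, intervalIntegral.integral_smul]
    exact smul_comm _ _ _

theorem norm_circleAux_le (z₀ : ℂ) (r : ℝ) (hr : 0 ≤ r) (φ : C(sphere z₀ r, M)) :
    ‖circleAux z₀ r hr φ‖ ≤ r * ‖φ‖ := by
  simp only [circleAux, LinearMap.coe_mk, AddHom.coe_mk]
  rw [norm_smul]
  have h : ‖∫ θ in (0 : ℝ)..2 * Real.pi, deriv (circleMap z₀ r) θ •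
      φ ⟨circleMap z₀ r θ, circleMap_mem_sphere z₀ hr θ⟩‖ ≤
      (r * ‖φ‖) * |2 * Real.pi - 0| := by
    refine intervalIntegral.norm_integral_le_of_norm_le_const fun θ _ => ?_
    rw [norm_smul]
    gcongr
    · simp [deriv_circleMap, abs_of_nonneg hr]
    · exact φ.norm_coe_le_norm _
  have hpi : ‖(2 * Real.pi * Complex.I : ℂ)⁻¹‖ = (2 * Real.pi)⁻¹ := by
    simp [abs_of_pos Real.pi_pos]
  rw [hpi]
  calc _ ≤ (2 * Real.pi)⁻¹ * ((r * ‖φ‖) * |2 * Real.pi - 0|) := by gcongr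
    _ = r * ‖φ‖ := by
      rw [sub_zero, abs_of_pos (by positivity)]
      field_simp

/-- `(2πi)⁻¹ ∮ φ` as a continuous linear functional on continuous functions on a circle. -/
noncomputable def circleFunctional (z₀ : ℂ) (r : ℝ) (hr : 0 ≤ r) :
    C(sphere z₀ r, M) →L[ℂ] M :=
  LinearMap.mkContinuous (circleAux z₀ r hr) r (norm_circleAux_le z₀ r hr)

theorem circleFunctional_apply {z₀ : ℂ} {r : ℝ} (hr : 0 ≤ r) (φ : C(sphere z₀ r, M))
    (f : ℂ → M) (h : ∀ w : sphere z₀ r, φ w = f w) :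
    circleFunctional z₀ r hr φ = (2 * Real.pi * Complex.I : ℂ)⁻¹ • ∮ w in C(z₀, r), f w := by
  simp only [circleFunctional, circleAux, LinearMap.mkContinuous_apply, LinearMap.coe_mk, AddHom.coe_mk,
    circleIntegral, h]

theorem norm_circleFunctional_le {z₀ : ℂ} {r : ℝ} (hr : 0 ≤ r) (φ : C(sphere z₀ r, M)) :
    ‖circleFunctional z₀ r hr φ‖ ≤ r * ‖φ‖ :=
  (circleFunctional z₀ r hr).le_of_opNorm_le (LinearMap.mkContinuous_norm_le _ hr (norm_circleAux_le z₀ r hr)) φ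

/-- The inclusion of a subset of `ℂ`, as a continuous function. -/
def inclMap (K : Set ℂ) : C(K, ℂ) := ⟨Subtype.val, continuous_subtype_val⟩

/-- The Cauchy kernel `w ↦ (w - z)⁻¹` on `K`. -/
noncomputable def cauchyKernel (K : Set ℂ) (z : ℂ) : C(K, ℂ) :=
  Ring.inverse (inclMap K - algebraMap ℂ C(K, ℂ) z)

theorem isUnit_inclMap_sub {K : Set ℂ} {z : ℂ} (hz : z ∉ K) :
    IsUnit (inclMap K - algebraMap ℂ C(K, ℂ) z) := by
  rw [ContinuousMap.isUnit_iff_forall_ne_zero]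
  intro w h
  apply hz
  have : (w : ℂ) = z := by simpa [inclMap, sub_eq_zero] using h
  exact this ▸ w.2

theorem cauchyKernel_apply {K : Set ℂ} {z : ℂ} (hz : z ∉ K) (w : K) :
    cauchyKernel K z w = ((w : ℂ) - z)⁻¹ := by
  have h := Ring.inverse_mul_cancel _ (isUnit_inclMap_sub hz)
  have h2 := congrArg (fun φ : C(K, ℂ) => φ w) h
  simp only [ContinuousMap.mul_apply, ContinuousMap.one_apply] at h2
  exact eq_inv_of_mul_eq_one_left h2

/-- The kernel is the inverse of an affine function of z in the Banach algebra C(K, ℂ), and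
inversion is smooth at units. -/
theorem contDiffAt_cauchyKernel {K : Set ℂ} [CompactSpace K] {z : ℂ} (hz : z ∉ K) :
    ContDiffAt ℂ ∞ (cauchyKernel K) z := by
  obtain ⟨u, hu⟩ := isUnit_inclMap_sub hz
  have h1 : ContDiffAt ℂ ∞ (fun z => inclMap K - algebraMap ℂ C(K, ℂ) z) z :=
    (contDiff_const.sub (Algebra.linearMap ℂ C(K, ℂ)).toContinuousLinearMap.contDiff).contDiffAt
  have h2 : ContDiffAt ℂ ∞ Ring.inverse (inclMap K - algebraMap ℂ C(K, ℂ) z) := by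
    rw [← hu]; exact contDiffAt_ringInverse ℂ u
  exact h2.comp z h1

/-- Pointwise scalar multiplication of continuous functions, as a bounded bilinear map. -/
noncomputable def smulBilin (K : Set ℂ) [CompactSpace K] :
    C(K, ℂ) →L[ℂ] C(K, M) →L[ℂ] C(K, M) :=
  LinearMap.mkContinuous₂
    (LinearMap.mk₂ ℂ (fun (κ : C(K, ℂ)) (φ : C(K, M)) =>
        (⟨fun k => κ k • φ k, by fun_prop⟩ : C(K, M)))
      (by intros; ext; simp [add_smul]) (by intros; ext; simp [mul_smul])
      (by intros; ext; simp) (by intro c κ φ; ext k; simp [smul_comm c])) 1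
    (by
      intro κ φ
      rw [ContinuousMap.norm_le _ (by positivity)]
      intro k
      calc ‖κ k • φ k‖ = ‖κ k‖ * ‖φ k‖ := norm_smul _ _
        _ ≤ 1 * ‖κ‖ * ‖φ‖ := by
          rw [one_mul]; gcongr; exacts [κ.norm_coe_le_norm k, φ.norm_coe_le_norm k])

@[simp] theorem smulBilin_apply (K : Set ℂ) [CompactSpace K] (κ : C(K, ℂ)) (φ : C(K, M))
    (k : K) : smulBilin K κ φ k = κ k • φ k := rfl

theorem cauchy_formula [CompleteSpace M] {z₀ z : ℂ} {r : ℝ} (hr : 0 ≤ r) (hz : z ∈ ball z₀ r)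
    {f : ℂ → M} (hf : DiffContOnCl ℂ f (ball z₀ r)) (φ : C(sphere z₀ r, M))
    (h : ∀ w : sphere z₀ r, φ w = f w) :
    circleFunctional z₀ r hr (smulBilin _ (cauchyKernel _ z) φ) = f z := by
  have hz' : z ∉ sphere z₀ r := fun h => (ne_of_lt (mem_ball.1 hz)) (mem_sphere.1 h)
  rw [circleFunctional_apply hr _ (fun w => (w - z)⁻¹ • f w)]
  · exact hf.two_pi_i_inv_smul_circleIntegral_sub_inv_smul hz
  · intro w
    rw [smulBilin_apply, cauchyKernel_apply hz', h]

variable {E : Type} [NormedAddCommGroup E] [NormedSpace ℝ E]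

/-- A family of functions, holomorphic on a disc, that depends smoothly on a parameter on the
boundary circle does so jointly in the disc. -/
theorem contDiffOn_of_slice [NormedSpace ℝ M] [IsScalarTower ℝ ℂ M] [CompleteSpace M] {V : Set E}
    {z₀ : ℂ} {r : ℝ} (hr : 0 ≤ r) {f : E → ℂ → M} {Φ : E → C(sphere z₀ r, M)}
    (hΦ : ContDiffOn ℝ ∞ Φ V) (hf : ∀ p ∈ V, DiffContOnCl ℂ (f p) (ball z₀ r))
    (h : ∀ p ∈ V, ∀ w : sphere z₀ r, Φ p w = f p w) :
    ContDiffOn ℝ ∞ (fun q : E × ℂ => f q.1 q.2) (V ×ˢ ball z₀ r) := by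
  -- The Cauchy integral is a bounded functional of the product of the kernel, smooth in z, and the
  -- boundary values, smooth in the parameter.
  have key : ContDiffOn ℝ ∞ (fun q : E × ℂ => circleFunctional z₀ r hr
      (smulBilin _ (cauchyKernel (sphere z₀ r) q.2) (Φ q.1))) (V ×ˢ ball z₀ r) := by
    refine ((circleFunctional z₀ r hr).restrictScalars ℝ).contDiff.comp_contDiffOn ?_
    have hκ : ContDiffOn ℝ ∞ (fun q : E × ℂ => cauchyKernel (sphere z₀ r) q.2)
        (V ×ˢ ball z₀ r) := by
      intro q hq
      have hz' : q.2 ∉ sphere z₀ r :=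
        fun h => (ne_of_lt (mem_ball.1 hq.2)) (mem_sphere.1 h)
      exact (((contDiffAt_cauchyKernel hz').restrict_scalars ℝ).comp q
        contDiffAt_snd).contDiffWithinAt
    have hΦ' : ContDiffOn ℝ ∞ (fun q : E × ℂ => Φ q.1) (V ×ˢ ball z₀ r) :=
      hΦ.comp contDiffOn_fst fun q hq => hq.1
    exact (((smulBilin (M := M) (sphere z₀ r)).bilinearRestrictScalars ℝ).isBoundedBilinearMap).contDiff.comp_contDiffOn
      (hκ.prodMk hΦ')
  exact key.congr fun q hq => (cauchy_formula hr hq.2 (hf q.1 hq.1) _ (h q.1 hq.1)).symm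

end Cauchy

/-! ### Gluing local sections of a flat bundle over a simply connected space -/

/-- Locally constant transitions define a bundle with discrete fibre G, that is, a covering; over a
simply connected base the identity lifts to a section of it. In the chart i a section c stands for
the map c F_i, and this is what becomes global. -/
theorem exists_global_of_locally_constant_transition {X G : Type} [TopologicalSpace X]
    [SimplyConnectedSpace X] [LocallyPathConnectedSpace X] [Group G] (U : X → Set X)
    (hU : ∀ i, IsOpen (U i)) (hmem : ∀ i, i ∈ U i) (F : X → X → G)
    (hF : ∀ i j, ∀ x ∈ U i ∩ U j, ∀ᶠ y in 𝓝 x, F i y * (F j y)⁻¹ = F i x * (F j x)⁻¹)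
    (x₀ : X) (g₀ : G) :
    ∃ S : X → G, S x₀ = g₀ ∧ ∀ x, ∃ g, ∀ᶠ y in 𝓝 x, S y = g * F x y := by
  let : TopologicalSpace G := ⊥
  have : DiscreteTopology G := ⟨rfl⟩
  let Z : FiberBundleCore X X G :=
    { baseSet := U
      isOpen_baseSet := hU
      indexAt := id
      mem_baseSet_at := hmem
      -- The coordinate g in chart i and g' in chart j describe the same map when g F_i = g' F_j.
      coordChange := fun i j x g => g * (F i x * (F j x)⁻¹)
      coordChange_self := by intros; simp
      continuousOn_coordChange := by
        intro i j
        rintro ⟨x, g⟩ ⟨hx, -⟩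
        refine ContinuousAt.continuousWithinAt ?_
        refine (continuousAt_const (y := g * (F i x * (F j x)⁻¹))).congr ?_
        have h2 : ∀ᶠ g' in 𝓝 g, g' = g := by simp
        rw [nhds_prod_eq]
        filter_upwards [(hF i j x hx).prod_mk h2] with q hq
        rw [hq.1, hq.2]
      coordChange_comp := by intros; group }
  have hcov : IsCoveringMap (Bundle.TotalSpace.proj : Z.TotalSpace → X) :=
    FiberBundle.isCoveringMap (F := G) (E := Z.Fiber)
  obtain ⟨s, ⟨hs0, hs⟩, -⟩ := hcov.existsUnique_continuousMap_lifts (ContinuousMap.id X) x₀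
    -- This starting point of the lift makes c F equal to g₀ at x₀.
    (⟨x₀, (g₀ * (F x₀ x₀)⁻¹ : G)⟩ : Z.TotalSpace) rfl
  have hproj : ∀ y, (s y).proj = y := fun y => congrFun hs y
  let c : X → G := fun y => (s y).2
  refine ⟨fun y => c y * F y y, ?_, fun x => ?_⟩
  · have : c x₀ = g₀ * (F x₀ x₀)⁻¹ := by
      simp only [c]
      rw [hs0]
    change c x₀ * F x₀ x₀ = g₀
    rw [this]; group
  · have hloc : ContinuousAt (fun y => (Z.localTriv x (s y)).2) x := by
      refine continuousAt_snd.comp ?_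
      refine ContinuousAt.comp (f := s) ?_ s.continuous.continuousAt
      refine (Z.localTriv x).continuousAt ?_
      rw [Z.mem_localTriv_source, hproj x]
      exact hmem x
    refine ⟨(Z.localTriv x (s x)).2, ?_⟩
    have h3 := hloc.eventually (show ∀ᶠ g' in 𝓝 (Z.localTriv x (s x)).2,
      g' = (Z.localTriv x (s x)).2 by simp)
    filter_upwards [h3] with y hy
    rw [← hy, Z.localTriv_apply]
    have h4 : (s y).proj = y := hproj y
    change c y * F y y = c y * (F (id (s y).proj) (s y).proj * (F x (s y).proj)⁻¹) * F x y
    rw [h4]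
    simp [mul_assoc]

/-! ### Flat connections with values in a Banach algebra -/

section Primitive

variable {B : Type} [NormedAddCommGroup B] [NormedSpace ℝ B]

/-- The primitive vanishing at `0`, as a linear map. -/
noncomputable def primitiveAux : C(Icc (0 : ℝ) 1, B) →ₗ[ℝ] C(Icc (0 : ℝ) 1, B) where
  toFun := fun φ => ⟨fun t => ∫ s in (0 : ℝ)..t, IccExtend zero_le_one φ s,
    (intervalIntegral.continuous_primitive
      (fun a b => (φ.continuous.Icc_extend').intervalIntegrable a b) 0).comp
        continuous_subtype_val⟩
  map_add' := by
    intro φ χ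
    ext t
    simp only [ContinuousMap.coe_mk, ContinuousMap.add_apply]
    rw [← intervalIntegral.integral_add]
    · rfl
    all_goals exact (ContinuousMap.continuous _).Icc_extend'.intervalIntegrable _ _
  map_smul' := by
    intro c φ
    ext t
    simp only [ContinuousMap.coe_mk, ContinuousMap.smul_apply, RingHom.id_apply]
    rw [← intervalIntegral.integral_smul]
    rfl

theorem norm_primitiveAux_le (φ : C(Icc (0 : ℝ) 1, B)) : ‖primitiveAux φ‖ ≤ 1 * ‖φ‖ := by
  rw [ContinuousMap.norm_le _ (by positivity)]
  intro t
  have h := intervalIntegral.norm_integral_le_of_norm_le_const (a := (0 : ℝ)) (b := t)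
    (f := IccExtend zero_le_one φ) (C := ‖φ‖) fun s _ => φ.norm_coe_le_norm _
  refine h.trans ?_
  rw [sub_zero, abs_of_nonneg t.2.1, mul_comm]
  gcongr
  exact t.2.2

/-- The primitive vanishing at `0`. -/
noncomputable def primitiveCLM : C(Icc (0 : ℝ) 1, B) →L[ℝ] C(Icc (0 : ℝ) 1, B) :=
  primitiveAux.mkContinuous 1 norm_primitiveAux_le

theorem primitiveCLM_apply (φ : C(Icc (0 : ℝ) 1, B)) (t : Icc (0 : ℝ) 1) :
    primitiveCLM φ t = ∫ s in (0 : ℝ)..t, IccExtend zero_le_one φ s := rfl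

end Primitive

/-! ### Uniqueness and regularity of solutions of dF = F α; the Volterra operator. -/

section Flat

variable {E A : Type} [NormedAddCommGroup E] [NormedSpace ℝ E] [NormedRing A] [NormedAlgebra ℝ A]
  [CompleteSpace A]

/-- `dF = F α` at `p`. -/
def SolvesAt (α : E → E →L[ℝ] A) (F : E → A) (p : E) : Prop :=
  HasFDerivAt F ((ContinuousLinearMap.mul ℝ A (F p)).comp (α p)) p

/-- The curvature of `α` vanishes on `D`. -/
def IsFlatOn (α : E → E →L[ℝ] A) (D : Set E) : Prop :=
  ∀ p ∈ D, ∀ v w, fderiv ℝ α p v w - fderiv ℝ α p w v + α p v * α p w - α p w * α p v = 0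

/-- The Volterra operator `V ↦ ∫₀ᵗ V β`. -/
noncomputable def volterra :
    C(Icc (0 : ℝ) 1, A) →L[ℝ] C(Icc (0 : ℝ) 1, A) →L[ℝ] C(Icc (0 : ℝ) 1, A) :=
  ((ContinuousLinearMap.compL ℝ _ _ _) primitiveCLM).comp
    (ContinuousLinearMap.mul ℝ C(Icc (0 : ℝ) 1, A)).flip

theorem volterra_apply (β V : C(Icc (0 : ℝ) 1, A)) : volterra β V = primitiveCLM (V * β) := rfl

theorem norm_volterra_le (β : C(Icc (0 : ℝ) 1, A)) : ‖volterra β‖ ≤ ‖β‖ := by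
  refine ContinuousLinearMap.opNorm_le_bound _ (norm_nonneg _) fun V => ?_
  rw [volterra_apply]
  calc _ ≤ 1 * ‖V * β‖ :=
        norm_primitiveAux_le _
    _ ≤ ‖β‖ * ‖V‖ := by rw [one_mul, mul_comm]; exact norm_mul_le _ _

theorem SolvesAt.differentiableAt {α : E → E →L[ℝ] A} {F : E → A} {p : E} (h : SolvesAt α F p) :
    DifferentiableAt ℝ F p := HasFDerivAt.differentiableAt h

theorem SolvesAt.fderiv_apply {α : E → E →L[ℝ] A} {F : E → A} {p : E} (h : SolvesAt α F p)
    (v : E) : fderiv ℝ F p v = F p * α p v := by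
  rw [HasFDerivAt.fderiv h]; rfl

theorem SolvesAt.const_mul {α : E → E →L[ℝ] A} {F : E → A} {p : E} (h : SolvesAt α F p)
    (g : A) : SolvesAt α (fun q => g * F q) p := by
  have := HasFDerivAt.const_mul h g
  refine this.congr_fderiv ?_
  ext v
  simp [mul_assoc]

theorem SolvesAt.congr {α : E → E →L[ℝ] A} {F G : E → A} {p : E} (h : SolvesAt α F p)
    (hG : G =ᶠ[𝓝 p] F) : SolvesAt α G p := by
  have := HasFDerivAt.congr_of_eventuallyEq h hG
  rwa [← hG.eq_of_nhds] at this

/-- Solutions are as smooth as the form allows. -/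
theorem contDiffOn_of_solvesAt {α : E → E →L[ℝ] A} {F : E → A} {D : Set E} (hD : IsOpen D)
    (hα : ContDiffOn ℝ ∞ α D) (h : ∀ p ∈ D, SolvesAt α F p) : ContDiffOn ℝ ∞ F D := by
  rw [contDiffOn_infty]
  intro n
  induction n with
  | zero =>
    exact contDiffOn_zero.2 fun p hp => (h p hp).differentiableAt.continuousAt.continuousWithinAt
  | succ n ih =>
    push_cast
    rw [contDiffOn_succ_iff_fderiv_of_isOpen hD]
    refine ⟨fun p hp => (h p hp).differentiableAt.differentiableWithinAt, by simp, ?_⟩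
    refine ContDiffOn.congr ?_ fun p hp => HasFDerivAt.fderiv (h p hp)
    exact ((ContinuousLinearMap.mul ℝ A).contDiff.comp_contDiffOn ih).clm_comp
      (hα.of_le (by exact_mod_cast le_top))

/-- Two solutions differ by a constant left factor. -/
theorem eq_mul_of_solvesAt {α : E → E →L[ℝ] A} {F : E → A} {G : E → Aˣ} {D : Set E}
    (hD : IsOpen D) (hc : IsPreconnected D) (hF : ∀ p ∈ D, SolvesAt α F p)
    (hG : ∀ p ∈ D, SolvesAt α (fun q => (G q : A)) p) {p q : E} (hp : p ∈ D) (hq : q ∈ D) :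
    F q * ((G q)⁻¹ : Aˣ) = F p * ((G p)⁻¹ : Aˣ) := by
  -- The two contributions to d(F G⁻¹), namely F α G⁻¹ and -F G⁻¹ (G α) G⁻¹, cancel.
  have key : ∀ x ∈ D, HasFDerivAt (fun y => F y * Ring.inverse (G y : A)) (0 : E →L[ℝ] A) x := by
    intro x hx
    have h1 := (hasFDerivAt_ringInverse (𝕜 := ℝ) (G x)).comp x (hG x hx)
    have h2 := HasFDerivAt.mul' (hF x hx) h1
    refine h2.congr_fderiv ?_
    ext v
    simp [mul_assoc]
  have := hD.is_const_of_fderiv_eq_zero hc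
    (fun x hx => (key x hx).differentiableAt.differentiableWithinAt)
    (fun x hx => (key x hx).fderiv) hq hp
  simpa using this

/-- Since F G⁻¹ is constant, equality at one point spreads over a connected set. Symmetries of
loops, dependence on the loop parameter and uniqueness of framings are all derived from this. -/
theorem SolvesAt.eq_of_eq {α : E → E →L[ℝ] A} {F : E → A} {G : E → A} {D : Set E}
    (hD : IsOpen D) (hc : IsPreconnected D) (hF : ∀ p ∈ D, SolvesAt α F p)
    (hG : ∀ p ∈ D, SolvesAt α G p) (hu : ∀ p ∈ D, IsUnit (G p)) {p : E} (hp : p ∈ D)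
    (h : F p = G p) {q : E} (hq : q ∈ D) : F q = G q := by
  classical
  let G' : E → Aˣ := fun x => if hx : IsUnit (G x) then hx.unit else 1
  have hG' : ∀ x ∈ D, (G' x : A) = G x := fun x hx => by simp [G', hu x hx]
  have h1 := eq_mul_of_solvesAt hD hc hF (G := G') (fun x hx => (hG x hx).congr ?_) hp hq
  · rw [h, ← hG' p hp, Units.mul_inv, Units.mul_inv_eq_iff_eq_mul, one_mul, hG' q hq] at h1
    exact h1
  · filter_upwards [hD.mem_nhds hx] with y hy using hG' y hy

end Flat

/-! ### Integration of flat forms, locally along rays and then globally. -/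

section LocalSolution

variable {E A : Type} [NormedAddCommGroup E] [NormedSpace ℝ E] [NormedRing A] [NormedAlgebra ℝ A]
  [CompleteSpace A]

/-- Here S is the solution along the ray s ↦ p₀ + s v, and β and a are the values of α on v and on w
along it. Moving v in the direction w changes β by βw, once flatness has replaced ∂_w α(v) by ∂_v
α(w) + [α(v), α(w)]. As dF = F α is expected, the variation of S should be s S a; that it solves the
linearized Volterra equation is the product rule. -/
theorem volterra_variation {S β βw Y : C(Icc (0 : ℝ) 1, A)} (hS : S = 1 + volterra β S)
    {a a' : ℝ → A} (ha : ∀ s ∈ Icc (0 : ℝ) 1, HasDerivAt a (a' s) s)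
    (hβw : ∀ s : Icc (0 : ℝ) 1, βw s = (s : ℝ) • (a' s + β s * a s - a s * β s) + a s)
    (hY : ∀ s : Icc (0 : ℝ) 1, Y s = (s : ℝ) • (S s * a s)) :
    Y = volterra βw S + volterra β Y := by
  rw [volterra_apply, volterra_apply, ← map_add]
  ext t
  rw [primitiveCLM_apply]
  -- An extension of S to the whole line, differentiable at every real s, as the fundamental theorem
  -- of calculus requires.
  let S' : ℝ → A := fun s => 1 + ∫ x in (0 : ℝ)..s, IccExtend zero_le_one (S * β : C(Icc (0 : ℝ) 1, A)) x
  have hS' : ∀ s : Icc (0 : ℝ) 1, S' s = S s := by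
    intro s
    conv_rhs => rw [hS]
    rw [volterra_apply, ContinuousMap.add_apply, primitiveCLM_apply]
    rfl
  have hc : ∀ φ : C(Icc (0 : ℝ) 1, A), Continuous (IccExtend zero_le_one φ) :=
    fun φ => φ.continuous.Icc_extend'
  have hder : ∀ s, HasDerivAt S' (IccExtend zero_le_one (S * β : C(Icc (0 : ℝ) 1, A)) s) s := fun s =>
    ((hc _).integral_hasStrictDerivAt 0 s).hasDerivAt.const_add 1
  have hsub : uIcc (0 : ℝ) t ⊆ Icc 0 1 := by
    rw [uIcc_of_le t.2.1]
    exact Icc_subset_Icc le_rfl t.2.2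
  have h := intervalIntegral.integral_eq_sub_of_hasDerivAt (a := (0 : ℝ)) (b := t)
    (f := fun s => s • (S' s * a s)) (f' := IccExtend zero_le_one (S * βw + Y * β : C(Icc (0 : ℝ) 1, A))) ?_
    ((hc _).intervalIntegrable _ _)
  · rw [h, hY t, hS']
    simp
  · intro s hs
    have hsI := hsub hs
    have h1 := (hasDerivAt_id s).smul ((hder s).mul (ha s hsI))
    refine h1.congr_deriv ?_
    have e1 := hS' ⟨s, hsI⟩
    simp only at e1
    rw [IccExtend_of_mem _ _ hsI, IccExtend_of_mem _ _ hsI]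
    simp only [ContinuousMap.mul_apply, ContinuousMap.add_apply]
    rw [hY, hβw]
    simp only [e1, id, Pi.mul_apply, one_smul]
    simp only [mul_add, mul_sub, smul_add, smul_sub, mul_smul_comm, smul_mul_assoc, mul_assoc]
    abel

/-- Solutions of `S = s₀ + T (β v) S` depend differentiably on the parameter `v`, and the
derivative is determined by the differentiated equation. -/
theorem hasFDerivAt_resolvent {X Y B : Type} [NormedAddCommGroup X] [NormedSpace ℝ X]
    [CompleteSpace X] [NormedAddCommGroup Y] [NormedSpace ℝ Y] [NormedAddCommGroup B]
    [NormedSpace ℝ B] (T : Y →L[ℝ] X →L[ℝ] X) (L : X →L[ℝ] B) {β : E → Y} {β' : E →L[ℝ] Y}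
    {v : E} (hβ : HasFDerivAt β β' v) (s₀ : X) {S : E → X} (hS : ∀ᶠ v' in 𝓝 v,
      IsUnit (1 - T (β v')) ∧ S v' = Ring.inverse (1 - T (β v')) s₀) {D : E →L[ℝ] B}
    (hD : ∀ w, ∃ Z, Z = T (β' w) (S v) + T (β v) Z ∧ L Z = D w) :
    HasFDerivAt (fun v => L (S v)) D v := by
  have hSe : ∀ᶠ v' in 𝓝 v, S v' = s₀ + T (β v') (S v') := by
    filter_upwards [hS] with v' hv'
    have h := congrArg (fun T : X →L[ℝ] X => T s₀) (Ring.mul_inverse_cancel _ hv'.1)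
    simp only [mul_apply_eq_comp, sub_apply, one_apply_eq_self] at h
    rw [← hv'.2] at h
    exact eq_add_of_sub_eq h
  have hTβ : HasFDerivAt (fun v => T (β v)) (T.comp β') v := T.hasFDerivAt.comp v hβ
  obtain ⟨u, hu⟩ := hS.self_of_nhds.1
  have hSd : DifferentiableAt ℝ S v := by
    have h1 : DifferentiableAt ℝ Ring.inverse (1 - T (β v)) := by
      rw [← hu]; exact (hasFDerivAt_ringInverse (𝕜 := ℝ) u).differentiableAt
    have h2 : DifferentiableAt ℝ (fun v => Ring.inverse (1 - T (β v))) v :=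
      DifferentiableAt.comp (g := Ring.inverse) v h1 (hTβ.differentiableAt.const_sub 1)
    exact (h2.clm_apply (differentiableAt_const s₀)).congr_of_eventuallyEq
      (hS.mono fun v' hv' => hv'.2)
  refine (L.hasFDerivAt.comp v hSd.hasFDerivAt).congr_fderiv ?_
  ext w
  obtain ⟨Z, hZ, hZ'⟩ := hD w
  rw [ContinuousLinearMap.comp_apply, ← hZ']
  have hSw : fderiv ℝ S v w = T (β' w) (S v) + T (β v) (fderiv ℝ S v w) := by
    have h1 : HasFDerivAt (fun v => s₀ + T (β v) (S v)) _ v :=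
      (hTβ.clm_apply hSd.hasFDerivAt).const_add s₀
    have h3 := DFunLike.congr_fun (hSd.hasFDerivAt.unique (h1.congr_of_eventuallyEq hSe)) w
    refine h3.trans ?_
    simp [add_comm]
  -- The true derivative and the candidate Z solve the same differentiated equation, so the
  -- invertible operator 1 - T (β v) kills their difference.
  have h1 : (u : X →L[ℝ] X) (fderiv ℝ S v w - Z) = 0 := by
    rw [hu, sub_apply, one_apply_eq_self, map_sub]
    nth_rewrite 1 [hSw]
    nth_rewrite 1 [hZ]
    abel
  have h2 := congrArg ((u⁻¹ : (X →L[ℝ] X)ˣ) : X →L[ℝ] X) h1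
  rw [← mul_apply_eq_comp, Units.inv_mul, map_zero] at h2
  rw [sub_eq_zero.1 h2]

/-- Parallel transport along rays: F(p₀ + v) is the value at time 1 of the solution of S' = S α(v)
on the ray in direction v. For small v the Volterra operator has norm less than 1, so S is the
resolvent applied to 1 and depends differentiably on v. Flatness makes the derivative equal to F α
in every direction, not only the radial one. -/
theorem exists_local_solution {α : E → E →L[ℝ] A} {D : Set E} (hD : IsOpen D)
    (hα : ContDiffOn ℝ ∞ α D) (hflat : IsFlatOn α D) {p₀ : E} (hp₀ : p₀ ∈ D) :
    ∃ r > 0, ball p₀ r ⊆ D ∧ ∃ F : E → A, F p₀ = 1 ∧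
      ∀ p ∈ ball p₀ r, IsUnit (F p) ∧ SolvesAt α F p := by
  obtain ⟨r₀, hr₀, hball⟩ := Metric.isOpen_iff.1 hD p₀ hp₀
  let f : E × ℝ → A := fun q => α (p₀ + q.2 • q.1) q.1
  let W : Set (E × ℝ) := (fun q : E × ℝ => p₀ + q.2 • q.1) ⁻¹' D
  have hγ : ContDiff ℝ ∞ (fun q : E × ℝ => p₀ + q.2 • q.1) := by fun_prop
  have hW : IsOpen W := hD.preimage hγ.continuous
  have hf : ContDiffOn ℝ ∞ f W :=
    (hα.comp hγ.contDiffOn fun q hq => hq).clm_apply contDiffOn_fst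
  have hVW : ball (0 : E) r₀ ×ˢ Icc (0 : ℝ) 1 ⊆ W := by
    rintro ⟨v, t⟩ ⟨hv, ht⟩
    apply hball
    rw [mem_ball_zero_iff] at hv
    rw [mem_ball_iff_norm, add_sub_cancel_left, norm_smul, Real.norm_eq_abs, abs_of_nonneg ht.1]
    calc t * ‖v‖ ≤ 1 * ‖v‖ := by gcongr; exact ht.2
      _ < r₀ := by rwa [one_mul]
  set β := slice (Icc (0 : ℝ) 1) f with hβdef
  have hβ : ContDiffOn ℝ ∞ β (ball 0 r₀) := contDiffOn_slice isOpen_ball hW hf hVW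
  have hβapp : ∀ v ∈ ball (0 : E) r₀, ∀ t : Icc (0 : ℝ) 1, β v t = α (p₀ + (t : ℝ) • v) v :=
    fun v hv t => slice_apply hf.continuousOn hVW hv t
  have hβ0 : β 0 = 0 := by
    ext t
    rw [hβapp 0 (mem_ball_self hr₀)]
    simp
  have hsmall : ∀ᶠ v in 𝓝 (0 : E), v ∈ ball (0 : E) r₀ ∧ ‖β v‖ < 1 := by
    have h1 := hβ.continuousOn.continuousAt (ball_mem_nhds _ hr₀)
    have h2 := h1.norm.eventually (Iio_mem_nhds (show ‖β 0‖ < 1 by rw [hβ0, norm_zero]; exact one_pos))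
    exact (show ∀ᶠ v in 𝓝 (0 : E), v ∈ ball (0 : E) r₀ from ball_mem_nhds _ hr₀).and h2
  obtain ⟨r₁, hr₁, hr₁'⟩ := Metric.eventually_nhds_iff_ball.1 hsmall
  have hunit : ∀ v ∈ ball (0 : E) r₁, IsUnit (1 - volterra (β v)) := fun v hv =>
    isUnit_one_sub_of_norm_lt_one (x := volterra (β v))
      ((norm_volterra_le _).trans_lt (hr₁' v hv).2)
  let S : E → C(Icc (0 : ℝ) 1, A) := fun v => Ring.inverse (1 - volterra (β v)) 1
  have hS : ∀ v ∈ ball (0 : E) r₁, S v = 1 + volterra (β v) (S v) := by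
    intro v hv
    have h := congrArg (fun T => T (1 : C(Icc (0 : ℝ) 1, A)))
      (Ring.mul_inverse_cancel _ (hunit v hv))
    simp only [mul_apply_eq_comp, sub_apply,
      one_apply_eq_self] at h
    exact eq_add_of_sub_eq h
  let one' : Icc (0 : ℝ) 1 := ⟨1, by simp⟩
  let F : E → A := fun p => S (p - p₀) one'
  have hsol : ∀ v ∈ ball (0 : E) r₁, HasFDerivAt (fun v => S v one')
      ((ContinuousLinearMap.mul ℝ A (S v one')).comp (α (p₀ + v))) v := by
    intro v hv
    have hv₀ := (hr₁' v hv).1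
    have hβd := hasFDerivAt_slice isOpen_ball hW (hf.of_le (by simp)) hVW hv₀
    rw [← hβdef] at hβd
    let β' := familyToOperator (Icc (0 : ℝ) 1) (slice (Icc (0 : ℝ) 1)
      (fun q => (fderiv ℝ f q).comp (ContinuousLinearMap.inl ℝ E ℝ)) v)
    change HasFDerivAt β β' v at hβd
    refine hasFDerivAt_resolvent (X := C(Icc (0 : ℝ) 1, A)) volterra (ContinuousMap.evalCLM ℝ one')
      hβd 1 (S := S) ?_ fun w => ?_
    · filter_upwards [isOpen_ball.mem_nhds hv] with v' hv' using ⟨hunit v' hv', rfl⟩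
    have hmemD : ∀ s ∈ Icc (0 : ℝ) 1, p₀ + s • v ∈ D := fun s hs =>
      hVW (show (v, s) ∈ _ from ⟨hv₀, hs⟩)
    have hαd : ∀ s ∈ Icc (0 : ℝ) 1, HasFDerivAt α (fderiv ℝ α (p₀ + s • v)) (p₀ + s • v) :=
      fun s hs => ((hα.differentiableOn (by simp)).differentiableAt
        (hD.mem_nhds (hmemD s hs))).hasFDerivAt
    let Y : C(Icc (0 : ℝ) 1, A) := ⟨fun s => (s : ℝ) • (S v s * α (p₀ + (s : ℝ) • v) w), by
      have hc1 : Continuous (S v) := (S v).continuous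
      have : Continuous fun s : Icc (0 : ℝ) 1 => α (p₀ + (s : ℝ) • v) :=
        hα.continuousOn.comp_continuous (by fun_prop) fun s => hmemD s s.2
      exact continuous_subtype_val.smul (hc1.mul (this.clm_apply continuous_const))⟩
    have hY : Y = volterra (β' w) (S v) + volterra (β v) Y := by
      refine volterra_variation (hS v hv) (a := fun s => α (p₀ + s • v) w)
        (a' := fun s => fderiv ℝ α (p₀ + s • v) v w) ?_ ?_ fun s => rfl
      · intro s hs
        have h1 : HasDerivAt (fun s : ℝ => p₀ + s • v) v s := by
          simpa using ((hasDerivAt_id s).smul_const v).const_add p₀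
        have h2 := (hαd s hs).comp_hasDerivAt s h1
        simpa using h2.clm_apply (hasDerivAt_const s w)
      · intro s
        have hs := s.2
        have hfd : HasFDerivAt f (fderiv ℝ f (v, (s : ℝ))) (v, (s : ℝ)) :=
          ((hf.differentiableOn (by simp)).differentiableAt
            (hW.mem_nhds (hVW ⟨hv₀, hs⟩))).hasFDerivAt
        have e1 : β' w s = fderiv ℝ f (v, (s : ℝ)) (w, 0) := by
          have hg : ContinuousOn (fun q => (fderiv ℝ f q).comp (ContinuousLinearMap.inl ℝ E ℝ)) W :=
            (hf.continuousOn_fderiv_of_isOpen hW (by simp)).clm_comp continuousOn_const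
          simp only [β', familyToOperator_apply]
          rw [slice_apply hg hVW hv₀]
          rfl
        have e2 : HasFDerivAt (fun v => f (v, (s : ℝ)))
            ((fderiv ℝ f (v, (s : ℝ))).comp (ContinuousLinearMap.inl ℝ E ℝ)) v :=
          HasFDerivAt.comp (g := f) v hfd (hasFDerivAt_prodMk_left v (s : ℝ))
        have e3 : HasFDerivAt (fun v : E => p₀ + (s : ℝ) • v)
            ((s : ℝ) • ContinuousLinearMap.id ℝ E) v :=
          ((hasFDerivAt_id v).const_smul (s : ℝ)).const_add p₀
        have e4 := ((hαd s hs).comp v e3).clm_apply (hasFDerivAt_id v)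
        have e5 := congrArg (fun T => T w) (e2.unique e4)
        simp only [ContinuousLinearMap.comp_apply, ContinuousLinearMap.inl_apply] at e5
        rw [e1, e5, hβapp v hv₀]
        have e6 := hflat _ (hmemD s hs) v w
        -- Flatness exchanges v and w at the cost of a commutator; this is its only use.
        have e7 : fderiv ℝ α (p₀ + (s : ℝ) • v) w v = fderiv ℝ α (p₀ + (s : ℝ) • v) v w
            + α (p₀ + (s : ℝ) • v) v * α (p₀ + (s : ℝ) • v) w
            - α (p₀ + (s : ℝ) • v) w * α (p₀ + (s : ℝ) • v) v := by
          rw [← sub_eq_zero, ← neg_eq_zero, ← e6]; abel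
        rw [← e7]
        simp [add_comm]
    refine ⟨Y, hY, ?_⟩
    change Y one' = S v one' * α (p₀ + v) w
    simp [Y, one']
  have hF : ∀ p ∈ ball p₀ r₁, SolvesAt α F p := by
    intro p hp
    have hp' : p - p₀ ∈ ball (0 : E) r₁ := by
      rwa [mem_ball_zero_iff, ← mem_ball_iff_norm]
    have := (hsol _ hp').comp p ((hasFDerivAt_id p).sub_const p₀)
    refine this.congr_fderiv ?_
    ext w
    simp [F]
  have hF0 : F p₀ = 1 := by
    have h := hS 0 (mem_ball_self hr₁)
    rw [hβ0, map_zero, zero_apply, add_zero] at h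
    simp [F, h]
  have hU : ∀ᶠ p in 𝓝 p₀, IsUnit (F p) :=
    (hF p₀ (mem_ball_self hr₁)).differentiableAt.continuousAt.eventually
      (Units.isOpen.mem_nhds (show IsUnit (F p₀) by rw [hF0]; exact isUnit_one))
  obtain ⟨r₂, hr₂, hr₂'⟩ := Metric.eventually_nhds_iff_ball.1 hU
  refine ⟨min r₀ (min r₁ r₂), by positivity, (ball_subset_ball (min_le_left _ _)).trans hball,
    F, hF0, fun p hp => ?_⟩
  have hp1 : p ∈ ball p₀ (min r₁ r₂) := ball_subset_ball (min_le_right _ _) hp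
  exact ⟨hr₂' p (ball_subset_ball (min_le_right _ _) hp1),
    hF p (ball_subset_ball (min_le_left _ _) hp1)⟩

/-- A flat form on a simply connected domain has a global solution. -/
theorem exists_global_solution {α : E → E →L[ℝ] A} {D : Set E} (hD : IsOpen D)
    [SimplyConnectedSpace D] (hα : ContDiffOn ℝ ∞ α D) (hflat : IsFlatOn α D) {p₀ : E}
    (hp₀ : p₀ ∈ D) :
    ∃ F : E → A, F p₀ = 1 ∧ ∀ p ∈ D, IsUnit (F p) ∧ SolvesAt α F p := by
  classical
  have hloc := fun p : D => exists_local_solution hD hα hflat p.2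
  choose r hr hrD F hF0 hF using hloc
  let G : D → E → Aˣ := fun i x => if hx : IsUnit (F i x) then hx.unit else 1
  have hG : ∀ i : D, ∀ x ∈ ball (i : E) (r i), (G i x : A) = F i x := fun i x hx => by
    simp [G, (hF i x hx).1]
  have hGs : ∀ i : D, ∀ x ∈ ball (i : E) (r i), SolvesAt α (fun x => (G i x : A)) x := by
    intro i x hx
    refine (hF i x hx).2.congr ?_
    filter_upwards [isOpen_ball.mem_nhds hx] with y hy using hG i y hy
  have : LocallyPathConnectedSpace D := hD.locallyPathConnectedSpace
  obtain ⟨S, hS0, hS⟩ := exists_global_of_locally_constant_transition (X := D)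
    (fun i => Subtype.val ⁻¹' ball (i : E) (r i))
    (fun i => isOpen_ball.preimage continuous_subtype_val) (fun i => mem_ball_self (hr i))
    (fun i x => G i x) (by
      rintro i j x ⟨hxi, hxj⟩
      have hopen : IsOpen (ball (i : E) (r i) ∩ ball (j : E) (r j)) := isOpen_ball.inter isOpen_ball
      have hmem : (Subtype.val ⁻¹' (ball (i : E) (r i) ∩ ball (j : E) (r j)) : Set D) ∈ 𝓝 x :=
        (hopen.preimage continuous_subtype_val).mem_nhds ⟨hxi, hxj⟩
      filter_upwards [hmem] with y hy
      -- An intersection of two balls is convex, hence connected, so the quotient of the two local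
      -- solutions is constant on it.
      have := eq_mul_of_solvesAt hopen ((convex_ball _ _).inter (convex_ball _ _)).isPreconnected
        (fun p hp => hGs i p hp.1) (fun p hp => hGs j p hp.2)
        (show (x : E) ∈ ball (i : E) (r i) ∩ ball (j : E) (r j) from ⟨hxi, hxj⟩) hy
      exact Units.ext (by simpa using this)) ⟨p₀, hp₀⟩ 1
  refine ⟨fun x => if hx : x ∈ D then (S ⟨x, hx⟩ : A) else 1, by simp [hp₀, hS0], fun p hp => ?_⟩
  simp only [hp, dite_true]
  refine ⟨(S ⟨p, hp⟩).isUnit, ?_⟩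
  obtain ⟨g, hg⟩ := hS ⟨p, hp⟩
  rw [nhds_subtype_eq_comap, eventually_comap] at hg
  refine ((hGs ⟨p, hp⟩ p (mem_ball_self (hr _))).const_mul (g : A)).congr ?_
  filter_upwards [hg, hD.mem_nhds hp] with y hy hyD
  rw [dif_pos hyD, hy ⟨y, hyD⟩ rfl]
  simp

end LocalSolution

/-! ### Holomorphic functions on the punctured plane -/

section Punctured

variable {M : Type} [NormedAddCommGroup M] [NormedSpace ℂ M] [CompleteSpace M]

theorem differentiable_update_of_tendsto {g : ℂ → M} (hg : DifferentiableOn ℂ g {0}ᶜ) {c : M}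
    (h0 : Tendsto g (𝓝[≠] 0) (𝓝 c)) : Differentiable ℂ (Function.update g 0 c) := by
  have h1 : DifferentiableOn ℂ (Function.update g 0 c) (univ \ {0}) := by
    refine (hg.mono fun z hz => hz.2).congr fun z hz => ?_
    exact Function.update_of_ne hz.2 _ _
  exact differentiableOn_univ.1 ((Complex.differentiableOn_compl_singleton_and_continuousAt_iff
    univ_mem).1 ⟨h1, continuousAt_update_same.2 h0⟩)

/-- A version of Liouville's theorem on the punctured plane. -/
theorem eq_of_tendsto_inv {g : ℂ → M} (hg : DifferentiableOn ℂ g {0}ᶜ)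
    (h0 : Tendsto (fun z => z • g z) (𝓝[≠] 0) (𝓝 0)) {c : M}
    (hi : Tendsto (fun z => g z⁻¹) (𝓝[≠] 0) (𝓝 c)) {z : ℂ} (hz : z ≠ 0) : g z = c := by
  -- The hypothesis at 0 says g = o(1/z), which makes the singularity removable; the entire
  -- extension has a limit at ∞ and is therefore constant.
  have h1 : DifferentiableOn ℂ (Function.update g 0 (limUnder (𝓝[≠] 0) g)) univ := by
    refine Complex.differentiableOn_update_limUnder_of_isLittleO univ_mem
      (hg.mono fun z hz => hz.2) ?_
    rw [Asymptotics.isLittleO_iff]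
    intro ε hε
    have h1 : Tendsto (fun z => z • (g z - g 0)) (𝓝[≠] 0) (𝓝 0) := by
      have h2 : Tendsto (fun z : ℂ => z • g 0) (𝓝[≠] 0) (𝓝 0) := by
        have : Tendsto (fun z : ℂ => z • g 0) (𝓝 0) (𝓝 ((0 : ℂ) • g 0)) :=
          (continuous_id.smul continuous_const).tendsto 0
        rw [zero_smul] at this
        exact this.mono_left nhdsWithin_le_nhds
      simpa [smul_sub] using h0.sub h2
    filter_upwards [(Metric.tendsto_nhds.1 h1) ε hε, self_mem_nhdsWithin] with z hz hz0
    rw [dist_zero_right, norm_smul] at hz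
    rw [sub_zero, norm_inv, ← div_eq_mul_inv, le_div_iff₀ (norm_pos_iff.2 hz0), mul_comm]
    exact hz.le
  have h2 : Tendsto (Function.update g 0 (limUnder (𝓝[≠] 0) g)) (cocompact ℂ) (𝓝 c) := by
    rw [← Metric.cobounded_eq_cocompact]
    have h3 : Tendsto g (Bornology.cobounded ℂ) (𝓝 c) := by
      have := hi.comp (tendsto_inv₀_cobounded' (α := ℂ))
      refine this.congr fun z => by simp
    refine h3.congr' ?_
    have : ∀ᶠ z in Bornology.cobounded ℂ, z ≠ 0 := by
      rw [Metric.cobounded_eq_cocompact]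
      exact (isCompact_singleton (x := (0 : ℂ))).compl_mem_cocompact
    filter_upwards [this] with z hz
    rw [Function.update_of_ne hz]
  have h4 := congrFun ((differentiableOn_univ.1 h1).eq_const_of_tendsto_cocompact h2) z
  rwa [Function.update_of_ne hz] at h4

/-- The Laurent coefficients of `f` about `0`, computed on the circle of radius `R`. -/
noncomputable def laurentCoeff (f : ℂ → M) (R : ℝ) (j : ℤ) : M :=
  (2 * Real.pi * Complex.I : ℂ)⁻¹ • ∮ w in C(0, R), w ^ (-j - 1) • f w

theorem isOpen_setOf_lt_norm (ρ : ℝ) : IsOpen {z : ℂ | ρ < ‖z‖} :=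
  isOpen_lt continuous_const continuous_norm

/-- The integrand is holomorphic on the annulus between the two circles. -/
theorem laurentCoeff_eq {f : ℂ → M} {ρ : ℝ} (hρ : 0 ≤ ρ)
    (hf : DifferentiableOn ℂ f {z | ρ < ‖z‖}) {r R : ℝ} (hr : ρ < r) (hR : ρ < R) (j : ℤ) :
    laurentCoeff f r j = laurentCoeff f R j := by
  wlog h : r ≤ R generalizing r R
  · exact (this hR hr (le_of_not_ge h)).symm
  have hd : DifferentiableOn ℂ (fun w : ℂ => w ^ (-j - 1) • f w) {z | ρ < ‖z‖} := by
    refine DifferentiableOn.smul (fun z hz => ?_) hf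
    have hz0 : z ≠ 0 := norm_pos_iff.1 (hρ.trans_lt hz)
    exact (differentiableAt_zpow.2 (Or.inl hz0)).differentiableWithinAt
  have hsub : closedBall (0 : ℂ) R \ ball 0 r ⊆ {z | ρ < ‖z‖} := by
    rintro z ⟨-, hz⟩
    rw [mem_ball_zero_iff, not_lt] at hz
    exact hr.trans_le hz
  unfold laurentCoeff
  rw [Complex.circleIntegral_eq_of_differentiable_on_annulus_off_countable (hρ.trans_lt hr) h
    countable_empty (hd.continuousOn.mono hsub)]
  rintro z ⟨⟨hz1, hz2⟩, -⟩
  refine hd.differentiableAt ((isOpen_setOf_lt_norm ρ).mem_nhds (hsub ⟨?_, ?_⟩))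
  · exact ball_subset_closedBall hz1
  · exact fun h => hz2 (ball_subset_closedBall h)

/-- Cauchy's theorem on the annulus for the divided difference (f w - f z) / (w - z), which is
holomorphic at z as well. The kernel 1 / (w - z) contributes 2πi on the outer circle and 0 on the
inner one. -/
theorem cauchy_annulus {f : ℂ → M} {r R : ℝ} {z : ℂ} {U : Set ℂ} (hU : IsOpen U)
    (hf : DifferentiableOn ℂ f U) (hr : 0 < r) (hrz : r < ‖z‖) (hzR : ‖z‖ < R)
    (hsub : closedBall (0 : ℂ) R \ ball 0 r ⊆ U) :
    (2 * Real.pi * Complex.I : ℂ) • f z =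
      (∮ w in C(0, R), (w - z)⁻¹ • f w) - ∮ w in C(0, r), (w - z)⁻¹ • f w := by
  have hzU : z ∈ U := hsub ⟨by simpa using hzR.le, by simpa using hrz.le⟩
  have hd : DifferentiableOn ℂ (dslope f z) U :=
    (Complex.differentiableOn_dslope (hU.mem_nhds hzU)).2 hf
  have h1 := Complex.circleIntegral_eq_of_differentiable_on_annulus_off_countable hr
    (hrz.trans hzR).le countable_empty (hd.continuousOn.mono hsub) (by
      rintro w ⟨⟨hw1, hw2⟩, -⟩
      refine hd.differentiableAt (hU.mem_nhds (hsub ⟨?_, ?_⟩))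
      · exact ball_subset_closedBall hw1
      · exact fun h => hw2 (ball_subset_closedBall h))
  have hsphere : ∀ s, r ≤ s → s ≤ R → sphere (0 : ℂ) s ⊆ U := by
    intro s hs1 hs2 w hw
    rw [mem_sphere_zero_iff_norm] at hw
    exact hsub ⟨by simpa [hw] using hs2, by simpa [hw] using hs1⟩
  have h2 : ∀ s, 0 < s → s ≠ ‖z‖ → sphere (0 : ℂ) s ⊆ U →
      (∮ w in C(0, s), dslope f z w) =
        (∮ w in C(0, s), (w - z)⁻¹ • f w) - (∮ w in C(0, s), (w - z)⁻¹) • f z := by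
    intro s hs hsz hsU
    have hne : ∀ w ∈ sphere (0 : ℂ) s, w - z ≠ 0 := by
      intro w hw h
      rw [sub_eq_zero] at h
      rw [mem_sphere_zero_iff_norm, h] at hw
      exact hsz hw.symm
    have hinv : ContinuousOn (fun w : ℂ => (w - z)⁻¹) (sphere 0 s) :=
      ContinuousOn.inv₀ (by fun_prop) hne
    rw [← circleIntegral.integral_smul_const, ← circleIntegral.integral_sub]
    · refine circleIntegral.integral_congr hs.le fun w hw => ?_
      rw [dslope_of_ne f (fun h => hne w hw (sub_eq_zero.2 h)), slope, vsub_eq_sub, smul_sub]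
    · exact (hinv.smul (hf.continuousOn.mono hsU)).circleIntegrable hs.le
    · exact (hinv.smul continuousOn_const).circleIntegrable hs.le
  rw [h2 R (hr.trans (hrz.trans hzR)) hzR.ne' (hsphere R (hrz.trans hzR).le le_rfl),
    h2 r hr hrz.ne (hsphere r le_rfl (hrz.trans hzR).le),
    circleIntegral.integral_sub_inv_of_mem_ball (by simpa using hzR)] at h1
  have h3 : (∮ w in C(0, r), (w - z)⁻¹) = 0 := by
    refine DiffContOnCl.circleIntegral_eq_zero hr.le ?_
    refine DifferentiableOn.diffContOnCl fun w hw => ?_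
    rw [closure_ball _ hr.ne'] at hw
    refine ((differentiableAt_id.sub_const z).inv fun h => ?_).differentiableWithinAt
    simp only [id] at h
    rw [sub_eq_zero.1 h, mem_closedBall_zero_iff] at hw
    exact absurd hw (not_le.2 hrz)
  rw [h3, zero_smul, sub_zero] at h1
  rw [← h1]
  abel

/-- For |w| = r < |z| the kernel -1 / (w - z) is a geometric series in w / z, convergent in the
Banach algebra of continuous functions on the circle. A continuous functional may be applied term by
term, and this yields the principal part. -/
theorem hasSum_circle_inner {f : ℂ → M} {r : ℝ} {z : ℂ} (hr : 0 < r) (hrz : r < ‖z‖)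
    (hf : ContinuousOn f (sphere 0 r)) :
    HasSum (fun n : ℕ => z ^ (-(n + 1 : ℤ)) • laurentCoeff f r (-(n + 1)))
      (-((2 * Real.pi * Complex.I : ℂ)⁻¹ • ∮ w in C(0, r), (w - z)⁻¹ • f w)) := by
  have hz : z ≠ 0 := norm_pos_iff.1 (hr.trans hrz)
  let F : C(sphere (0 : ℂ) r, M) := ⟨fun w => f w, hf.domRestrict⟩
  let q : C(sphere (0 : ℂ) r, ℂ) := z⁻¹ • inclMap (sphere (0 : ℂ) r)
  have hq : ‖q‖ < 1 := by
    have : ‖q‖ ≤ r / ‖z‖ := by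
      rw [ContinuousMap.norm_le _ (by positivity)]
      intro w
      have := w.2
      rw [mem_sphere_zero_iff_norm] at this
      simp [q, inclMap, this, div_eq_inv_mul]
    refine this.trans_lt ?_
    rwa [div_lt_one (hr.trans hrz)]
  have hsum := summable_geometric_of_norm_lt_one (x := q) hq
  have h1 : (∑' n : ℕ, q ^ n) * (1 - q) = 1 := geom_series_mul_neg q hq
  have h2 := hsum.hasSum
  let L : C(sphere (0 : ℂ) r, ℂ) →L[ℂ] M :=
    (circleFunctional 0 r hr.le).comp ((smulBilin (M := M) (sphere (0 : ℂ) r)).flip F)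
  have h3 := (h2.mapL L).const_smul z⁻¹
  convert h3 using 1
  · funext n
    simp only [laurentCoeff, L, ContinuousLinearMap.comp_apply, ContinuousLinearMap.flip_apply]
    rw [circleFunctional_apply hr.le _ (fun w => (z⁻¹ * w) ^ n • f w)
      (fun w => by simp [q, inclMap]; rfl)]
    rw [smul_comm, smul_comm z⁻¹]
    congr 1
    rw [← circleIntegral.integral_smul, ← circleIntegral.integral_smul]
    refine circleIntegral.integral_congr hr.le fun w hw => ?_
    simp only [smul_smul]
    congr 1
    rw [mul_pow, zpow_neg, inv_pow]
    have : (-(-((n : ℤ) + 1)) - 1) = n := by ring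
    rw [this, zpow_natCast, ← Nat.cast_succ, zpow_natCast, pow_succ]
    field_simp
  · simp only [L, ContinuousLinearMap.comp_apply, ContinuousLinearMap.flip_apply]
    rw [circleFunctional_apply hr.le _ (fun w => (-z * (w - z)⁻¹) • f w)]
    · rw [smul_comm, ← smul_neg]
      congr 1
      rw [← circleIntegral.integral_smul, ← neg_one_smul ℂ, ← circleIntegral.integral_smul]
      refine circleIntegral.integral_congr hr.le fun w hw => ?_
      simp only [smul_smul]
      congr 1
      field_simp
    · intro w
      have hw := w.2
      rw [mem_sphere_zero_iff_norm] at hw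
      have hwz : (w : ℂ) - z ≠ 0 := by
        intro h
        rw [sub_eq_zero.1 h] at hw
        exact hrz.ne' hw
      have h4 := congrArg (fun φ : C(sphere (0 : ℂ) r, ℂ) => φ w) h1
      simp only [ContinuousMap.mul_apply, ContinuousMap.sub_apply, ContinuousMap.one_apply] at h4
      simp only [smulBilin_apply]
      congr 1
      have h5 : (1 : ℂ) - q w ≠ 0 := right_ne_zero_of_mul_eq_one h4
      refine mul_right_cancel₀ h5 (h4.trans ?_)
      simp only [q, inclMap, ContinuousMap.smul_apply, ContinuousMap.coe_mk, smul_eq_mul]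
      field_simp
      ring

/-- In Cauchy's formula on an annulus around |z|, the outer integral expands in nonnegative powers
and the inner one in negative powers. The coefficients can then be moved to the common radius R. -/
theorem hasSum_laurent {f : ℂ → M} {ρ : ℝ} (hρ : 0 ≤ ρ)
    (hf : DifferentiableOn ℂ f {z | ρ < ‖z‖}) {R : ℝ} (hR : ρ < R) {z : ℂ} (hz : ρ < ‖z‖) :
    HasSum (fun j : ℤ => z ^ j • laurentCoeff f R j) (f z) := by
  obtain ⟨r, hr1, hr2⟩ := exists_between hz
  obtain ⟨R', hR1⟩ := exists_gt ‖z‖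
  have hr0 := hρ.trans_lt hr1
  have hsph : ∀ s, ρ < s → ContinuousOn f (sphere 0 s) := fun s hs =>
    hf.continuousOn.mono fun w hw => by
      rw [mem_sphere_zero_iff_norm] at hw
      simpa [hw] using hs
  have h1 := cauchy_annulus (isOpen_setOf_lt_norm ρ) hf hr0 hr2 hR1 (by
    rintro w ⟨-, hw⟩
    rw [mem_ball_zero_iff, not_lt] at hw
    exact hr1.trans_le hw)
  have h2 := hasSum_circle_inner hr0 hr2 (hsph r hr1)
  have h3 := (hasSum_two_pi_I_cauchyPowerSeries_integral (c := 0)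
    ((hsph R' (hz.trans hR1)).circleIntegrable (hr0.trans (hr2.trans hR1)).le) hR1).const_smul
      (2 * Real.pi * Complex.I : ℂ)⁻¹
  have h4 := HasSum.of_nat_of_neg_add_one (f := fun j : ℤ => z ^ j • laurentCoeff f R j)
    (m := (2 * Real.pi * Complex.I : ℂ)⁻¹ • ∮ w in C(0, R'), (w - (0 + z))⁻¹ • f w)
    (m' := (-((2 * Real.pi * Complex.I : ℂ)⁻¹ • ∮ w in C(0, r), (w - z)⁻¹ • f w))) ?_ ?_
  · convert h4 using 1
    rw [zero_add, ← sub_eq_add_neg, ← smul_sub, ← h1, smul_smul,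
      inv_mul_cancel₀ Complex.two_pi_I_ne_zero, one_smul]
  · convert h3 using 1
    funext n
    rw [laurentCoeff_eq hρ hf hR (hz.trans hR1)]
    simp only [laurentCoeff]
    rw [smul_comm]
    congr 1
    rw [← circleIntegral.integral_smul]
    refine circleIntegral.integral_congr (hr0.trans (hr2.trans hR1)).le fun w hw => ?_
    simp only [smul_smul, sub_zero]
    congr 1
    have hw0 : w ≠ 0 := by
      rintro rfl
      simp at hw
      exact absurd hw (hr0.trans (hr2.trans hR1)).ne
    rw [zpow_natCast, div_pow, zpow_sub₀ hw0, zpow_neg, zpow_natCast, zpow_one]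
    field_simp
  · convert h2 using 1
    funext n
    rw [laurentCoeff_eq hρ hf hR hr1]

end Punctured

/-! ### Neumann series with parameters -/

section Neumann

variable {X Y B : Type} [NormedAddCommGroup X] [NormedSpace ℂ X] [CompleteSpace X]
  [NormedAddCommGroup Y] [NormedSpace ℂ Y] [NormedAddCommGroup B] [NormedSpace ℂ B]

theorem contDiffAt_inverse_apply (T : Y →L[ℂ] X →L[ℂ] X) (g : Y →L[ℂ] X) {y : Y}
    (hy : IsUnit (T y)) : ContDiffAt ℂ ∞ (fun y => Ring.inverse (T y) (g y)) y := by
  obtain ⟨t, ht⟩ := hy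
  have h1 : ContDiffAt ℂ ∞ Ring.inverse (T y) := by
    rw [← ht]; exact contDiffAt_ringInverse ℂ t
  have h2 : ContDiffAt ℂ ∞ (fun y => Ring.inverse (T y)) y :=
    ContDiffAt.comp (g := Ring.inverse) y h1 T.contDiff.contDiffAt
  exact h2.clm_apply g.contDiff.contDiffAt

variable (S : X →L[ℂ] X) (ev : X →L[ℂ] B)

/-- `∑ z⁻ⁿ⁻¹ ev (Sⁿ u)`. -/
noncomputable def negSeries (u : X) (z : ℂ) : B := ev (z⁻¹ • Ring.inverse (1 - z⁻¹ • S) u)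

variable {S} (hS : ‖S‖ ≤ 1 / 2)

include hS in
theorem norm_inv_smul_lt {z : ℂ} (hz : 1 / 2 < ‖z‖) : ‖z⁻¹ • S‖ < 1 := by
  have hz0 : z ≠ 0 := norm_pos_iff.1 (lt_trans (by norm_num) hz)
  rw [norm_smul, norm_inv, ← div_eq_inv_mul, div_lt_one (norm_pos_iff.2 hz0)]
  exact hS.trans_lt hz

include hS in
theorem hasSum_negSeries (u : X) {z : ℂ} (hz : 1 / 2 < ‖z‖) :
    HasSum (fun n : ℕ => z ^ (-(n + 1 : ℤ)) • ev ((S ^ n) u)) (negSeries S ev u z) := by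
  have hq := norm_inv_smul_lt hS hz
  have h1 := (summable_geometric_of_norm_lt_one hq).hasSum
  have h2 : Ring.inverse (1 - z⁻¹ • S) = ∑' n : ℕ, (z⁻¹ • S) ^ n :=
    Ring.inverse_unit (Units.mk _ _ (mul_neg_geom_series (z⁻¹ • S) hq)
      (geom_series_mul_neg (z⁻¹ • S) hq))
  rw [← h2] at h1
  have h3 := ((h1.mapL (ContinuousLinearMap.apply ℂ X u)).const_smul z⁻¹).mapL ev
  convert h3 using 1
  · funext n
    have hz0 : z ≠ 0 := norm_pos_iff.1 (lt_trans (by norm_num) hz)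
    rw [smul_pow]
    simp only [ContinuousLinearMap.apply_apply, map_smul, smul_smul]
    congr 1
    rw [zpow_neg, ← Nat.cast_succ, zpow_natCast, ← inv_pow, pow_succ']
  · rfl

theorem contDiffAt_negFactor {w : ℂ} (hw : ‖w • S‖ < 1) :
    ContDiffAt ℂ ∞ (fun w : ℂ => Ring.inverse (1 - w • S)) w := by
  obtain ⟨t, ht⟩ := isUnit_one_sub_of_norm_lt_one hw
  have h1 : ContDiffAt ℂ ∞ Ring.inverse (1 - w • S) := by
    rw [← ht]; exact contDiffAt_ringInverse ℂ t
  exact ContDiffAt.comp (g := Ring.inverse) w h1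
    (contDiffAt_const.sub (contDiffAt_id.smul contDiffAt_const))

include hS in
-- The closed form through the resolvent gives smoothness jointly in the vector and in z without
-- differentiating a series.
theorem contDiffOn_negSeries :
    ContDiffOn ℂ ∞ (fun q : X × ℂ => negSeries S ev q.1 q.2) (univ ×ˢ {z : ℂ | 1 / 2 < ‖z‖}) := by
  rintro ⟨u, z⟩ ⟨-, hz⟩
  have hz0 : z ≠ 0 := norm_pos_iff.1 (lt_trans (by norm_num) hz)
  have h1 := contDiffAt_negFactor (norm_inv_smul_lt hS hz)
  have h2 : ContDiffAt ℂ ∞ (fun q : X × ℂ => q.2⁻¹) (u, z) := contDiffAt_snd.inv hz0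
  have h3 : ContDiffAt ℂ ∞ (fun q : X × ℂ => Ring.inverse (1 - q.2⁻¹ • S)) (u, z) :=
    ContDiffAt.comp (g := fun w : ℂ => Ring.inverse (1 - w • S)) (u, z) h1 h2
  exact (ev.contDiff.contDiffAt.comp _ (h2.smul (h3.clm_apply contDiffAt_fst))).contDiffWithinAt

theorem tendsto_negSeries (u : X) :
    Tendsto (fun z : ℂ => negSeries S ev u z⁻¹) (𝓝 0) (𝓝 0) := by
  have h1 : ContinuousAt (fun w : ℂ => ev (w • Ring.inverse (1 - w • S) u)) 0 := by
    have h2 := (contDiffAt_negFactor (S := S) (w := 0) (by simp)).continuousAt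
    exact ev.continuous.continuousAt.comp
      (continuousAt_id.smul (h2.clm_apply continuousAt_const))
  simpa [negSeries, ContinuousAt] using h1

end Neumann

/-! ### Toeplitz operators on bounded sequences -/

section Toeplitz

variable {M Y : Type} [NormedRing M] [NormedAlgebra ℂ M] [CompleteSpace M]
  [NormedAddCommGroup Y] [NormedSpace ℂ Y]

theorem summable_half_pow_natAbs : Summable fun j : ℤ => (1 / 2 : ℝ) ^ j.natAbs := by
  refine Summable.of_nat_of_neg ?_ ?_ <;> simpa using summable_geometric_two

theorem summable_half_pow_natAbs_sub (m : ℕ) :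
    Summable fun n : ℕ => (1 / 2 : ℝ) ^ ((n : ℤ) - m).natAbs :=
  summable_half_pow_natAbs.comp_injective (i := fun n : ℕ => (n : ℤ) - m) fun a b h => by
    simpa using h

theorem tsum_half_pow_natAbs_sub_le (m : ℕ) :
    ∑' n : ℕ, (1 / 2 : ℝ) ^ ((n : ℤ) - m).natAbs ≤ ∑' j : ℤ, (1 / 2 : ℝ) ^ j.natAbs :=
  tsum_comp_le_tsum_of_inj (i := fun n : ℕ => (n : ℤ) - m) summable_half_pow_natAbs
    (fun _ => by positivity) fun a b h => by simpa using h

/-- The unknown is a factor v = 1 + ∑ 2⁻ⁿ uₙ z⁻ⁿ⁻¹ for which v γ has no negative powers. Multiplying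
the equation for the coefficient of index -(m + 1) by 2ᵐ puts the weight 2ᵐ⁻ⁿ on the entries
c_{n-m}. The decay 4^{-|n-m|} absorbs this weight and leaves 2^{-|n-m|}, whose sum over n is bounded
uniformly in m. -/
theorem weight_le (m n : ℕ) :
    (2 : ℝ) ^ m * (1 / 2 : ℝ) ^ n * (1 / 4 : ℝ) ^ ((n : ℤ) - m).natAbs ≤
      (1 / 2 : ℝ) ^ ((n : ℤ) - m).natAbs := by
  have h4 : (1 / 4 : ℝ) = (1 / 2) * (1 / 2) := by norm_num
  rcases le_total m n with h | h
  · obtain ⟨k, rfl⟩ := Nat.exists_eq_add_of_le h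
    have : (((m + k : ℕ) : ℤ) - m).natAbs = k := by omega
    rw [this, pow_add, h4, mul_pow]
    have h1 : (2 : ℝ) ^ m * (1 / 2) ^ m = 1 := by rw [← mul_pow]; norm_num
    have h2 : (1 / 2 : ℝ) ^ k ≤ 1 := pow_le_one₀ (by norm_num) (by norm_num)
    have h3 : (0 : ℝ) < (1 / 2 : ℝ) ^ k := by positivity
    calc _ = ((2 : ℝ) ^ m * (1 / 2) ^ m) * ((1 / 2) ^ k * (1 / 2) ^ k) * (1 / 2) ^ k := by ring
      _ ≤ 1 * (1 * 1) * (1 / 2) ^ k := by rw [h1]; gcongr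
      _ = _ := by ring
  · obtain ⟨k, rfl⟩ := Nat.exists_eq_add_of_le h
    have : ((n : ℤ) - ((n + k : ℕ) : ℤ)).natAbs = k := by omega
    rw [this, pow_add, h4, mul_pow]
    have h1 : (2 : ℝ) ^ n * (1 / 2) ^ n = 1 := by rw [← mul_pow]; norm_num
    have h2 : (2 : ℝ) ^ k * (1 / 2) ^ k = 1 := by rw [← mul_pow]; norm_num
    refine le_of_eq ?_
    calc _ = ((2 : ℝ) ^ n * (1 / 2) ^ n) * ((2 : ℝ) ^ k * (1 / 2) ^ k) * (1 / 2) ^ k := by ring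
      _ = _ := by rw [h1, h2]; ring

/-- The matrix entries of the weighted Toeplitz operator with symbol coefficients `c`. -/
noncomputable def toeplitzTerm (c : ℤ → Y →L[ℂ] M) (y : Y) (u : ℕ →ᵇ M) (m n : ℕ) : M :=
  ((2 : ℂ) ^ m * (1 / 2 : ℂ) ^ n) • (u n * c (n - m) y)

variable {c : ℤ → Y →L[ℂ] M} (hc : ∀ j y, ‖c j y‖ ≤ (1 / 4 : ℝ) ^ j.natAbs * ‖y‖)

include hc in
theorem norm_toeplitzTerm_le (y : Y) (u : ℕ →ᵇ M) (m n : ℕ) :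
    ‖toeplitzTerm c y u m n‖ ≤ (1 / 2 : ℝ) ^ ((n : ℤ) - m).natAbs * (‖y‖ * ‖u‖) := by
  rw [toeplitzTerm, norm_smul]
  have h1 : ‖(2 : ℂ) ^ m * (1 / 2 : ℂ) ^ n‖ = (2 : ℝ) ^ m * (1 / 2 : ℝ) ^ n := by simp
  rw [h1]
  calc _ ≤ (2 : ℝ) ^ m * (1 / 2 : ℝ) ^ n *
        (‖u‖ * ((1 / 4 : ℝ) ^ ((n : ℤ) - m).natAbs * ‖y‖)) := by
        gcongr
        refine (norm_mul_le _ _).trans ?_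
        gcongr
        · exact u.norm_coe_le_norm n
        · exact hc _ _
    _ = ((2 : ℝ) ^ m * (1 / 2 : ℝ) ^ n * (1 / 4 : ℝ) ^ ((n : ℤ) - m).natAbs) *
        (‖y‖ * ‖u‖) := by ring
    _ ≤ _ := by gcongr; exact weight_le m n

include hc in
theorem summable_toeplitzTerm (y : Y) (u : ℕ →ᵇ M) (m : ℕ) :
    Summable (toeplitzTerm c y u m) :=
  Summable.of_norm_bounded ((summable_half_pow_natAbs_sub m).mul_right _)
    (norm_toeplitzTerm_le hc y u m)

include hc in
theorem norm_tsum_toeplitzTerm_le (y : Y) (u : ℕ →ᵇ M) (m : ℕ) :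
    ‖∑' n, toeplitzTerm c y u m n‖ ≤ (∑' j : ℤ, (1 / 2 : ℝ) ^ j.natAbs) * ‖y‖ * ‖u‖ := by
  refine (tsum_of_norm_bounded ((summable_half_pow_natAbs_sub m).mul_right _).hasSum
    (norm_toeplitzTerm_le hc y u m)).trans ?_
  rw [tsum_mul_right, mul_assoc]
  gcongr
  exact tsum_half_pow_natAbs_sub_le m

/-- The weighted Toeplitz operators on bounded sequences, depending linearly on the symbol. -/
noncomputable def toeplitz : Y →L[ℂ] (ℕ →ᵇ M) →L[ℂ] (ℕ →ᵇ M) :=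
  LinearMap.mkContinuous₂
    (LinearMap.mk₂ ℂ (fun (y : Y) (u : ℕ →ᵇ M) =>
      BoundedContinuousFunction.ofNormedAddCommGroupDiscrete
        (fun m => ∑' n, toeplitzTerm c y u m n) _ (norm_tsum_toeplitzTerm_le hc y u))
      (by
        intro y y' u; ext m
        simp only [BoundedContinuousFunction.add_apply,
          BoundedContinuousFunction.coe_ofNormedAddCommGroupDiscrete]
        rw [← (summable_toeplitzTerm hc y u m).tsum_add (summable_toeplitzTerm hc y' u m)]
        simp only [toeplitzTerm, map_add, mul_add, smul_add])
      (by
        intro a y u; ext m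
        simp only [BoundedContinuousFunction.smul_apply,
          BoundedContinuousFunction.coe_ofNormedAddCommGroupDiscrete]
        rw [← (summable_toeplitzTerm hc y u m).tsum_const_smul]
        simp only [toeplitzTerm, map_smul, mul_smul_comm, smul_comm a])
      (by
        intro y u u'; ext m
        simp only [BoundedContinuousFunction.add_apply,
          BoundedContinuousFunction.coe_ofNormedAddCommGroupDiscrete]
        rw [← (summable_toeplitzTerm hc y u m).tsum_add (summable_toeplitzTerm hc y u' m)]
        simp only [toeplitzTerm, BoundedContinuousFunction.add_apply, add_mul, smul_add])
      (by
        intro a y u; ext m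
        simp only [BoundedContinuousFunction.smul_apply,
          BoundedContinuousFunction.coe_ofNormedAddCommGroupDiscrete]
        rw [← (summable_toeplitzTerm hc y u m).tsum_const_smul]
        simp only [toeplitzTerm, BoundedContinuousFunction.smul_apply, smul_mul_assoc,
          smul_comm a]))
    (∑' j : ℤ, (1 / 2 : ℝ) ^ j.natAbs)
    (fun y u => by
      refine (BoundedContinuousFunction.norm_le (by positivity)).2 fun m => ?_
      exact norm_tsum_toeplitzTerm_le hc y u m)

theorem toeplitz_apply (y : Y) (u : ℕ →ᵇ M) (m : ℕ) :
    toeplitz hc y u m = ∑' n, toeplitzTerm c y u m n := rfl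

include hc in
theorem norm_negCoeff_le (y : Y) (m : ℕ) : ‖(2 : ℂ) ^ m • c (-(m + 1)) y‖ ≤ 1 * ‖y‖ := by
  rw [norm_smul, norm_pow, Complex.norm_ofNat]
  calc (2 : ℝ) ^ m * ‖c (-(m + 1)) y‖ ≤ 2 ^ m * ((1 / 4 : ℝ) ^ (m + 1) * ‖y‖) := by
        gcongr
        refine (hc _ y).trans_eq ?_
        congr 2
    _ = (2 ^ m * (1 / 2) ^ m) * (1 / 2) ^ m * (1 / 4) * ‖y‖ := by
        have h4 : (1 / 4 : ℝ) ^ m = (1 / 2) ^ m * (1 / 2) ^ m := by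
          rw [← mul_pow]; norm_num
        rw [pow_succ, h4]; ring
    _ ≤ 1 * ‖y‖ := by
        have h1 : (2 : ℝ) ^ m * (1 / 2) ^ m = 1 := by rw [← mul_pow]; norm_num
        have h2 : (1 / 2 : ℝ) ^ m ≤ 1 := pow_le_one₀ (by norm_num) (by norm_num)
        rw [h1]
        gcongr
        linarith

/-- The weighted sequence of coefficients of negative index. -/
noncomputable def negCoeff : Y →L[ℂ] (ℕ →ᵇ M) :=
  LinearMap.mkContinuous
    { toFun := fun y => BoundedContinuousFunction.ofNormedAddCommGroupDiscrete
        (fun m : ℕ => (2 : ℂ) ^ m • c (-(m + 1)) y) _ (norm_negCoeff_le hc y)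
      map_add' := by intro y y'; ext m; simp
      map_smul' := by intro a y; ext m; simp [smul_comm a] } 1
    (fun y => (BoundedContinuousFunction.norm_le (by positivity)).2 (norm_negCoeff_le hc y))

theorem negCoeff_apply (y : Y) (m : ℕ) : negCoeff hc y m = (2 : ℂ) ^ m • c (-(m + 1)) y := rfl

/-- The solution `u` of `T_y u = - (negative coefficients)`. -/
noncomputable def toeplitzSol (y : Y) : ℕ →ᵇ M :=
  -(Ring.inverse (toeplitz hc y) (negCoeff hc y))

theorem toeplitz_toeplitzSol {y : Y} (hy : IsUnit (toeplitz hc y)) :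
    toeplitz hc y (toeplitzSol hc y) = -negCoeff hc y := by
  have := DFunLike.congr_fun (Ring.mul_inverse_cancel _ hy) (negCoeff hc y)
  rw [mul_apply_eq_comp, one_apply_eq_self] at this
  rw [toeplitzSol, map_neg, this]

theorem contDiffAt_toeplitzSol {y : Y} (hy : IsUnit (toeplitz hc y)) :
    ContDiffAt ℂ ∞ (toeplitzSol hc) y :=
  (contDiffAt_inverse_apply (X := ℕ →ᵇ M) (toeplitz hc) (negCoeff hc) hy).neg

/-- The coefficient sums of a product with negative powers. -/
theorem tsum_coeff_eq_zero {y : Y} (hy : IsUnit (toeplitz hc y)) (m : ℕ) :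
    c (-(m + 1)) y + ∑' n : ℕ, (1 / 2 : ℂ) ^ n • (toeplitzSol hc y n * c (n - m) y) = 0 := by
  have h := DFunLike.congr_fun (toeplitz_toeplitzSol hc hy) m
  rw [toeplitz_apply, BoundedContinuousFunction.neg_apply, negCoeff_apply] at h
  simp only [toeplitzTerm, mul_smul] at h
  have h2 : (2 : ℂ) ^ m ≠ 0 := pow_ne_zero _ two_ne_zero
  rw [tsum_const_smul'' ((2 : ℂ) ^ m), ← smul_neg] at h
  rw [smul_right_injective M h2 h]
  abel

end Toeplitz

/-! ### The shift and its resolvent -/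

section Shift

variable {M : Type} [NormedRing M] [NormedAlgebra ℂ M] [CompleteSpace M]

theorem norm_half_smul_le (u : ℕ →ᵇ M) (n : ℕ) : ‖(1 / 2 : ℂ) • u (n + 1)‖ ≤ (1 / 2) * ‖u‖ := by
  rw [norm_smul]
  simp only [one_div, norm_inv, Complex.norm_ofNat]
  gcongr
  exact u.norm_coe_le_norm _

/-- Half of the backward shift. -/
noncomputable def halfShift : (ℕ →ᵇ M) →L[ℂ] (ℕ →ᵇ M) :=
  LinearMap.mkContinuous
    { toFun := fun u => BoundedContinuousFunction.ofNormedAddCommGroupDiscrete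
        (fun n : ℕ => (1 / 2 : ℂ) • u (n + 1)) ((1 / 2) * ‖u‖) (norm_half_smul_le u)
      map_add' := by intro y y'; ext m; exact smul_add _ _ _
      map_smul' := by intro a y; ext m; exact smul_comm _ _ _ } (1 / 2)
    (fun u => (BoundedContinuousFunction.norm_le (by positivity)).2 (norm_half_smul_le u))

theorem halfShift_apply (u : ℕ →ᵇ M) (n : ℕ) : halfShift u n = (1 / 2 : ℂ) • u (n + 1) := rfl

theorem norm_halfShift_le : ‖(halfShift : (ℕ →ᵇ M) →L[ℂ] (ℕ →ᵇ M))‖ ≤ 1 / 2 :=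
  LinearMap.mkContinuous_norm_le _ (by norm_num) _

/-- At n = 0 this reads 2⁻ᵏ u_k, so the resolvent of the shift, evaluated at the entry 0, is the
generating series of the weighted sequence u. -/
theorem halfShift_pow_apply (u : ℕ →ᵇ M) (k n : ℕ) :
    (halfShift ^ k) u n = (1 / 2 : ℂ) ^ k • u (n + k) := by
  induction k generalizing n with
  | zero => simp
  | succ k ih =>
    rw [pow_succ', mul_apply_eq_comp, halfShift_apply, ih, smul_smul, pow_succ']
    congr 2
    ring

end Shift

/-! ### Birkhoff factorization near the identity -/

section Coefficients

variable {M : Type} [NormedAddCommGroup M] [NormedSpace ℂ M] [CompleteSpace M]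

/-- `w ↦ wᵏ` on a circle about the origin. -/
noncomputable def zpowMap {r : ℝ} (hr : 0 < r) (k : ℤ) : C(sphere (0 : ℂ) r, ℂ) :=
  ⟨fun w => (w : ℂ) ^ k, continuous_subtype_val.zpow₀ k fun w => Or.inl fun h => by
    have := w.2
    rw [mem_sphere_zero_iff_norm, h, norm_zero] at this
    exact hr.ne this⟩

theorem zpowMap_apply {r : ℝ} (hr : 0 < r) (k : ℤ) (w : sphere (0 : ℂ) r) :
    zpowMap hr k w = (w : ℂ) ^ k := rfl

/-- The Laurent coefficients as functionals on continuous functions on a circle. -/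
noncomputable def coeffCLM {r : ℝ} (hr : 0 < r) (j : ℤ) : C(sphere (0 : ℂ) r, M) →L[ℂ] M :=
  (circleFunctional 0 r hr.le).comp (smulBilin (sphere (0 : ℂ) r) (zpowMap hr (-j - 1)))

theorem coeffCLM_apply {r : ℝ} (hr : 0 < r) (j : ℤ) {φ : C(sphere (0 : ℂ) r, M)} {f : ℂ → M}
    (h : ∀ w : sphere (0 : ℂ) r, φ w = f w) : coeffCLM hr j φ = laurentCoeff f r j := by
  rw [coeffCLM, ContinuousLinearMap.comp_apply, circleFunctional_apply hr.le _
    (fun w => w ^ (-j - 1) • f w)]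
  · rfl
  · intro w
    rw [smulBilin_apply, zpowMap_apply, h]

theorem norm_coeffCLM_le {r : ℝ} (hr : 0 < r) (j : ℤ) (φ : C(sphere (0 : ℂ) r, M)) :
    ‖coeffCLM hr j φ‖ ≤ r ^ (-j) * ‖φ‖ := by
  refine (norm_circleFunctional_le hr.le _).trans ?_
  have : ‖smulBilin (sphere (0 : ℂ) r) (zpowMap hr (-j - 1)) φ‖ ≤ r ^ (-j - 1) * ‖φ‖ := by
    rw [ContinuousMap.norm_le _ (by positivity)]
    intro w
    have hw := w.2
    rw [mem_sphere_zero_iff_norm] at hw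
    rw [smulBilin_apply, norm_smul, zpowMap_apply, norm_zpow, hw]
    gcongr
    exact φ.norm_coe_le_norm w
  refine (mul_le_mul_of_nonneg_left this hr.le).trans_eq ?_
  · show r * (r ^ (-j - 1) * ‖φ‖) = _
    · 
      rw [zpow_sub₀ hr.ne', zpow_one]
      field_simp

theorem laurentCoeff_const {r : ℝ} (hr : 0 < r) (j : ℤ) (x : M) :
    laurentCoeff (fun _ => x) r j = if j = 0 then x else 0 := by
  rw [laurentCoeff, circleIntegral.integral_smul_const]
  split_ifs with h
  · subst h
    have := circleIntegral.integral_sub_center_inv (0 : ℂ) hr.ne'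
    simp only [sub_zero] at this
    simp only [neg_zero, zero_sub, zpow_neg_one, this, smul_smul]
    rw [inv_mul_cancel₀ Complex.two_pi_I_ne_zero, one_smul]
  · have := circleIntegral.integral_sub_zpow_of_ne (n := -j - 1) (by omega) (0 : ℂ) 0 r
    simp only [sub_zero] at this
    rw [this, zero_smul, smul_zero]

/-- Abel's lemma: convergence at z bounds the terms zᵏ aₖ, hence gives geometric domination on every
disc of radius less than |z|; such z exist with arbitrarily large modulus. -/
theorem entire_of_summable {a : ℕ → M}
    (h : ∀ R : ℝ, ∃ z : ℂ, R < ‖z‖ ∧ Summable fun k => z ^ k • a k) :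
    Differentiable ℂ (fun z : ℂ => ∑' k, z ^ k • a k) ∧
      ∀ z : ℂ, Summable fun k => z ^ k • a k := by
  have key : ∀ s : ℝ, 0 < s → ∃ u : ℕ → ℝ, Summable u ∧
      ∀ k, ∀ w ∈ ball (0 : ℂ) s, ‖w ^ k • a k‖ ≤ u k := by
    intro s hs
    obtain ⟨z, hz, hsum⟩ := h s
    obtain ⟨C, hC⟩ := hsum.tendsto_atTop_zero.norm.bddAbove_range
    refine ⟨fun k => C * (s / ‖z‖) ^ k, (summable_geometric_of_lt_one (by positivity)
      ((div_lt_one (hs.trans hz)).2 hz)).mul_left C, fun k w hw => ?_⟩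
    have h1 : ‖z ^ k • a k‖ ≤ C := hC ⟨k, rfl⟩
    rw [norm_smul, norm_pow] at h1
    rw [mem_ball_zero_iff] at hw
    have hz0 : 0 < ‖z‖ := hs.trans hz
    calc ‖w ^ k • a k‖ = ‖w‖ ^ k * ‖a k‖ := by rw [norm_smul, norm_pow]
      _ ≤ s ^ k * ‖a k‖ := by gcongr
      _ = (‖z‖ ^ k * ‖a k‖) * (s / ‖z‖) ^ k := by rw [div_pow]; field_simp
      _ ≤ C * (s / ‖z‖) ^ k := by gcongr
  constructor
  · intro z
    obtain ⟨u, hu, hb⟩ := key (‖z‖ + 1) (by positivity)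
    refine (Complex.differentiableOn_tsum_of_summable_norm (F := fun k (w : ℂ) => w ^ k • a k)
      hu (fun k => ?_) isOpen_ball hb).differentiableAt (isOpen_ball.mem_nhds ?_)
    · exact ((differentiable_id.pow k).smul_const (a k)).differentiableOn
    · simp
  · intro z
    obtain ⟨u, hu, hb⟩ := key (‖z‖ + 1) (by positivity)
    exact Summable.of_norm_bounded hu fun k => hb k z (by simp)

end Coefficients

theorem HasSum.congr_fun' {ι N : Type} [AddCommMonoid N] [TopologicalSpace N] {f g : ι → N} {a : N}
    (h : HasSum f a) (hfg : ∀ i, f i = g i) : HasSum g a := by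
  rwa [← funext hfg]

section Birkhoff

variable {M : Type} [NormedRing M] [NormedAlgebra ℂ M] [CompleteSpace M]

theorem laurentCoeff_smul_mul {r : ℝ} (hr : 0 < r) (j k : ℤ) (a : ℂ) (x : M) {f : ℂ → M}
    (hf : ContinuousOn f (sphere 0 r)) :
    laurentCoeff (fun w => w ^ k • a • (x * f w)) r j = a • (x * laurentCoeff f r (j - k)) := by
  have hne : ∀ w ∈ sphere (0 : ℂ) r, w ≠ 0 := fun w hw h => by
    rw [mem_sphere_zero_iff_norm, h, norm_zero] at hw
    exact hr.ne hw
  have h1 : (∮ w in C(0, r), w ^ (-j - 1) • w ^ k • a • (x * f w)) =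
      a • (x * ∮ w in C(0, r), w ^ (-(j - k) - 1) • f w) := by
    have hc : ContinuousOn (fun w : ℂ => w ^ (-(j - k) - 1) • f w) (sphere 0 r) :=
      ContinuousOn.smul (continuousOn_id.zpow₀ _ fun w hw => Or.inl (hne w hw)) hf
    have h2 := (ContinuousLinearMap.mul ℂ M x).intervalIntegral_comp_comm
      (hc.circleIntegrable hr.le).out
    rw [circleIntegral.integral_congr (g := fun w => a • (x * (w ^ (-(j - k) - 1) • f w))) hr.le,
      circleIntegral.integral_smul]
    · congr 1
      simp only [ContinuousLinearMap.mul_apply'] at h2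
      rw [circleIntegral, circleIntegral, ← h2]
      simp only [mul_smul_comm]
    · intro w hw
      simp only [mul_smul_comm]
      rw [smul_smul, ← zpow_add₀ (hne w hw), smul_comm]
      congr 3
      ring
  rw [laurentCoeff, h1, laurentCoeff, smul_comm, mul_smul_comm]

/-- The coefficient functionals on pairs of functions on the circles of radius `4` and `1/4`. -/
noncomputable def symbolCoeff (j : ℤ) :
    C(sphere (0 : ℂ) 4, M) × C(sphere (0 : ℂ) (1 / 4), M) →L[ℂ] M :=
  if 0 ≤ j then (coeffCLM (by norm_num) j).comp (ContinuousLinearMap.fst ℂ _ _)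
  else (coeffCLM (by norm_num) j).comp (ContinuousLinearMap.snd ℂ _ _)

/-- Cauchy's estimate on the circle of radius 4 for j ≥ 0 and of radius 1/4 for j < 0 gives the
decay 4^{-|j|} on both sides. -/
theorem norm_symbolCoeff_le (j : ℤ)
    (y : C(sphere (0 : ℂ) 4, M) × C(sphere (0 : ℂ) (1 / 4), M)) :
    ‖symbolCoeff j y‖ ≤ (1 / 4 : ℝ) ^ j.natAbs * ‖y‖ := by
  unfold symbolCoeff
  split_ifs with h
  · refine (norm_coeffCLM_le (by norm_num) j y.1).trans ?_
    obtain ⟨n, rfl⟩ := Int.eq_ofNat_of_zero_le h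
    have h4 : (4 : ℝ) ^ (-(n : ℤ)) = (1 / 4 : ℝ) ^ n := by
      rw [zpow_neg, zpow_natCast, one_div, inv_pow]
    refine (mul_le_mul_of_nonneg_left (norm_fst_le y) (by positivity)).trans_eq ?_
    exact congrArg (· * ‖y‖) h4
  · refine (norm_coeffCLM_le (by norm_num) j y.2).trans ?_
    obtain ⟨n, hn⟩ := Int.eq_ofNat_of_zero_le (a := -j) (by omega)
    obtain rfl : j = -n := by omega
    rw [neg_neg, zpow_natCast, Int.natAbs_neg, Int.natAbs_natCast]
    gcongr
    exact norm_snd_le y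

/-- For a function holomorphic on ℂ^* the radius is immaterial, so the two circles together yield
its Laurent coefficients. -/
theorem symbolCoeff_apply (j : ℤ)
    {y : C(sphere (0 : ℂ) 4, M) × C(sphere (0 : ℂ) (1 / 4), M)} {f : ℂ → M}
    (hf : DifferentiableOn ℂ f {0}ᶜ) (h1 : ∀ w, y.1 w = f w) (h2 : ∀ w, y.2 w = f w) {r : ℝ}
    (hr : 0 < r) : symbolCoeff j y = laurentCoeff f r j := by
  have hf' : DifferentiableOn ℂ f {z | 0 < ‖z‖} := hf.mono fun z hz => norm_pos_iff.1 hz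
  unfold symbolCoeff
  split_ifs with h
  · rw [ContinuousLinearMap.comp_apply, ContinuousLinearMap.coe_fst', coeffCLM_apply _ _ h1]
    exact laurentCoeff_eq le_rfl hf' (by norm_num) hr j
  · rw [ContinuousLinearMap.comp_apply, ContinuousLinearMap.coe_snd', coeffCLM_apply _ _ h2]
    exact laurentCoeff_eq le_rfl hf' (by norm_num) hr j

/-- The symbol of the loop 1. Units form an open set, so the operators of nearby loops are
invertible. -/
theorem toeplitz_eq_one {Y : Type} [NormedAddCommGroup Y] [NormedSpace ℂ Y] {c : ℤ → Y →L[ℂ] M}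
    (hc : ∀ j y, ‖c j y‖ ≤ (1 / 4 : ℝ) ^ j.natAbs * ‖y‖) {y : Y}
    (hy : ∀ j, c j y = if j = 0 then 1 else 0) : toeplitz hc y = 1 := by
  ext u m
  rw [toeplitz_apply, tsum_eq_single m]
  · simp only [toeplitzTerm, hy, sub_self, if_true, mul_one, one_apply_eq_self]
    rw [← mul_pow]
    norm_num
  · intro n hn
    have : (n : ℤ) - m ≠ 0 := fun h => hn (by omega)
    simp [toeplitzTerm, hy, this]

/-- `v = 1 + ∑ 2⁻ⁿ uₙ z⁻ⁿ⁻¹`. -/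
noncomputable def negFactor (u : ℕ →ᵇ M) (z : ℂ) : M :=
  1 + negSeries halfShift (BoundedContinuousFunction.evalCLM ℂ 0) u z

theorem hasSum_negFactor (u : ℕ →ᵇ M) {z : ℂ} (hz : 1 / 2 < ‖z‖) :
    HasSum (fun n : ℕ => z ^ (-(n + 1 : ℤ)) • (1 / 2 : ℂ) ^ n • u n) (negFactor u z - 1) := by
  rw [negFactor, add_sub_cancel_left]
  refine (hasSum_negSeries (X := ℕ →ᵇ M) (BoundedContinuousFunction.evalCLM ℂ 0)
    norm_halfShift_le u hz).congr_fun' fun n => ?_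
  have := halfShift_pow_apply u n 0
  rw [zero_add] at this
  exact congrArg (z ^ (-(n + 1 : ℤ)) • ·) this

theorem contDiffOn_negFactor : ContDiffOn ℂ ∞ (fun q : (ℕ →ᵇ M) × ℂ => negFactor q.1 q.2)
    (univ ×ˢ {z : ℂ | 1 / 2 < ‖z‖}) :=
  contDiffOn_const.add (contDiffOn_negSeries (X := ℕ →ᵇ M)
    (BoundedContinuousFunction.evalCLM ℂ 0) norm_halfShift_le)

theorem tendsto_negFactor (u : ℕ →ᵇ M) :
    Tendsto (fun z : ℂ => negFactor u z⁻¹) (𝓝 0) (𝓝 1) := by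
  have := (tendsto_negSeries (X := ℕ →ᵇ M) (S := halfShift)
    (BoundedContinuousFunction.evalCLM ℂ 0) u).const_add 1
  rwa [add_zero] at this

/-- For r ≥ 1 the powers w⁻ⁿ⁻¹ are bounded by 1 on the circle, so the series of `negFactor`
converges uniformly there and coefficients may be taken term by term. -/
theorem laurentCoeff_negFactor_mul {f : ℂ → M} {r : ℝ} (hr : 1 / 2 < r)
    (hf : ContinuousOn f (sphere 0 r)) (u : ℕ →ᵇ M) (hr1 : 1 ≤ r) (j : ℤ) :
    laurentCoeff (fun z => negFactor u z * f z) r j = laurentCoeff f r j +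
      ∑' n : ℕ, (1 / 2 : ℂ) ^ n • (u n * laurentCoeff f r (j + (n + 1))) := by
  have hr0 : 0 < r := lt_trans (by norm_num) hr
  let G : C(sphere (0 : ℂ) r, M) := ⟨fun w => f w, hf.domRestrict⟩
  let t : ℕ → C(sphere (0 : ℂ) r, M) := fun n =>
    ⟨fun w => (w : ℂ) ^ (-(n + 1 : ℤ)) • (1 / 2 : ℂ) ^ n • (u n * G w),
      (zpowMap hr0 (-(n + 1 : ℤ))).continuous.smul
        ((continuous_const.mul G.continuous).const_smul _)⟩
  have ht : Summable t := by
    refine Summable.of_norm_bounded (g := fun n : ℕ => (1 / 2 : ℝ) ^ n * (‖u‖ * ‖G‖))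
      (summable_geometric_two.mul_right _) fun n => ?_
    rw [ContinuousMap.norm_le _ (by positivity)]
    intro w
    have hw := w.2
    rw [mem_sphere_zero_iff_norm] at hw
    change ‖(w : ℂ) ^ (-(n + 1 : ℤ)) • (1 / 2 : ℂ) ^ n • (u n * G w)‖ ≤ _
    rw [norm_smul, norm_smul, norm_zpow, hw, norm_pow]
    have h1 : r ^ (-(n + 1 : ℤ)) ≤ 1 := zpow_le_one_of_nonpos₀ hr1 (by omega)
    have h2 : ‖(1 / 2 : ℂ)‖ = 1 / 2 := by simp
    rw [h2]
    calc _ ≤ 1 * ((1 / 2 : ℝ) ^ n * (‖u n‖ * ‖G w‖)) := by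
          gcongr
          exact norm_mul_le _ _
      _ ≤ 1 * ((1 / 2 : ℝ) ^ n * (‖u‖ * ‖G‖)) := by
          gcongr
          · exact u.norm_coe_le_norm n
          · exact G.norm_coe_le_norm w
      _ = _ := one_mul _
  have hval : ∀ w : sphere (0 : ℂ) r, (G + ∑' n, t n) w = negFactor u w * f w := by
    intro w
    have hw := w.2
    rw [mem_sphere_zero_iff_norm] at hw
    have h1 := ht.hasSum.mapL (ContinuousMap.evalCLM ℂ w)
    have h2 := (hasSum_negFactor u (z := w) (by rw [hw]; exact hr)).mul_right (f w)
    have h3 : (∑' n, t n) w = (negFactor u w - 1) * f w := by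
      refine h1.unique (h2.congr_fun' fun n => ?_)
      rw [smul_mul_assoc, smul_mul_assoc]
      rfl
    rw [ContinuousMap.add_apply, h3, sub_mul, one_mul]
    change f w + _ = _
    abel
  rw [← coeffCLM_apply hr0 j hval, map_add]
  have hG : coeffCLM hr0 j G = laurentCoeff f r j :=
    coeffCLM_apply hr0 j (φ := G) (f := f) fun w => rfl
  refine congrArg₂ (· + ·) hG ?_
  · have h1 := ht.hasSum.mapL (coeffCLM hr0 j)
    rw [← h1.tsum_eq]
    refine tsum_congr fun n => ?_
    have h2 := coeffCLM_apply hr0 j (φ := t n)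
      (f := fun w => w ^ (-(n + 1 : ℤ)) • (1 / 2 : ℂ) ^ n • (u n * f w)) fun w => rfl
    rw [h2, laurentCoeff_smul_mul hr0 _ _ _ _ hf]
    congr 3

end Birkhoff

/-! ### Smooth local Birkhoff factorization of families through the loop 1. -/

section LocalBirkhoff

variable {E M : Type} [NormedAddCommGroup E] [NormedSpace ℝ E] [NormedRing M] [NormedAlgebra ℂ M]
  [CompleteSpace M]

/-- The Toeplitz equation says that the coefficients of negative index of v γ vanish, so its Laurent
series is a power series. -/
theorem hasSum_negFactor_mul {γ : ℂ → M} (hγ : DifferentiableOn ℂ γ {0}ᶜ)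
    {y : C(sphere (0 : ℂ) 4, M) × C(sphere (0 : ℂ) (1 / 4), M)}
    (h1 : ∀ w, y.1 w = γ w) (h2 : ∀ w, y.2 w = γ w)
    (hy : IsUnit (toeplitz (norm_symbolCoeff_le (M := M)) y)) {z : ℂ} (hz : 1 / 2 < ‖z‖) :
    HasSum (fun k : ℕ => z ^ k • laurentCoeff (fun w =>
      negFactor (toeplitzSol (norm_symbolCoeff_le (M := M)) y) w * γ w) 1 k)
      (negFactor (toeplitzSol (norm_symbolCoeff_le (M := M)) y) z * γ z) := by
  set u := toeplitzSol (norm_symbolCoeff_le (M := M)) y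
  have hd : DifferentiableOn ℂ (fun w => negFactor u w * γ w) {z : ℂ | 1 / 2 < ‖z‖} := by
    refine DifferentiableOn.mul ?_ (hγ.mono fun z hz => ?_)
    · exact ((contDiffOn_negFactor (M := M)).comp (f := fun z : ℂ => (u, z))
        (contDiff_const.prodMk contDiff_id).contDiffOn
        (fun z hz => ⟨mem_univ _, hz⟩)).differentiableOn (by simp)
    · exact norm_pos_iff.1 (lt_trans (by norm_num) hz)
  have hL := hasSum_laurent (by norm_num) hd (R := 1) (by norm_num) hz
  refine ((Nat.cast_injective (R := ℤ)).hasSum_iff fun j hj => ?_).2 hL |>.congr_fun' fun k => ?_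
  · obtain ⟨m, rfl⟩ : ∃ m : ℕ, j = -(m + 1) := by
      refine ⟨(-j - 1).toNat, ?_⟩
      have : j < 0 := by
        by_contra hcon
        exact hj ⟨j.toNat, by simpa using hcon⟩
      omega
    rw [laurentCoeff_negFactor_mul (by norm_num) (hγ.continuousOn.mono ?_) u le_rfl]
    · have h3 := tsum_coeff_eq_zero (norm_symbolCoeff_le (M := M)) hy m
      rw [symbolCoeff_apply _ hγ h1 h2 one_pos] at h3
      have h4 : ∀ n : ℕ, symbolCoeff ((n : ℤ) - m) y =
          laurentCoeff γ 1 (-(m + 1 : ℤ) + (n + 1)) := fun n => by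
        rw [symbolCoeff_apply _ hγ h1 h2 one_pos]
        congr 1
        ring
      simp only [h4] at h3
      rw [h3, smul_zero]
    · intro w hw h
      rw [mem_sphere_zero_iff_norm, mem_singleton_iff.1 h, norm_zero] at hw
      norm_num at hw
  · simp

/-- Let v be the factor given by the Toeplitz solution. A priori v γ makes sense only for |z| > 1/2,
but there it is a power series, which then converges everywhere; b is its sum. Near ∞ one has b γ⁻¹
= v, which tends to 1. -/
theorem exists_local_birkhoff {V : Set E} (hV : IsOpen V) {p₀ : E} (hp₀ : p₀ ∈ V)
    {γ : E → ℂ → M}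
    (hγ : ContDiffOn ℝ ∞ (fun q : E × ℂ => γ q.1 q.2) (V ×ˢ {0}ᶜ))
    (hhol : ∀ p ∈ V, DifferentiableOn ℂ (γ p) {0}ᶜ)
    (hu : ∀ p ∈ V, ∀ z, z ≠ 0 → IsUnit (γ p z)) (h1 : ∀ z, z ≠ 0 → γ p₀ z = 1) :
    ∃ V' ⊆ V, IsOpen V' ∧ p₀ ∈ V' ∧ ∃ b : E → ℂ → M, (∀ p ∈ V', Differentiable ℂ (b p)) ∧
      ContDiffOn ℝ ∞ (fun q : E × ℂ => b q.1 q.2) (V' ×ˢ univ) ∧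
      ∀ p ∈ V', Tendsto (fun z => b p z⁻¹ * Ring.inverse (γ p z⁻¹)) (𝓝[≠] 0) (𝓝 1) := by
  have hsph : ∀ r : ℝ, 0 < r → V ×ˢ sphere (0 : ℂ) r ⊆ V ×ˢ {0}ᶜ := fun r hr =>
    prod_mono_right fun w hw h => by
      rw [mem_sphere_zero_iff_norm, mem_singleton_iff.1 h, norm_zero] at hw
      exact hr.ne hw
  have hW : IsOpen (V ×ˢ ({0}ᶜ : Set ℂ)) := hV.prod isOpen_compl_singleton
  let Y := C(sphere (0 : ℂ) 4, M) × C(sphere (0 : ℂ) (1 / 4), M)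
  let g : E × ℂ → M := fun q => γ q.1 q.2
  -- The Toeplitz operator only sees the values on two circles, and these depend smoothly on the
  -- parameter as points of a Banach space.
  let y : E → Y := fun p => (slice (sphere (0 : ℂ) 4) g p, slice (sphere (0 : ℂ) (1 / 4)) g p)
  have hy : ContDiffOn ℝ ∞ y V :=
    (contDiffOn_slice hV hW hγ (hsph 4 (by norm_num))).prodMk
      (contDiffOn_slice hV hW hγ (hsph (1 / 4) (by norm_num)))
  have hy1 : ∀ p ∈ V, ∀ w, (y p).1 w = γ p w := fun p hp w =>
    slice_apply hγ.continuousOn (hsph 4 (by norm_num)) hp w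
  have hy2 : ∀ p ∈ V, ∀ w, (y p).2 w = γ p w := fun p hp w =>
    slice_apply hγ.continuousOn (hsph (1 / 4) (by norm_num)) hp w
  let T := toeplitz (norm_symbolCoeff_le (M := M))
  let u : E → ℕ →ᵇ M := fun p => toeplitzSol (norm_symbolCoeff_le (M := M)) (y p)
  let V' : Set E := V ∩ y ⁻¹' {x | IsUnit (T x)}
  have hV' : IsOpen V' := by
    refine hy.continuousOn.isOpen_inter_preimage hV ?_
    have h := Units.isOpen (R := (ℕ →ᵇ M) →L[ℂ] (ℕ →ᵇ M))
    exact h.preimage T.continuous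
  have hp₀' : p₀ ∈ V' := by
    refine ⟨hp₀, ?_⟩
    change IsUnit (T (y p₀))
    have : T (y p₀) = 1 := toeplitz_eq_one _ fun j => by
      rw [symbolCoeff_apply (f := fun _ => 1) j (differentiableOn_const _)
        (fun w => ?_) (fun w => ?_) one_pos, laurentCoeff_const one_pos]
      · rw [hy1 p₀ hp₀, h1 _ (ne_zero_of_mem_sphere (by norm_num) w)]
      · rw [hy2 p₀ hp₀, h1 _ (ne_zero_of_mem_sphere (by norm_num) w)]
    rw [this]
    exact isUnit_one
  have hus : ContDiffOn ℝ ∞ u V' := fun p hp =>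
    ((contDiffAt_toeplitzSol (norm_symbolCoeff_le (M := M)) hp.2).restrict_scalars
      ℝ).comp_contDiffWithinAt p ((hy p hp.1).mono inter_subset_left)
  let B : E → ℂ → M := fun p z => negFactor (u p) z * γ p z
  let b : E → ℂ → M := fun p z => ∑' k : ℕ, z ^ k • laurentCoeff (B p) 1 k
  have hsum : ∀ p ∈ V', ∀ z : ℂ, 1 / 2 < ‖z‖ →
      HasSum (fun k : ℕ => z ^ k • laurentCoeff (B p) 1 k) (B p z) := fun p hp z hz =>
    hasSum_negFactor_mul (hhol p hp.1) (hy1 p hp.1) (hy2 p hp.1) hp.2 hz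
  have hbB : ∀ p ∈ V', ∀ z : ℂ, 1 / 2 < ‖z‖ → b p z = B p z := fun p hp z hz =>
    (hsum p hp z hz).tsum_eq
  have hb : ∀ p ∈ V', Differentiable ℂ (b p) := fun p hp =>
    (entire_of_summable fun R => ⟨((max R 1 + 1 : ℝ) : ℂ), by
      rw [Complex.norm_real, Real.norm_of_nonneg (by positivity)]
      exact (le_max_left _ _).trans_lt (lt_add_one _), (hsum p hp _ (by
      rw [Complex.norm_real, Real.norm_of_nonneg (by positivity)]
      have := le_max_right R 1
      linarith)).summable⟩).1
  have hBs : ContDiffOn ℝ ∞ (fun q : E × ℂ => B q.1 q.2) (V' ×ˢ {z : ℂ | 1 / 2 < ‖z‖}) := by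
    have e1 : ContDiffOn ℝ ∞ (fun q : E × ℂ => negFactor (u q.1) q.2)
        (V' ×ˢ {z : ℂ | 1 / 2 < ‖z‖}) :=
      ((contDiffOn_negFactor (M := M)).restrict_scalars ℝ).comp
        (f := fun q : E × ℂ => (u q.1, q.2))
        ((hus.comp contDiffOn_fst fun q hq => hq.1).prodMk contDiffOn_snd)
        fun q hq => ⟨mem_univ _, hq.2⟩
    exact e1.mul (hγ.mono (prod_mono inter_subset_left fun z (hz : 1 / 2 < ‖z‖) =>
      norm_pos_iff.1 (lt_trans one_half_pos hz)))
  have hopen : IsOpen (V' ×ˢ {z : ℂ | 1 / 2 < ‖z‖}) :=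
    hV'.prod (isOpen_lt continuous_const continuous_norm)
  refine ⟨V', inter_subset_left, hV', hp₀', b, hb, ?_, fun p hp => ?_⟩
  · rintro ⟨p, z⟩ ⟨hp, -⟩
    -- Outside the disc of radius 1/2, b is the smooth product v γ; inside the unit disc smoothness
    -- follows from the values on the unit circle by Cauchy's formula.
    rcases lt_or_ge (1 / 2) ‖z‖ with hz | hz
    · exact ((hBs.congr fun q hq => hbB q.1 hq.1 q.2 hq.2).contDiffAt
        (hopen.mem_nhds ⟨hp, hz⟩)).contDiffWithinAt
    · have hs : V' ×ˢ sphere (0 : ℂ) 1 ⊆ V' ×ˢ {z : ℂ | 1 / 2 < ‖z‖} :=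
        prod_mono_right fun w hw => by
          rw [mem_sphere_zero_iff_norm] at hw
          rw [mem_ofPred_eq, hw]
          norm_num
      refine ((contDiffOn_of_slice zero_le_one (contDiffOn_slice hV' hopen hBs hs)
        (fun p hp => (hb p hp).diffContOnCl) fun p hp w => ?_).contDiffAt
        ((hV'.prod isOpen_ball).mem_nhds ⟨hp, ?_⟩)).contDiffWithinAt
      · rw [slice_apply hBs.continuousOn hs hp]
        exact (hbB p hp w (hs (mk_mem_prod hp w.2)).2).symm
      · rw [mem_ball_zero_iff]
        linarith
  · refine ((tendsto_negFactor (u p)).mono_left nhdsWithin_le_nhds).congr' ?_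
    have : ∀ᶠ z in 𝓝[≠] (0 : ℂ), z ∈ ball (0 : ℂ) 2 :=
      nhdsWithin_le_nhds (ball_mem_nhds _ two_pos)
    filter_upwards [this, self_mem_nhdsWithin] with z hz hz0
    rw [mem_ball_zero_iff] at hz
    have hz0' : 0 < ‖z‖ := norm_pos_iff.2 hz0
    rw [hbB p hp _ (by rw [norm_inv, one_div]; exact inv_strictAnti₀ hz0' hz), mul_assoc,
      Ring.mul_inverse_cancel _ (hu p hp.1 _ (inv_ne_zero hz0)), mul_one]

end LocalBirkhoff

/-! ### The Banach algebra of complex `2 × 2` matrices -/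

/-- Complex `2 × 2` matrices, as a Banach algebra. -/
def BMat : Type := MatC

noncomputable instance : NormedRing BMat := Matrix.linftyOpNormedRing (n := Fin 2) (α := ℂ)

noncomputable instance : NormedAlgebra ℂ BMat :=
  Matrix.linftyOpNormedAlgebra (R := ℂ) (n := Fin 2) (α := ℂ)

/-- The identification of matrices with elements of the Banach algebra. -/
def toB : MatC ≃ₐ[ℂ] BMat where
  toFun X := X
  invFun X := X
  left_inv _ := rfl
  right_inv _ := rfl
  map_mul' _ _ := rfl
  map_add' _ _ := rfl
  commutes' _ := rfl

instance : FiniteDimensional ℂ BMat := Module.Finite.equiv toB.toLinearEquiv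

instance : CompleteSpace BMat := FiniteDimensional.complete ℂ BMat

/-- `toB` as a continuous linear equivalence. -/
noncomputable def toBL : MatC ≃L[ℂ] BMat := toB.toLinearEquiv.toContinuousLinearEquiv

/-- The entries, as continuous functionals. -/
noncomputable def entryB (i j : Fin 2) : BMat →L[ℂ] ℂ :=
  ((LinearMap.proj j ∘ₗ LinearMap.proj i : (Fin 2 → Fin 2 → ℂ) →ₗ[ℂ] ℂ) ∘ₗ
    (Matrix.ofLinearEquiv ℂ).symm.toLinearMap ∘ₗ toB.symm.toLinearMap).toContinuousLinearMap

theorem entryB_apply (i j : Fin 2) (X : BMat) : entryB i j X = toB.symm X i j := rfl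

theorem entryB_mul (i j : Fin 2) (X Y : BMat) :
    entryB i j (X * Y) = entryB i 0 X * entryB 0 j Y + entryB i 1 X * entryB 1 j Y := by
  simp [entryB_apply, Matrix.mul_apply]

theorem entryB_one (i j : Fin 2) : entryB i j 1 = if i = j then 1 else 0 := by
  simp [entryB_apply, Matrix.one_apply]

theorem BMat.ext {X Y : BMat} (h : ∀ i j, entryB i j X = entryB i j Y) : X = Y :=
  toB.symm.injective (Matrix.ext h)

/-- The matrix with given entries. -/
noncomputable def mkB (a b c d : ℂ) : BMat := toB !![a, b; c, d]

theorem entryB_mkB (a b c d : ℂ) : entryB 0 0 (mkB a b c d) = a ∧ entryB 0 1 (mkB a b c d) = b ∧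
    entryB 1 0 (mkB a b c d) = c ∧ entryB 1 1 (mkB a b c d) = d := ⟨rfl, rfl, rfl, rfl⟩

theorem BMat.ext4 {X Y : BMat} (h1 : entryB 0 0 X = entryB 0 0 Y) (h2 : entryB 0 1 X = entryB 0 1 Y)
    (h3 : entryB 1 0 X = entryB 1 0 Y) (h4 : entryB 1 1 X = entryB 1 1 Y) : X = Y := by
  refine BMat.ext fun i j => ?_
  fin_cases i <;> fin_cases j <;> assumption

theorem mkB_eq_sum (a b c d : ℂ) : mkB a b c d =
    a • mkB 1 0 0 0 + b • mkB 0 1 0 0 + c • mkB 0 0 1 0 + d • mkB 0 0 0 1 := by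
  apply BMat.ext4 <;> simp [entryB_mkB]

theorem eq_mkB (X : BMat) :
    X = mkB (entryB 0 0 X) (entryB 0 1 X) (entryB 1 0 X) (entryB 1 1 X) := by
  apply BMat.ext4 <;> simp [entryB_mkB]

/-- The determinant. -/
noncomputable def detB (X : BMat) : ℂ := (toB.symm X).det

theorem detB_eq (X : BMat) :
    detB X = entryB 0 0 X * entryB 1 1 X - entryB 0 1 X * entryB 1 0 X := by
  rw [detB, Matrix.det_fin_two]; rfl

theorem detB_mul (X Y : BMat) : detB (X * Y) = detB X * detB Y := by
  simp [detB]

theorem detB_one : detB 1 = 1 := by simp [detB]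

theorem continuous_detB : Continuous detB := by
  simp only [funext detB_eq]
  fun_prop

theorem contDiff_detB : ContDiff ℂ ∞ detB := by
  simp only [funext detB_eq]
  fun_prop

/-- The adjugate. -/
noncomputable def adjB : BMat →L[ℂ] BMat :=
  LinearMap.toContinuousLinearMap
    { toFun := fun X => mkB (entryB 1 1 X) (-entryB 0 1 X) (-entryB 1 0 X) (entryB 0 0 X)
      map_add' := fun X Y => by apply BMat.ext4 <;> simp [entryB_mkB] <;> ring
      map_smul' := fun a X => by apply BMat.ext4 <;> simp [entryB_mkB] }

theorem adjB_apply (X : BMat) :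
    adjB X = mkB (entryB 1 1 X) (-entryB 0 1 X) (-entryB 1 0 X) (entryB 0 0 X) := rfl

theorem mul_adjB {X : BMat} (h : detB X = 1) : X * adjB X = 1 := by
  rw [detB_eq] at h
  apply BMat.ext4 <;> simp [entryB_mul, adjB_apply, entryB_mkB, entryB_one] <;>
    first | ring1 | linear_combination h

theorem adjB_mul {X : BMat} (h : detB X = 1) : adjB X * X = 1 := by
  rw [detB_eq] at h
  apply BMat.ext4 <;> simp [entryB_mul, adjB_apply, entryB_mkB, entryB_one] <;>
    first | ring1 | linear_combination h

theorem adjB_mul_rev (X Y : BMat) : adjB (X * Y) = adjB Y * adjB X := by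
  apply BMat.ext4 <;> simp [entryB_mul, adjB_apply, entryB_mkB] <;> ring

theorem adjB_one : adjB 1 = 1 := by
  apply BMat.ext4 <;> simp [adjB_apply, entryB_mkB, entryB_one]

theorem detB_adjB (X : BMat) : detB (adjB X) = detB X := by
  simp only [detB_eq, adjB_apply, entryB_mkB]; ring

theorem toB_inv {X : MatC} (h : X.det = 1) : toB X⁻¹ = adjB (toB X) := by
  have h1 : toB X * toB X⁻¹ = 1 := by
    rw [← map_mul, Matrix.mul_nonsing_inv _ (by rw [h]; exact isUnit_one), map_one]
  calc toB X⁻¹ = (adjB (toB X) * toB X) * toB X⁻¹ := by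
        rw [adjB_mul (by simpa [detB] using h), one_mul]
    _ = _ := by rw [mul_assoc, h1, mul_one]

theorem isUnit_of_detB {X : BMat} (h : detB X = 1) : IsUnit X :=
  ⟨⟨X, adjB X, mul_adjB h, adjB_mul h⟩, rfl⟩

theorem inverse_eq_adjB {X : BMat} (h : detB X = 1) : Ring.inverse X = adjB X :=
  Ring.inverse_unit ⟨X, adjB X, mul_adjB h, adjB_mul h⟩

/-- Complex conjugation of the entries. -/
noncomputable def conjB : BMat →L[ℝ] BMat where
  cont := by
    simp only [mkB_eq_sum (star _)]
    fun_prop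
  toLinearMap :=
    { toFun := fun X => mkB (star (entryB 0 0 X)) (star (entryB 0 1 X)) (star (entryB 1 0 X))
        (star (entryB 1 1 X))
      map_add' := fun X Y => by apply BMat.ext4 <;> simp [entryB_mkB]
      map_smul' := fun a X => by
        have h : ∀ (i j) (Z : BMat), entryB i j (a • Z) = (a : ℂ) * entryB i j Z :=
          fun i j Z => (entryB i j).map_smul (a : ℂ) Z
        apply BMat.ext4 <;> simp [h, entryB_mkB] }

theorem entryB_conjB (i j : Fin 2) (X : BMat) : entryB i j (conjB X) = star (entryB i j X) := by
  fin_cases i <;> fin_cases j <;> rfl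

theorem conjB_mul (X Y : BMat) : conjB (X * Y) = conjB X * conjB Y :=
  BMat.ext fun i j => by simp [entryB_conjB, entryB_mul]

theorem conjB_one : conjB 1 = 1 :=
  BMat.ext fun i j => by simp only [entryB_conjB, entryB_one]; split_ifs <;> simp

theorem conjB_smul (a : ℂ) (X : BMat) : conjB (a • X) = star a • conjB X :=
  BMat.ext fun i j => by simp [entryB_conjB]

theorem conjB_conjB (X : BMat) : conjB (conjB X) = X :=
  BMat.ext fun i j => by simp [entryB_conjB]

theorem detB_conjB (X : BMat) : detB (conjB X) = star (detB X) := by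
  simp [detB_eq, entryB_conjB]

theorem conjB_adjB (X : BMat) : conjB (adjB X) = adjB (conjB X) := by
  apply BMat.ext4 <;> simp [entryB_conjB, adjB_apply, entryB_mkB]

/-- Real matrices in the Banach algebra. -/
noncomputable def realB (X : MatR) : BMat := toB (toC X)

theorem entryB_realB (i j : Fin 2) (X : MatR) : entryB i j (realB X) = (X i j : ℂ) := rfl

theorem conjB_realB (X : MatR) : conjB (realB X) = realB X :=
  BMat.ext fun i j => by simp [entryB_conjB, entryB_realB]

theorem realB_injective : Function.Injective realB := fun X Y h => by
  ext i j
  have := congrArg (entryB i j) h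
  simpa [entryB_realB] using this

theorem exists_realB {X : BMat} (h : conjB X = X) : ∃ Y : MatR, realB Y = X := by
  refine ⟨(toB.symm X).map Complex.re, BMat.ext fun i j => ?_⟩
  rw [entryB_realB]
  have := congrArg (entryB i j) h
  rw [entryB_conjB] at this
  exact Complex.conj_eq_iff_re.1 this

theorem realB_mul (X Y : MatR) : realB (X * Y) = realB X * realB Y :=
  BMat.ext fun i j => by simp [entryB_mul, entryB_realB, Matrix.mul_apply]

theorem realB_one : realB 1 = 1 :=
  BMat.ext fun i j => by simp [entryB_realB, entryB_one, Matrix.one_apply]; split_ifs <;> simp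

theorem realB_add (X Y : MatR) : realB (X + Y) = realB X + realB Y :=
  BMat.ext fun i j => by simp [entryB_realB]

theorem realB_smul (a : ℝ) (X : MatR) : realB (a • X) = (a : ℂ) • realB X :=
  BMat.ext fun i j => by simp [entryB_realB]

/-- The matrix `𝐤'`. -/
noncomputable def kB : BMat := realB matK

theorem entryB_kB : entryB 0 0 kB = -1 ∧ entryB 0 1 kB = 0 ∧ entryB 1 0 kB = 0 ∧
    entryB 1 1 kB = 1 := by
  simp [kB, entryB_realB, matK]

theorem kB_mul_kB : kB * kB = 1 := by
  apply BMat.ext4 <;> simp [entryB_mul, entryB_kB, entryB_one]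

theorem conjB_kB : conjB kB = kB := conjB_realB _

theorem detB_kB_mul_mul (X : BMat) : detB (kB * X * kB) = detB X := by
  simp only [detB_eq, entryB_mul, entryB_kB]; ring

/-! ### Smoothness and derivatives of matrix-valued maps -/

section Smooth

variable {X : Type} [NormedAddCommGroup X] [NormedSpace ℝ X]

theorem contDiffOn_bMat {f : X → BMat} {U : Set X}
    (h : ∀ i j, ContDiffOn ℝ ∞ (fun q => entryB i j (f q)) U) : ContDiffOn ℝ ∞ f U := by
  have : f = fun q => mkB (entryB 0 0 (f q)) (entryB 0 1 (f q)) (entryB 1 0 (f q))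
      (entryB 1 1 (f q)) := funext fun q => eq_mkB _
  rw [this]
  simp only [mkB_eq_sum (entryB _ _ _)]
  exact ((((h 0 0).smul contDiffOn_const).add ((h 0 1).smul contDiffOn_const)).add
    ((h 1 0).smul contDiffOn_const)).add ((h 1 1).smul contDiffOn_const)

theorem isSmoothOn_iff {f : X → MatC} {U : Set X} :
    IsSmoothOn f U ↔ ContDiffOn ℝ ∞ (fun q => toB (f q)) U :=
  ⟨fun h => contDiffOn_bMat h, fun h i j =>
    ((entryB i j).restrictScalars ℝ).contDiff.comp_contDiffOn h⟩

theorem isSmoothOn_real_iff {f : X → MatR} {U : Set X} :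
    IsSmoothOn f U ↔ ContDiffOn ℝ ∞ (fun q => realB (f q)) U :=
  ⟨fun h => contDiffOn_bMat fun i j => Complex.ofRealCLM.contDiff.comp_contDiffOn (h i j),
    fun h i j => Complex.reCLM.contDiff.comp_contDiffOn
      (((entryB i j).restrictScalars ℝ).contDiff.comp_contDiffOn h)⟩

theorem toB_matDeriv {F : Plane → MatC} {p : Plane}
    (h : DifferentiableAt ℝ (fun q => toB (F q)) p) (v : Plane) :
    toB (matDeriv F p v) = fderiv ℝ (fun q => toB (F q)) p v := by
  refine BMat.ext fun i j => ?_
  have := (((entryB i j).restrictScalars ℝ).hasFDerivAt.comp p h.hasFDerivAt).fderiv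
  exact DFunLike.congr_fun this v

theorem realB_matDeriv {F : Plane → MatR} {p : Plane}
    (h : DifferentiableAt ℝ (fun q => realB (F q)) p) (v : Plane) :
    realB (matDeriv F p v) = fderiv ℝ (fun q => realB (F q)) p v := by
  refine BMat.ext fun i j => ?_
  have h1 := ((entryB i j).restrictScalars ℝ).hasFDerivAt.comp p h.hasFDerivAt
  have h2 : HasFDerivAt (fun q => F q i j) _ p := Complex.reCLM.hasFDerivAt.comp p h1
  have h3 := (Complex.ofRealCLM.hasFDerivAt.comp p h2).unique h1
  rw [entryB_realB]
  change (((fderiv ℝ (fun q => F q i j) p) v : ℝ) : ℂ) = _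
  rw [h2.fderiv]
  exact DFunLike.congr_fun h3 v

end Smooth

/-! ### The loop groups as groups of holomorphic functions -/

/-- Holomorphic functions on `ℂ^*` with the symmetries of the twisted loop group. -/
structure IsLoop (γ : ℂ → BMat) : Prop where
  hol : DifferentiableOn ℂ γ {0}ᶜ
  real : ∀ z, z ≠ 0 → γ (star z) = conjB (γ z)
  det : ∀ z, z ≠ 0 → detB (γ z) = 1
  twist : ∀ z, z ≠ 0 → kB * γ z * kB = γ (-z)

/-- A loop, as a function with values in the Banach algebra. -/
noncomputable def loopB (γ : Loop) (z : ℂ) : BMat := toB (γ z)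

/-- The function `z ↦ γ (z⁻¹)`. -/
noncomputable def flipB {M : Type} (γ : ℂ → M) (z : ℂ) : M := γ z⁻¹

theorem flipB_flipB {M : Type} (γ : ℂ → M) : flipB (flipB γ) = γ := by
  funext z; simp [flipB]

theorem flipB_apply {M : Type} (γ : ℂ → M) (z : ℂ) : flipB γ z = γ z⁻¹ := rfl

/-- `γ` extends continuously to `0`, with value `c`. -/
def LimAt {M : Type} [TopologicalSpace M] (γ : ℂ → M) (c : M) : Prop := Tendsto γ (𝓝[≠] 0) (𝓝 c)

theorem differentiableOn_flipB {M : Type} [NormedAddCommGroup M] [NormedSpace ℂ M] {γ : ℂ → M}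
    (h : DifferentiableOn ℂ γ {0}ᶜ) :
    DifferentiableOn ℂ (flipB γ) {0}ᶜ :=
  h.comp (g := γ) (f := fun z : ℂ => z⁻¹) (differentiableOn_inv) fun _ hz => inv_ne_zero hz

theorem IsLoop.flip {γ : ℂ → BMat} (h : IsLoop γ) : IsLoop (flipB γ) where
  hol := differentiableOn_flipB h.hol
  real z hz := by rw [flipB, flipB, ← h.real _ (inv_ne_zero hz)]; simp
  det z hz := h.det _ (inv_ne_zero hz)
  twist z hz := by rw [flipB, flipB, h.twist _ (inv_ne_zero hz), inv_neg]

theorem isLoop_flip_iff {γ : ℂ → BMat} : IsLoop (flipB γ) ↔ IsLoop γ :=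
  ⟨fun h => by rw [← flipB_flipB γ]; exact h.flip, IsLoop.flip⟩

theorem IsLoop.mul {γ δ : ℂ → BMat} (h : IsLoop γ) (h' : IsLoop δ) :
    IsLoop (fun z => γ z * δ z) where
  hol := h.hol.mul h'.hol
  real z hz := by rw [h.real z hz, h'.real z hz, conjB_mul]
  det z hz := by rw [detB_mul, h.det z hz, h'.det z hz, one_mul]
  twist z hz := by
    rw [← h.twist z hz, ← h'.twist z hz]
    calc _ = kB * (γ z * ((kB * kB) * δ z)) * kB := by
          rw [kB_mul_kB, one_mul]
      _ = _ := by simp only [mul_assoc]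

theorem adjB_kB_mul_mul (X : BMat) : adjB (kB * X * kB) = kB * adjB X * kB := by
  apply BMat.ext4 <;> simp [entryB_mul, adjB_apply, entryB_mkB, entryB_kB]

theorem eventually_ne_zero : ∀ᶠ z in 𝓝[≠] (0 : ℂ), z ≠ 0 := self_mem_nhdsWithin

theorem LimAt.congr {M : Type} [TopologicalSpace M] {γ δ : ℂ → M} {c : M} (h : LimAt γ c)
    (h' : ∀ z, z ≠ 0 → δ z = γ z) : LimAt δ c :=
  Tendsto.congr' (eventually_ne_zero.mono fun z hz => (h' z hz).symm) h

/-! ### Laurent and Taylor expansions with real coefficient matrices. -/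

section Laurent

theorem hasLaurent_iff {γ : Loop} {c : ℤ → MatR} : HasLaurent γ c ↔
    ∀ z : ℂ, z ≠ 0 → HasSum (fun j : ℤ => z ^ j • realB (c j)) (loopB γ z) := by
  refine forall₂_congr fun z _ => ⟨fun h => ?_, fun h => ?_⟩
  · exact (h.mapL toBL.toContinuousLinearMap).congr_fun' fun j => map_smul toB _ _
  · exact (h.mapL toBL.symm.toContinuousLinearMap).congr_fun' fun j => map_smul toB.symm _ _

/-- Average the series with the conjugate of the series at the conjugate point: the sum is unchanged
and each coefficient becomes its real part. Uniqueness of coefficients is not needed. -/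
theorem hasSum_re {a : ℤ → BMat} {z : ℂ} {x : BMat} (h : HasSum (fun j : ℤ => z ^ j • a j) x)
    (h' : HasSum (fun j : ℤ => star z ^ j • a j) (conjB x)) :
    HasSum (fun j : ℤ => z ^ j • realB ((toB.symm (a j)).map Complex.re)) x := by
  have h2 := h'.mapL conjB
  rw [conjB_conjB] at h2
  have h3 := (h.add h2).const_smul (1 / 2 : ℂ)
  have hx : (1 / 2 : ℂ) • (x + x) = x := by
    rw [← two_smul ℂ x, smul_smul]; norm_num
  rw [hx] at h3
  refine h3.congr_fun' fun j => ?_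
  rw [conjB_smul, star_zpow₀, star_star, ← smul_add, smul_comm]
  congr 1
  refine BMat.ext fun i k => ?_
  rw [map_smul, map_add, entryB_conjB, entryB_realB, smul_eq_mul, entryB_apply]
  have := Complex.add_conj (toB.symm (a j) i k)
  change 1 / 2 * (toB.symm (a j) i k + (starRingEnd ℂ) (toB.symm (a j) i k)) =
    ((toB.symm (a j) i k).re : ℂ)
  rw [this]
  push_cast
  ring

theorem exists_laurent {γ : ℂ → BMat} (h : DifferentiableOn ℂ γ {0}ᶜ)
    (hr : ∀ z, z ≠ 0 → γ (star z) = conjB (γ z)) :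
    ∃ c : ℤ → MatR, ∀ z, z ≠ 0 → HasSum (fun j : ℤ => z ^ j • realB (c j)) (γ z) := by
  have h' : DifferentiableOn ℂ γ {z | 0 < ‖z‖} := h.mono fun z hz => norm_pos_iff.1 hz
  have key : ∀ z, z ≠ 0 → HasSum (fun j : ℤ => z ^ j • laurentCoeff γ 1 j) (γ z) :=
    fun z hz => hasSum_laurent le_rfl h' one_pos (norm_pos_iff.2 hz)
  refine ⟨_, fun z hz => hasSum_re (key z hz) ?_⟩
  rw [← hr z hz]
  exact key _ (star_ne_zero.2 hz)

/-- Removal of the singularity at `0`. -/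
theorem exists_entire {M : Type} [NormedAddCommGroup M] [NormedSpace ℂ M] [CompleteSpace M]
    {γ : ℂ → M} (h : DifferentiableOn ℂ γ {0}ᶜ) {c : M}
    (hc : LimAt γ c) : ∃ g : ℂ → M, Differentiable ℂ g ∧ (∀ z, z ≠ 0 → g z = γ z) ∧ g 0 = c :=
  ⟨Function.update γ 0 c, differentiable_update_of_tendsto h hc,
    fun _ hz => Function.update_of_ne hz _ _, Function.update_self _ _ _⟩

theorem exists_taylor {γ : ℂ → BMat} (h : DifferentiableOn ℂ γ {0}ᶜ)
    (hr : ∀ z, z ≠ 0 → γ (star z) = conjB (γ z)) {x : BMat} (hx : LimAt γ x) :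
    ∃ c : ℤ → MatR, (∀ z, z ≠ 0 → HasSum (fun j : ℤ => z ^ j • realB (c j)) (γ z)) ∧
      (∀ j, j < 0 → c j = 0) ∧ realB (c 0) = x := by
  obtain ⟨g, hg, hgγ, hg0⟩ := exists_entire h hx
  let a : ℤ → BMat := fun j => if 0 ≤ j then
    ((j.toNat.factorial : ℂ)⁻¹ • iteratedDeriv j.toNat g 0) else 0
  have key : ∀ z, HasSum (fun j : ℤ => z ^ j • a j) (g z) := by
    intro z
    refine ((Nat.cast_injective (R := ℤ)).hasSum_iff fun j hj => ?_).1
      ((Complex.hasSum_taylorSeries_of_entire hg 0 z).congr_fun' fun n => ?_)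
    · have : ¬ 0 ≤ j := fun h => hj ⟨j.toNat, by simpa using h⟩
      simp only [a, if_neg this, smul_zero]
    · simp only [a, Function.comp_apply, Int.natCast_nonneg, if_true, Int.toNat_natCast, sub_zero, zpow_natCast]
      rw [smul_comm]
  refine ⟨fun j => (toB.symm (a j)).map Complex.re, fun z hz => hasSum_re ?_ ?_, ?_, ?_⟩
  · rw [← hgγ z hz]; exact key z
  · rw [← hr z hz, ← hgγ _ (star_ne_zero.2 hz)]; exact key _
  · intro j hj
    have : ¬ 0 ≤ j := not_le.2 hj
    simp only [a, if_neg this, map_zero]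
    ext i k
    rfl
  · have ha0 : a 0 = x := by simp [a, hg0]
    -- The limit at 0 inherits the reality condition, so taking the real part of the constant
    -- coefficient does not change it.
    have hxr : conjB x = x := by
      have h1 : Tendsto (fun z : ℂ => γ (star z)) (𝓝[≠] 0) (𝓝 x) := by
        refine hx.comp (tendsto_nhdsWithin_iff.2 ⟨?_, ?_⟩)
        · have : Tendsto (fun z : ℂ => star z) (𝓝 0) (𝓝 (star 0)) :=
            continuous_star.tendsto _
          rw [star_zero] at this
          exact this.mono_left nhdsWithin_le_nhds
        · exact eventually_ne_zero.mono fun z hz => star_ne_zero.2 hz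
      have h2 : Tendsto (fun z : ℂ => conjB (γ z)) (𝓝[≠] 0) (𝓝 (conjB x)) :=
        (conjB.continuous.tendsto x).comp hx
      exact tendsto_nhds_unique
        (h2.congr' (eventually_ne_zero.mono fun z hz => (hr z hz).symm)) h1
    change realB ((toB.symm (a 0)).map Complex.re) = x
    rw [ha0]
    obtain ⟨Y, rfl⟩ := exists_realB hxr
    congr 1

theorem limAt_of_hasSum {γ : ℂ → BMat} {c : ℤ → MatR}
    (h : ∀ z, z ≠ 0 → HasSum (fun j : ℤ => z ^ j • realB (c j)) (γ z))
    (hc : ∀ j, j < 0 → c j = 0) : LimAt γ (realB (c 0)) := by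
  have hn : ∀ z, z ≠ 0 → HasSum (fun k : ℕ => z ^ k • realB (c k)) (γ z) := fun z hz => by
    refine ((Nat.cast_injective (R := ℤ)).hasSum_iff fun j hj => ?_).2 (h z hz) |>.congr_fun'
      fun k => ?_
    · have : ¬ 0 ≤ j := fun h => hj ⟨j.toNat, by simpa using h⟩
      rw [hc j (not_le.1 this)]
      have : realB 0 = 0 := by
        have := realB_smul 0 0
        simpa using this
      rw [this, smul_zero]
    · simp
  have hd := (entire_of_summable (a := fun k : ℕ => realB (c k)) fun R =>
    ⟨((|R| + 1 : ℝ) : ℂ), by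
      rw [Complex.norm_real, Real.norm_of_nonneg (by positivity)]
      exact (le_abs_self R).trans_lt (lt_add_one _),
      (hn _ (Complex.ofReal_ne_zero.2 (by positivity))).summable⟩).1
  have h0 : ∑' k : ℕ, (0 : ℂ) ^ k • realB (c k) = realB (c 0) := by
    rw [tsum_eq_single 0]
    · simp
    · intro k hk; simp [hk]
  have h1 : Tendsto (fun z : ℂ => ∑' k : ℕ, z ^ k • realB (c k)) (𝓝 0) (𝓝 (realB (c 0))) := by
    rw [← h0]
    exact hd.continuous.tendsto 0
  exact (h1.mono_left nhdsWithin_le_nhds).congr'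
    (eventually_ne_zero.mono fun z hz => (hn z hz).tsum_eq)

/-- Split the series: the nonnegative powers form an entire function of z, the negative ones z⁻¹
times an entire function of z⁻¹. -/
theorem differentiableOn_of_hasSum {γ : ℂ → BMat} {c : ℤ → MatR}
    (h : ∀ z, z ≠ 0 → HasSum (fun j : ℤ => z ^ j • realB (c j)) (γ z)) :
    DifferentiableOn ℂ γ {0}ᶜ := by
  have hp : ∀ z : ℂ, z ≠ 0 → Summable fun k : ℕ => z ^ k • realB (c k) := fun z hz =>
    ((h z hz).summable.comp_injective (Nat.cast_injective (R := ℤ))).congr fun k => by simp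
  have hm : ∀ z : ℂ, z ≠ 0 → Summable fun k : ℕ => z ^ k • realB (c (-k - 1)) := fun z hz => by
    have := ((h z⁻¹ (inv_ne_zero hz)).summable.comp_injective
      (i := fun k : ℕ => -(k : ℤ) - 1) fun a b hab => by simpa using hab).const_smul z⁻¹
    refine this.congr fun k => ?_
    rw [Function.comp_apply, smul_smul]
    congr 1
    rw [inv_zpow', ← zpow_neg_one, ← zpow_natCast, ← zpow_add₀ hz]
    congr 1
    ring
  have hR : ∀ R : ℝ, ∃ z : ℂ, R < ‖z‖ ∧ z ≠ 0 := fun R => ⟨((|R| + 1 : ℝ) : ℂ), by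
      rw [Complex.norm_real, Real.norm_of_nonneg (by positivity)]
      exact (le_abs_self R).trans_lt (lt_add_one _),
      Complex.ofReal_ne_zero.2 (by positivity)⟩
  have dp := (entire_of_summable (a := fun k : ℕ => realB (c k)) fun R =>
    let ⟨z, hz, hz0⟩ := hR R; ⟨z, hz, hp z hz0⟩).1
  have dm := (entire_of_summable (a := fun k : ℕ => realB (c (-k - 1))) fun R =>
    let ⟨z, hz, hz0⟩ := hR R; ⟨z, hz, hm z hz0⟩).1
  have key : ∀ z : ℂ, z ≠ 0 → γ z = (∑' k : ℕ, z ^ k • realB (c k)) +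
      z⁻¹ • ∑' k : ℕ, z⁻¹ ^ k • realB (c (-k - 1)) := fun z hz => by
    have h1 := (hp z hz).hasSum
    have h2 := (hm z⁻¹ (inv_ne_zero hz)).hasSum.const_smul z⁻¹
    refine (h z hz).unique (HasSum.of_nat_of_neg_add_one
      (h1.congr_fun' fun k => ?_) (h2.congr_fun' fun k => ?_))
    · simp
    · rw [smul_smul]
      have e : -((k : ℤ) + 1) = -k - 1 := by ring
      rw [e]
      congr 1
      rw [← pow_succ', inv_pow, ← zpow_natCast, ← zpow_neg]
      congr 1
  refine DifferentiableOn.congr (f := fun z : ℂ => (∑' k : ℕ, z ^ k • realB (c k)) +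
      z⁻¹ • ∑' k : ℕ, z⁻¹ ^ k • realB (c (-k - 1))) ?_ key
  exact dp.differentiableOn.add (differentiableOn_inv.smul
    (dm.comp_differentiableOn differentiableOn_inv))

theorem real_of_hasSum {γ : ℂ → BMat} {c : ℤ → MatR}
    (h : ∀ z, z ≠ 0 → HasSum (fun j : ℤ => z ^ j • realB (c j)) (γ z)) (z : ℂ) (hz : z ≠ 0) :
    γ (star z) = conjB (γ z) :=
  (h _ (star_ne_zero.2 hz)).unique (((h z hz).mapL conjB).congr_fun' fun j => by
    rw [conjB_smul, conjB_realB, star_zpow₀])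

end Laurent

/-! ### The loop groups in terms of holomorphic functions on ℂ^*. -/

theorem matK_inv : (toC matK)⁻¹ = toC matK := by
  refine Matrix.inv_eq_right_inv (toB.injective ?_)
  rw [map_mul, map_one]
  exact kB_mul_kB

theorem toB_adAct_matK (X : MatC) : toB (adAct (toC matK) X) = kB * toB X * kB := by
  rw [adAct, matK_inv, map_mul, map_mul]; rfl

/-- Laurent expansion shows that real coefficients amount to holomorphy on ℂ^* together with
compatibility with complex conjugation; the other conditions translate word for word. -/
theorem mem_loopGroup_iff {γ : Loop} : γ ∈ loopGroup ↔ IsLoop (loopB γ) := by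
  constructor
  · rintro ⟨⟨c, hc⟩, hd, ht⟩
    rw [hasLaurent_iff] at hc
    exact ⟨differentiableOn_of_hasSum hc, real_of_hasSum hc, hd, fun z hz => by
      rw [loopB, ← toB_adAct_matK, ht z hz, loopB]⟩
  · intro h
    obtain ⟨c, hc⟩ := exists_laurent h.hol h.real
    refine ⟨⟨c, hasLaurent_iff.2 hc⟩, h.det, fun z hz => toB.injective ?_⟩
    rw [toB_adAct_matK]
    exact h.twist z hz

/-- Absence of negative powers means that the singularity at 0 is removable. -/
theorem mem_loopPos_iff {γ : Loop} :
    γ ∈ loopPos ↔ IsLoop (loopB γ) ∧ ∃ x, LimAt (loopB γ) x := by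
  constructor
  · rintro ⟨h, c, hc, hc0⟩
    exact ⟨mem_loopGroup_iff.1 h, _, limAt_of_hasSum (hasLaurent_iff.1 hc) hc0⟩
  · rintro ⟨h, x, hx⟩
    obtain ⟨c, hc, hc0, -⟩ := exists_taylor h.hol h.real hx
    exact ⟨mem_loopGroup_iff.2 h, c, hasLaurent_iff.2 hc, hc0⟩

theorem mem_loopPosStar_iff {γ : Loop} :
    γ ∈ loopPosStar ↔ IsLoop (loopB γ) ∧ LimAt (loopB γ) 1 := by
  constructor
  · rintro ⟨h, c, hc, hc0, hc1⟩
    have := limAt_of_hasSum (hasLaurent_iff.1 hc) hc0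
    rw [hc1, realB_one] at this
    exact ⟨mem_loopGroup_iff.1 h, this⟩
  · rintro ⟨h, hx⟩
    obtain ⟨c, hc, hc0, hc1⟩ := exists_taylor h.hol h.real hx
    exact ⟨mem_loopGroup_iff.2 h, c, hasLaurent_iff.2 hc, hc0,
      realB_injective (by rw [hc1, realB_one])⟩

theorem hasLaurent_flip {γ : Loop} {c : ℤ → MatR} (h : HasLaurent γ c) :
    HasLaurent (flipB γ) (fun j => c (-j)) := fun z hz =>
  ((Equiv.neg ℤ).hasSum_iff.2 (h z⁻¹ (inv_ne_zero hz))).congr_fun' fun j => by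
    simp

theorem loopB_flipB (γ : Loop) : loopB (flipB γ) = flipB (loopB γ) := rfl

theorem flip_mem_loopGroup_iff {γ : Loop} : flipB γ ∈ loopGroup ↔ γ ∈ loopGroup := by
  rw [mem_loopGroup_iff, mem_loopGroup_iff, loopB_flipB, isLoop_flip_iff]

/-- The substitution z ↦ z⁻¹ reverses the sign of the powers, so only one of the two kinds of
splitting has to be studied. -/
theorem flip_mem_loopPos_iff {γ : Loop} : flipB γ ∈ loopPos ↔ γ ∈ loopNeg := by
  constructor
  · rintro ⟨h, c, hc, hc0⟩
    have := (hasLaurent_flip hc)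
    rw [flipB_flipB] at this
    exact ⟨flip_mem_loopGroup_iff.1 h, _, this, fun j hj => hc0 _ (by omega)⟩
  · rintro ⟨h, c, hc, hc0⟩
    exact ⟨flip_mem_loopGroup_iff.2 h, _, (hasLaurent_flip hc), fun j hj => hc0 _ (by omega)⟩

theorem flip_mem_loopPosStar_iff {γ : Loop} : flipB γ ∈ loopPosStar ↔ γ ∈ loopNegStar := by
  constructor
  · rintro ⟨h, c, hc, hc0, h1⟩
    have := (hasLaurent_flip hc)
    rw [flipB_flipB] at this
    exact ⟨flip_mem_loopGroup_iff.1 h, _, this, fun j hj => hc0 _ (by omega), by simpa using h1⟩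
  · rintro ⟨h, c, hc, hc0, h1⟩
    exact ⟨flip_mem_loopGroup_iff.2 h, _, (hasLaurent_flip hc), fun j hj => hc0 _ (by omega),
      by simpa using h1⟩

theorem mem_loopNeg_iff {γ : Loop} :
    γ ∈ loopNeg ↔ IsLoop (loopB γ) ∧ ∃ x, LimAt (flipB (loopB γ)) x := by
  rw [← flip_mem_loopPos_iff, mem_loopPos_iff, loopB_flipB, isLoop_flip_iff]

theorem mem_loopNegStar_iff {γ : Loop} :
    γ ∈ loopNegStar ↔ IsLoop (loopB γ) ∧ LimAt (flipB (loopB γ)) 1 := by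
  rw [← flip_mem_loopPosStar_iff, mem_loopPosStar_iff, loopB_flipB, isLoop_flip_iff]

/-! ### Birkhoff splittings with parameters -/

/-- Holomorphic functions on `ℂ^*` with values in the special linear group. -/
structure IsHolSL (γ : ℂ → BMat) : Prop where
  hol : DifferentiableOn ℂ γ {0}ᶜ
  det : ∀ z, z ≠ 0 → detB (γ z) = 1

theorem IsLoop.isHolSL {γ : ℂ → BMat} (h : IsLoop γ) : IsHolSL γ := ⟨h.hol, h.det⟩

theorem IsHolSL.mul {γ δ : ℂ → BMat} (h : IsHolSL γ) (h' : IsHolSL δ) :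
    IsHolSL (fun z => γ z * δ z) :=
  ⟨h.hol.mul h'.hol, fun z hz => by rw [detB_mul, h.det z hz, h'.det z hz, one_mul]⟩

theorem IsHolSL.inv {γ : ℂ → BMat} (h : IsHolSL γ) : IsHolSL (fun z => adjB (γ z)) :=
  ⟨adjB.differentiable.comp_differentiableOn h.hol,
    fun z hz => by rw [detB_adjB, h.det z hz]⟩

theorem IsHolSL.flip {γ : ℂ → BMat} (h : IsHolSL γ) : IsHolSL (flipB γ) :=
  ⟨differentiableOn_flipB h.hol, fun _ hz => h.det _ (inv_ne_zero hz)⟩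

/-- `γ = a b` with `a → 1` at `∞` and `b` holomorphic at `0`. -/
structure IsNegPos (γ a b : ℂ → BMat) : Prop where
  left : IsHolSL a
  right : IsHolSL b
  lim_left : LimAt (flipB a) 1
  lim_right : ∃ x, LimAt b x
  eq : ∀ z, z ≠ 0 → γ z = a z * b z

theorem tendsto_smul_zero {M : Type} [NormedAddCommGroup M] [NormedSpace ℂ M] {g : ℂ → M} {x : M}
    (h : LimAt g x) : Tendsto (fun z => z • g z) (𝓝[≠] 0) (𝓝 0) := by
  have h1 : Tendsto (fun z : ℂ => z) (𝓝[≠] 0) (𝓝 0) := tendsto_id.mono_left nhdsWithin_le_nhds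
  have h2 := h1.smul h
  rwa [zero_smul] at h2

/-- The function a'⁻¹ a = b' b⁻¹ has a limit at 0, seen on the right, and tends to 1 at ∞, seen on
the left; by Liouville's theorem it is 1. -/
theorem IsNegPos.unique {γ a b a' b' : ℂ → BMat} (h : IsNegPos γ a b) (h' : IsNegPos γ a' b')
    {z : ℂ} (hz : z ≠ 0) : a z = a' z ∧ b z = b' z := by
  obtain ⟨x, hx⟩ := h.lim_right
  obtain ⟨x', hx'⟩ := h'.lim_right
  have e : ∀ z, z ≠ 0 → adjB (a' z) * a z = b' z * adjB (b z) := fun z hz => by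
    have h1 : a z * b z = a' z * b' z := by rw [← h.eq z hz, h'.eq z hz]
    calc adjB (a' z) * a z = adjB (a' z) * (a z * b z) * adjB (b z) := by
          rw [mul_assoc (adjB (a' z)), mul_assoc (a z), mul_adjB (h.right.det z hz), mul_one]
      _ = (adjB (a' z) * a' z) * b' z * adjB (b z) := by rw [h1]; simp only [mul_assoc]
      _ = _ := by rw [adjB_mul (h'.left.det z hz), one_mul]
  have l1 : LimAt (fun z => adjB (a' z) * a z) (x' * adjB x) :=
    LimAt.congr (hx'.mul ((adjB.continuous.tendsto x).comp hx)) e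
  have l2 : Tendsto (fun z => adjB (a' z⁻¹) * a z⁻¹) (𝓝[≠] 0) (𝓝 1) := by
    have h2 := ((adjB.continuous.tendsto 1).comp h'.lim_left).mul h.lim_left
    rwa [adjB_one, one_mul] at h2
  have key := eq_of_tendsto_inv (h'.left.inv.mul h.left).hol (tendsto_smul_zero l1) l2 hz
  have ha : a z = a' z := by
    calc a z = a' z * (adjB (a' z) * a z) := by
          rw [← mul_assoc, mul_adjB (h'.left.det z hz), one_mul]
      _ = _ := by rw [key, mul_one]
  refine ⟨ha, ?_⟩
  have key2 : b' z * adjB (b z) = 1 := by rw [← e z hz]; exact key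
  calc b z = (b' z * adjB (b z)) * b z := by rw [key2, one_mul]
    _ = _ := by rw [mul_assoc, adjB_mul (h.right.det z hz), mul_one]

theorem differentiableOn_bMat {f : ℂ → BMat} {U : Set ℂ}
    (h : ∀ i j, DifferentiableOn ℂ (fun q => entryB i j (f q)) U) : DifferentiableOn ℂ f U := by
  have : f = fun q => mkB (entryB 0 0 (f q)) (entryB 0 1 (f q)) (entryB 1 0 (f q))
      (entryB 1 1 (f q)) := funext fun q => eq_mkB _
  rw [this]
  simp only [mkB_eq_sum (entryB _ _ _)]
  exact ((((h 0 0).smul_const _).add ((h 0 1).smul_const _)).add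
    ((h 1 0).smul_const _)).add ((h 1 1).smul_const _)

theorem IsHolSL.conj {γ : ℂ → BMat} (h : IsHolSL γ) : IsHolSL (fun z => conjB (γ (star z))) := by
  refine ⟨differentiableOn_bMat fun i j => ?_, fun z hz => ?_⟩
  · intro z hz
    have hz' : star z ∈ ({0}ᶜ : Set ℂ) := star_ne_zero.2 hz
    have h1 := ((entryB i j).differentiable.comp_differentiableOn h.hol).differentiableAt
      (isOpen_compl_singleton.mem_nhds hz')
    simp only [entryB_conjB]
    have h2 := h1.conj_conj
    rw [show (starRingEnd ℂ) (star z) = z from star_star z] at h2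
    exact h2.differentiableWithinAt
  · rw [detB_conjB, h.det _ (star_ne_zero.2 hz), star_one]

theorem IsHolSL.twist {γ : ℂ → BMat} (h : IsHolSL γ) : IsHolSL (fun z => kB * γ (-z) * kB) :=
  ⟨((h.hol.comp (differentiable_neg.differentiableOn) fun _ hz => neg_ne_zero.2 hz).const_mul
    _).mul_const _, fun z hz => by rw [detB_kB_mul_mul, h.det _ (neg_ne_zero.2 hz)]⟩

theorem tendsto_punctured {f : ℂ → ℂ} (hf : Continuous f) (h0 : f 0 = 0)
    (hne : ∀ z, z ≠ 0 → f z ≠ 0) : Tendsto f (𝓝[≠] 0) (𝓝[≠] 0) := by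
  refine tendsto_nhdsWithin_iff.2 ⟨?_, eventually_ne_zero.mono hne⟩
  have := hf.tendsto 0
  rw [h0] at this
  exact this.mono_left nhdsWithin_le_nhds

theorem LimAt.conj {γ : ℂ → BMat} {x : BMat} (h : LimAt γ x) :
    LimAt (fun z => conjB (γ (star z))) (conjB x) :=
  (conjB.continuous.tendsto x).comp
    (h.comp (tendsto_punctured continuous_star (star_zero ℂ) fun _ => star_ne_zero.2))

theorem LimAt.twist {γ : ℂ → BMat} {x : BMat} (h : LimAt γ x) :
    LimAt (fun z => kB * γ (-z) * kB) (kB * x * kB) :=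
  ((h.comp (tendsto_punctured continuous_neg neg_zero fun _ => neg_ne_zero.2)).const_mul
    kB).mul_const kB

/-- Conjugation and twisting turn a splitting of γ into another splitting of γ, and by uniqueness it
is the same one. The symmetries may therefore be forgotten while factors are constructed. -/
theorem IsNegPos.isLoop {γ a b : ℂ → BMat} (hγ : IsLoop γ) (h : IsNegPos γ a b) :
    IsLoop a ∧ IsLoop b := by
  obtain ⟨x, hx⟩ := h.lim_right
  have hr : IsNegPos γ (fun z => conjB (a (star z))) (fun z => conjB (b (star z))) := by
    refine ⟨h.left.conj, h.right.conj, ?_, ⟨_, hx.conj⟩, fun z hz => ?_⟩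
    · have h1 := h.lim_left.conj
      rw [conjB_one] at h1
      exact h1.congr fun z _ => by simp [flipB]
    · rw [← conjB_mul, ← h.eq _ (star_ne_zero.2 hz), ← hγ.real _ (star_ne_zero.2 hz), star_star]
  have ht : IsNegPos γ (fun z => kB * a (-z) * kB) (fun z => kB * b (-z) * kB) := by
    refine ⟨h.left.twist, h.right.twist, ?_, ⟨_, hx.twist⟩, fun z hz => ?_⟩
    · have h1 := h.lim_left.twist
      rw [mul_one, kB_mul_kB] at h1
      exact h1.congr fun z _ => by simp [flipB, inv_neg]
    · have h1 := hγ.twist (-z) (neg_ne_zero.2 hz)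
      rw [neg_neg, h.eq _ (neg_ne_zero.2 hz)] at h1
      rw [← h1]
      calc _ = kB * (a (-z) * ((kB * kB) * b (-z))) * kB := by rw [kB_mul_kB, one_mul]
        _ = _ := by simp only [mul_assoc]
  have conj_aux : ∀ {u v : BMat}, u = conjB v → v = conjB u := fun h => by rw [h, conjB_conjB]
  have kk : ∀ X : BMat, kB * (kB * X * kB) * kB = X := fun X => by
    calc _ = (kB * kB) * X * (kB * kB) := by simp only [mul_assoc]
      _ = _ := by rw [kB_mul_kB, one_mul, mul_one]
  refine ⟨⟨h.left.hol, fun z hz => ?_, h.left.det, fun z hz => ?_⟩,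
    ⟨h.right.hol, fun z hz => ?_, h.right.det, fun z hz => ?_⟩⟩
  · exact conj_aux (h.unique hr hz).1
  · rw [(h.unique ht hz).1, kk]
  · exact conj_aux (h.unique hr hz).2
  · rw [(h.unique ht hz).2, kk]

section Parameters

variable {E : Type} [NormedAddCommGroup E] [NormedSpace ℝ E]

/-- Families of holomorphic functions on `ℂ^*`, smooth jointly in parameter and variable. -/
def JointSmooth {M : Type} [NormedAddCommGroup M] [NormedSpace ℝ M] (V : Set E) (f : E → ℂ → M) :
    Prop := ContDiffOn ℝ ∞ (fun q : E × ℂ => f q.1 q.2) (V ×ˢ {0}ᶜ)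

theorem JointSmooth.mono {M : Type} [NormedAddCommGroup M] [NormedSpace ℝ M] {V V' : Set E}
    {f : E → ℂ → M} (h : JointSmooth V f) (hV : V' ⊆ V) : JointSmooth V' f :=
  ContDiffOn.mono h (prod_mono_left hV)

theorem JointSmooth.mul {V : Set E} {f g : E → ℂ → BMat} (hf : JointSmooth V f)
    (hg : JointSmooth V g) : JointSmooth V (fun p z => f p z * g p z) :=
  ContDiffOn.mul hf hg

theorem JointSmooth.inv {V : Set E} {f : E → ℂ → BMat} (hf : JointSmooth V f) :
    JointSmooth V (fun p z => adjB (f p z)) :=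
  (adjB.restrictScalars ℝ).contDiff.comp_contDiffOn hf

theorem JointSmooth.congr {M : Type} [NormedAddCommGroup M] [NormedSpace ℝ M] {V : Set E}
    {f g : E → ℂ → M} (hf : JointSmooth V f) (h : ∀ p ∈ V, ∀ z, z ≠ 0 → g p z = f p z) :
    JointSmooth V g :=
  ContDiffOn.congr hf fun q hq => h q.1 hq.1 q.2 hq.2

theorem JointSmooth.flip {M : Type} [NormedAddCommGroup M] [NormedSpace ℝ M] {V : Set E}
    {f : E → ℂ → M} (hf : JointSmooth V f) : JointSmooth V (fun p => flipB (f p)) :=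
  ContDiffOn.comp (g := fun q : E × ℂ => f q.1 q.2) hf (f := fun q : E × ℂ => (q.1, q.2⁻¹))
    (contDiffOn_fst.prodMk (contDiffOn_snd.inv fun _ hq => hq.2))
    fun _ hq => ⟨hq.1, inv_ne_zero hq.2⟩

theorem jointSmooth_const {V : Set E} {γ : ℂ → BMat} (h : DifferentiableOn ℂ γ {0}ᶜ) :
    JointSmooth V (fun _ => γ) := by
  have h1 : ContDiffOn ℂ ∞ γ {0}ᶜ := h.contDiffOn isOpen_compl_singleton
  exact (h1.restrict_scalars ℝ).comp contDiffOn_snd fun q hq => hq.2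

/-- A jointly smooth family that extends to `0` for each parameter extends jointly smoothly. -/
theorem contDiffOn_of_limAt {M : Type} [NormedAddCommGroup M] [NormedSpace ℂ M] [CompleteSpace M]
    {V : Set E} (hV : IsOpen V) {f g : E → ℂ → M} (hf : JointSmooth V f)
    (hg : ∀ p ∈ V, Differentiable ℂ (g p)) (hfg : ∀ p ∈ V, ∀ z, z ≠ 0 → g p z = f p z) :
    ContDiffOn ℝ ∞ (fun q : E × ℂ => g q.1 q.2) (V ×ˢ univ) := by
  have hg' : JointSmooth V g := hf.congr hfg
  have hopen : IsOpen (V ×ˢ ({0}ᶜ : Set ℂ)) := hV.prod isOpen_compl_singleton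
  have hs : V ×ˢ sphere (0 : ℂ) 1 ⊆ V ×ˢ ({0}ᶜ : Set ℂ) :=
    prod_mono_right fun w hw => ne_zero_of_mem_sphere one_ne_zero ⟨w, hw⟩
  rintro ⟨p, z⟩ ⟨hp, -⟩
  by_cases hz : z = 0
  · refine ((contDiffOn_of_slice zero_le_one (contDiffOn_slice hV hopen hg' hs)
      (fun p hp => (hg p hp).diffContOnCl) fun p hp w => ?_).contDiffAt
      ((hV.prod isOpen_ball).mem_nhds ⟨hp, ?_⟩)).contDiffWithinAt
    · exact slice_apply hg'.continuousOn hs hp w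
    · rw [hz]; exact mem_ball_self one_pos
  · exact (ContDiffOn.contDiffAt hg' (hopen.mem_nhds ⟨hp, hz⟩)).contDiffWithinAt

/-- Translate by the known factors: a₀⁻¹ Ψ b₀⁻¹ equals 1 at p₀ and can be factored nearby. If b is
its factor, the right factor of Ψ is b b₀ and the left one is what remains. -/
theorem exists_negPos_near {V : Set E} (hV : IsOpen V) {p₀ : E} (hp₀ : p₀ ∈ V) {Ψ : E → ℂ → BMat}
    (hΨ : JointSmooth V Ψ) (hSL : ∀ p ∈ V, IsHolSL (Ψ p)) {a₀ b₀ : ℂ → BMat}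
    (h₀ : IsNegPos (Ψ p₀) a₀ b₀) :
    ∃ V' ⊆ V, IsOpen V' ∧ p₀ ∈ V' ∧ ∃ a b : E → ℂ → BMat, JointSmooth V' a ∧ JointSmooth V' b ∧
      ∀ p ∈ V', IsNegPos (Ψ p) (a p) (b p) := by
  let γ : E → ℂ → BMat := fun p z => adjB (a₀ z) * Ψ p z * adjB (b₀ z)
  have hγ : JointSmooth V γ := ((jointSmooth_const h₀.left.inv.hol).mul hΨ).mul
    (jointSmooth_const h₀.right.inv.hol)
  have hγSL : ∀ p ∈ V, IsHolSL (γ p) := fun p hp =>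
    (h₀.left.inv.mul (hSL p hp)).mul h₀.right.inv
  obtain ⟨V', hV'V, hV', hp₀', b, hb, hbs, hlim⟩ := exists_local_birkhoff hV hp₀ hγ
    (fun p hp => (hγSL p hp).hol) (fun p hp z hz => isUnit_of_detB ((hγSL p hp).det z hz))
    (fun z hz => by
      change adjB (a₀ z) * Ψ p₀ z * adjB (b₀ z) = 1
      rw [h₀.eq z hz, ← mul_assoc, adjB_mul (h₀.left.det z hz), one_mul,
        mul_adjB (h₀.right.det z hz)])
  obtain ⟨x₀, hx₀⟩ := h₀.lim_right
  have hlim' : ∀ p ∈ V', LimAt (flipB fun z => b p z * adjB (γ p z)) 1 := fun p hp =>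
    LimAt.congr (hlim p hp) fun z hz => by
      rw [flipB, inverse_eq_adjB ((hγSL p (hV'V hp)).det _ (inv_ne_zero hz))]
  -- The determinant of b is entire and tends to 1 at ∞, because det γ = 1 and b γ⁻¹ → 1; hence it
  -- is 1, which also makes b invertible.
  have hbSL : ∀ p ∈ V', IsHolSL (b p) := fun p hp => by
    refine ⟨(hb p hp).differentiableOn, fun z hz => ?_⟩
    refine eq_of_tendsto_inv (g := fun z => detB (b p z))
      ((contDiff_detB.differentiable (by simp)).comp (hb p hp)).differentiableOn
      (tendsto_smul_zero (x := detB (b p 0)) ?_) ?_ hz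
    · exact ((continuous_detB.comp (hb p hp).continuous).tendsto 0).mono_left nhdsWithin_le_nhds
    · have h1 := (continuous_detB.tendsto 1).comp (hlim' p hp)
      rw [detB_one] at h1
      refine h1.congr' (eventually_ne_zero.mono fun z hz => ?_)
      rw [Function.comp_apply, flipB, detB_mul, detB_adjB,
        (hγSL p (hV'V hp)).det _ (inv_ne_zero hz), mul_one]
  have hbj : JointSmooth V' b := hbs.mono (prod_mono_right (subset_univ _))
  have hB : JointSmooth V' fun p z => b p z * b₀ z := hbj.mul (jointSmooth_const h₀.right.hol)
  have hBSL : ∀ p ∈ V', IsHolSL fun z => b p z * b₀ z := fun p hp => (hbSL p hp).mul h₀.right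
  refine ⟨V', hV'V, hV', hp₀', fun p z => Ψ p z * adjB (b p z * b₀ z), fun p z => b p z * b₀ z,
    (hΨ.mono hV'V).mul hB.inv, hB, fun p hp =>
    ⟨(hSL p (hV'V hp)).mul (hBSL p hp).inv, hBSL p hp, ?_, ⟨b p 0 * x₀, ?_⟩, fun z hz => ?_⟩⟩
  · have h1 := h₀.lim_left.mul ((adjB.continuous.tendsto 1).comp (hlim' p hp))
    rw [adjB_one, one_mul] at h1
    refine LimAt.congr h1 fun z hz => ?_
    have hz' := inv_ne_zero hz
    change Ψ p z⁻¹ * adjB (b p z⁻¹ * b₀ z⁻¹) =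
      a₀ z⁻¹ * adjB (b p z⁻¹ * adjB (adjB (a₀ z⁻¹) * Ψ p z⁻¹ * adjB (b₀ z⁻¹)))
    have aa : ∀ X : BMat, adjB (adjB X) = X := fun X => by
      apply BMat.ext4 <;> simp [adjB_apply, entryB_mkB]
    simp only [adjB_mul_rev, aa, mul_assoc]
    rw [← mul_assoc (a₀ z⁻¹) (adjB (a₀ z⁻¹)), mul_adjB (h₀.left.det _ hz'), one_mul]
  · exact (((hb p hp).continuous.tendsto 0).mono_left nhdsWithin_le_nhds).mul hx₀
  · rw [mul_assoc, adjB_mul ((hBSL p hp).det z hz), mul_one]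

/-- The big cell is open, and the factors depend smoothly on the parameter. -/
theorem exists_negPos {V : Set E} (hV : IsOpen V) {Ψ : E → ℂ → BMat}
    (hΨ : JointSmooth V Ψ) (hSL : ∀ p ∈ V, IsHolSL (Ψ p)) :
    IsOpen {p | p ∈ V ∧ ∃ a b, IsNegPos (Ψ p) a b} ∧ ∃ a b : E → ℂ → BMat,
      JointSmooth {p | p ∈ V ∧ ∃ a b, IsNegPos (Ψ p) a b} a ∧
      JointSmooth {p | p ∈ V ∧ ∃ a b, IsNegPos (Ψ p) a b} b ∧
      ∀ p, p ∈ V → (∃ a b, IsNegPos (Ψ p) a b) → IsNegPos (Ψ p) (a p) (b p) := by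
  have h : ∀ p, ∃ a b, (∃ a b, IsNegPos (Ψ p) a b) → IsNegPos (Ψ p) a b := fun p => by
    by_cases hp : ∃ a b, IsNegPos (Ψ p) a b
    · obtain ⟨a, b, hab⟩ := hp
      exact ⟨a, b, fun _ => hab⟩
    · exact ⟨1, 1, fun h => absurd h hp⟩
  choose a b hab using h
  -- The factors were chosen point by point; by uniqueness they coincide with the smooth local ones
  -- on ℂ^*.
  have key : ∀ p ∈ V, (∃ a b, IsNegPos (Ψ p) a b) → ∃ V' ⊆ V, IsOpen V' ∧ p ∈ V' ∧
      (∀ p ∈ V', ∃ a b, IsNegPos (Ψ p) a b) ∧ JointSmooth V' a ∧ JointSmooth V' b := by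
    rintro p hp ⟨a₀, b₀, h₀⟩
    obtain ⟨V', h1, h2, h3, a', b', ha', hb', h4⟩ := exists_negPos_near hV hp hΨ hSL h₀
    refine ⟨V', h1, h2, h3, fun p hp => ⟨_, _, h4 p hp⟩, ha'.congr fun p hp z hz => ?_,
      hb'.congr fun p hp z hz => ?_⟩
    · exact ((hab p ⟨_, _, h4 p hp⟩).unique (h4 p hp) hz).1
    · exact ((hab p ⟨_, _, h4 p hp⟩).unique (h4 p hp) hz).2
  refine ⟨?_, a, b, ?_, ?_, fun p _ h => hab p h⟩
  · rw [isOpen_iff_mem_nhds]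
    rintro p ⟨hp, h⟩
    obtain ⟨V', h1, h2, h3, h4, -⟩ := key p hp h
    exact mem_of_superset (h2.mem_nhds h3) fun q hq => ⟨h1 hq, h4 q hq⟩
  · rintro ⟨p, z⟩ ⟨⟨hp, h⟩, hz⟩
    obtain ⟨V', h1, h2, h3, h4, h5, h6⟩ := key p hp h
    exact (ContDiffOn.contDiffAt h5
      ((h2.prod isOpen_compl_singleton).mem_nhds ⟨h3, hz⟩)).contDiffWithinAt
  · rintro ⟨p, z⟩ ⟨⟨hp, h⟩, hz⟩
    obtain ⟨V', h1, h2, h3, h4, h5, h6⟩ := key p hp h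
    exact (ContDiffOn.contDiffAt h6
      ((h2.prod isOpen_compl_singleton).mem_nhds ⟨h3, hz⟩)).contDiffWithinAt

end Parameters

/-! ### Flat forms on the plane -/

section CoordForm

variable {A B : Type} [NormedRing A] [NormedAlgebra ℝ A] [NormedRing B] [NormedAlgebra ℝ B]

/-- The form `P dx + Q dy`. -/
noncomputable def coordForm (P Q : Plane → A) (p : Plane) : Plane →L[ℝ] A :=
  (ContinuousLinearMap.fst ℝ ℝ ℝ).smulRight (P p) + (ContinuousLinearMap.snd ℝ ℝ ℝ).smulRight (Q p)

theorem coordForm_apply (P Q : Plane → A) (p v : Plane) :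
    coordForm P Q p v = v.1 • P p + v.2 • Q p := rfl

theorem contDiffOn_coordForm {P Q : Plane → A} {D : Set Plane} (hP : ContDiffOn ℝ ∞ P D)
    (hQ : ContDiffOn ℝ ∞ Q D) : ContDiffOn ℝ ∞ (coordForm P Q) D :=
  (contDiffOn_const.smulRight hP).add (contDiffOn_const.smulRight hQ)

theorem fderiv_coordForm {P Q : Plane → A} {P' Q' : Plane →L[ℝ] A} {p : Plane}
    (hP : HasFDerivAt P P' p) (hQ : HasFDerivAt Q Q' p) (v w : Plane) :
    fderiv ℝ (coordForm P Q) p v w = w.1 • P' v + w.2 • Q' v := by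
  have h1 := (ContinuousLinearMap.smulRightL ℝ Plane A
    (ContinuousLinearMap.fst ℝ ℝ ℝ)).hasFDerivAt.comp p hP
  have h2 := (ContinuousLinearMap.smulRightL ℝ Plane A
    (ContinuousLinearMap.snd ℝ ℝ ℝ)).hasFDerivAt.comp p hQ
  rw [HasFDerivAt.fderiv (f := coordForm P Q) (h1.add h2)]
  rfl

theorem apply_eq_coord (T : Plane →L[ℝ] A) (v : Plane) : T v = v.1 • T (1, 0) + v.2 • T (0, 1) := by
  rw [← map_smul, ← map_smul, ← map_add]
  simp

/-- The curvature is an alternating form on the plane, so its value on (∂x, ∂y) determines it. -/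
theorem isFlatOn_coordForm {P Q : Plane → A} {D : Set Plane} (hP : ∀ p ∈ D, DifferentiableAt ℝ P p)
    (hQ : ∀ p ∈ D, DifferentiableAt ℝ Q p)
    (h : ∀ p ∈ D, fderiv ℝ Q p (1, 0) - fderiv ℝ P p (0, 1) + P p * Q p - Q p * P p = 0) :
    IsFlatOn (coordForm P Q) D := by
  intro p hp v w
  rw [fderiv_coordForm (hP p hp).hasFDerivAt (hQ p hp).hasFDerivAt,
    fderiv_coordForm (hP p hp).hasFDerivAt (hQ p hp).hasFDerivAt, coordForm_apply, coordForm_apply,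
    apply_eq_coord (fderiv ℝ P p) v, apply_eq_coord (fderiv ℝ P p) w,
    apply_eq_coord (fderiv ℝ Q p) v, apply_eq_coord (fderiv ℝ Q p) w]
  simp only [add_mul, mul_add, smul_mul_smul_comm]
  have := congrArg ((v.1 * w.2 - v.2 * w.1) • ·) (h p hp)
  rw [smul_zero] at this
  rw [← this]
  module

theorem SolvesAt.map {E : Type} [NormedAddCommGroup E] [NormedSpace ℝ E] {α : E → E →L[ℝ] A}
    {β : E → E →L[ℝ] B} {F : E → A} {p : E} (h : SolvesAt α F p) (T : A →L[ℝ] B)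
    (hT : ∀ x y, T (x * y) = T x * T y) (hαβ : ∀ v, T (α p v) = β p v) :
    SolvesAt β (fun q => T (F q)) p := by
  have := T.hasFDerivAt.comp p h
  refine HasFDerivAt.congr_fderiv this ?_
  ext v
  simp [hT, hαβ]

end CoordForm

section SecondDerivative

variable {E M : Type} [NormedAddCommGroup E] [NormedSpace ℝ E] [NormedAddCommGroup M]
  [NormedSpace ℝ M] {D : Set E} {f : E → M}

theorem contDiffOn_fderiv_apply (hD : IsOpen D) (hf : ContDiffOn ℝ ∞ f D) (v : E) :
    ContDiffOn ℝ ∞ (fun q => fderiv ℝ f q v) D :=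
  (hf.fderiv_of_isOpen hD (by simp)).clm_apply contDiffOn_const

theorem fderiv_fderiv_comm (hD : IsOpen D) (hf : ContDiffOn ℝ ∞ f D) {p : E} (hp : p ∈ D)
    (v w : E) :
    fderiv ℝ (fun q => fderiv ℝ f q v) p w = fderiv ℝ (fun q => fderiv ℝ f q w) p v := by
  have h1 : ContDiffAt ℝ ∞ f p := hf.contDiffAt (hD.mem_nhds hp)
  have h2 := h1.isSymmSndFDerivAt (by
    rw [minSmoothness_of_isRCLikeNormedField]; exact ENat.LEInfty.out)
  have h3 : DifferentiableAt ℝ (fderiv ℝ f) p :=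
    ((hf.fderiv_of_isOpen hD (m := ∞) (by simp)).contDiffAt (hD.mem_nhds hp)).differentiableAt
      (by simp)
  rw [fderiv_clm_apply h3 (differentiableAt_const v), fderiv_clm_apply h3 (differentiableAt_const w)]
  simpa using (h2 v w).symm

end SecondDerivative

/-! ### The associated family of a harmonic map -/

section Harmonic

variable {A B : Type} [NormedRing A] [NormedAlgebra ℝ A] [NormedRing B] [NormedAlgebra ℝ B]

/-- `-(1/2) f ∂_v f`. -/
noncomputable def halfLog (f : Plane → B) (v p : Plane) : B :=
  (-(1 / 2) : ℝ) • (f p * fderiv ℝ f p v)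

/-- Involution-valued maps with `f_xy` proportional to `f`. -/
structure IsHarmonicInvolution (D : Set Plane) (f : Plane → B) : Prop where
  smooth : ContDiffOn ℝ ∞ f D
  sq : ∀ p ∈ D, f p * f p = 1
  harmonic : ∀ p ∈ D, ∃ c : ℝ, fderiv ℝ (fun q => fderiv ℝ f q (0, 1)) p (1, 0) = c • f p

variable {D : Set Plane} {f : Plane → B}

theorem contDiffOn_halfLog (hD : IsOpen D) (hf : ContDiffOn ℝ ∞ f D) (v : Plane) :
    ContDiffOn ℝ ∞ (halfLog f v) D :=
  (hf.mul (contDiffOn_fderiv_apply hD hf v)).const_smul _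

namespace IsHarmonicInvolution

/-- Differentiate f² = 1. -/
theorem anticomm (hD : IsOpen D) (h : IsHarmonicInvolution D f) {p : Plane} (hp : p ∈ D)
    (v : Plane) : fderiv ℝ f p v * f p = -(f p * fderiv ℝ f p v) := by
  have hd : DifferentiableAt ℝ f p :=
    (h.smooth.contDiffAt (hD.mem_nhds hp)).differentiableAt (by simp)
  have h1 := hd.hasFDerivAt.mul' hd.hasFDerivAt
  have h2 : HasFDerivAt (fun q => f q * f q) (0 : Plane →L[ℝ] B) p :=
    (hasFDerivAt_const (1 : B) p).congr_of_eventuallyEq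
      (eventually_of_mem (hD.mem_nhds hp) fun q hq => h.sq q hq)
  have h3 := DFunLike.congr_fun (h1.unique h2) v
  have h4 : f p * fderiv ℝ f p v + fderiv ℝ f p v * f p = 0 := by simpa using h3
  exact eq_neg_of_add_eq_zero_right h4

theorem fderiv_halfLog (hD : IsOpen D) (h : IsHarmonicInvolution D f) {p : Plane} (hp : p ∈ D)
    (v w : Plane) : fderiv ℝ (halfLog f v) p w = (-(1 / 2) : ℝ) •
      (f p * fderiv ℝ (fun q => fderiv ℝ f q v) p w + fderiv ℝ f p w * fderiv ℝ f p v) := by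
  have hd : DifferentiableAt ℝ f p :=
    (h.smooth.contDiffAt (hD.mem_nhds hp)).differentiableAt (by simp)
  have hd2 : DifferentiableAt ℝ (fun q => fderiv ℝ f q v) p :=
    ((contDiffOn_fderiv_apply hD h.smooth v).contDiffAt (hD.mem_nhds hp)).differentiableAt (by simp)
  have h1 := (hd.hasFDerivAt.mul' hd2.hasFDerivAt).const_smul (-(1 / 2) : ℝ)
  rw [HasFDerivAt.fderiv (f := halfLog f v) h1]
  simp

/-- Differentiate f_y f + f f_y = 0 in x and insert f_xy = c f. -/
theorem symm_mul (hD : IsOpen D) (h : IsHarmonicInvolution D f) {p : Plane} (hp : p ∈ D)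
    {c : ℝ} (hc : fderiv ℝ (fun q => fderiv ℝ f q (0, 1)) p (1, 0) = c • f p) :
    fderiv ℝ f p (1, 0) * fderiv ℝ f p (0, 1) + fderiv ℝ f p (0, 1) * fderiv ℝ f p (1, 0) =
      (-2 * c) • (1 : B) := by
  have hd : DifferentiableAt ℝ f p :=
    (h.smooth.contDiffAt (hD.mem_nhds hp)).differentiableAt (by simp)
  have hd2 : DifferentiableAt ℝ (fun q => fderiv ℝ f q (0, 1)) p :=
    ((contDiffOn_fderiv_apply hD h.smooth _).contDiffAt (hD.mem_nhds hp)).differentiableAt (by simp)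
  have h1 := (hd2.hasFDerivAt.mul' hd.hasFDerivAt).add (hd.hasFDerivAt.mul' hd2.hasFDerivAt)
  have h2 : HasFDerivAt (fun q => fderiv ℝ f q (0, 1) * f q + f q * fderiv ℝ f q (0, 1))
      (0 : Plane →L[ℝ] B) p :=
    (hasFDerivAt_const (0 : B) p).congr_of_eventuallyEq
      (eventually_of_mem (hD.mem_nhds hp) fun q hq => by
        change _ * _ + _ * _ = _
        rw [h.anticomm hD hq, neg_add_cancel])
  have h3 := DFunLike.congr_fun (h1.unique h2) (1, 0)
  simp [hc, h.sq p hp] at h3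
  have h4 : fderiv ℝ f p (1, 0) * fderiv ℝ f p (0, 1) +
      fderiv ℝ f p (0, 1) * fderiv ℝ f p (1, 0) + (2 * c) • (1 : B) = 0 := by
    rw [← h3]; module
  rw [eq_neg_of_add_eq_zero_left h4]
  module

/-- The connection forms of the associated family are flat. -/
theorem isFlatOn (hD : IsOpen D) (h : IsHarmonicInvolution D f) (ι : B →L[ℝ] A)
    (hι : ∀ x y, ι (x * y) = ι x * ι y) {a b : A} (ha : ∀ x, ι x * a = a * ι x)
    (hb : ∀ x, ι x * b = b * ι x) (hcomm : b * a = a * b) (hab : a + b + a * b = 0) :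
    IsFlatOn (coordForm (fun p => a * ι (halfLog f (1, 0) p)) (fun p => b * ι (halfLog f (0, 1) p)))
      D := by
  have hd : ∀ v, ∀ p ∈ D, DifferentiableAt ℝ (halfLog f v) p := fun v p hp =>
    ((contDiffOn_halfLog hD h.smooth v).contDiffAt (hD.mem_nhds hp)).differentiableAt (by simp)
  have hdι : ∀ (g : A) v, ∀ p ∈ D, HasFDerivAt (fun p => g * ι (halfLog f v p))
      (g • ι.comp (fderiv ℝ (halfLog f v) p)) p := fun g v p hp =>
    (ι.hasFDerivAt.comp p (hd v p hp).hasFDerivAt).const_mul g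
  refine isFlatOn_coordForm (fun p hp => (hdι a _ p hp).differentiableAt)
    (fun p hp => (hdι b _ p hp).differentiableAt) fun p hp => ?_
  obtain ⟨c, hc⟩ := h.harmonic p hp
  rw [(hdι a _ p hp).fderiv, (hdι b _ p hp).fderiv]
  change b * ι (fderiv ℝ (halfLog f (0, 1)) p (1, 0)) - a * ι (fderiv ℝ (halfLog f (1, 0)) p (0, 1))
    + _ - _ = 0
  have hs := h.symm_mul hD hp hc
  have hx := h.anticomm hD hp (1, 0)
  have hy := h.anticomm hD hp (0, 1)
  -- Here f f_xy = c cancels the symmetric part of f_x f_y, which leaves a multiple of the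
  -- commutator [f_x, f_y].
  have e1 : fderiv ℝ (halfLog f (0, 1)) p (1, 0) = (-(1 / 4) : ℝ) •
      (fderiv ℝ f p (1, 0) * fderiv ℝ f p (0, 1) - fderiv ℝ f p (0, 1) * fderiv ℝ f p (1, 0)) := by
    rw [h.fderiv_halfLog hD hp, hc, mul_smul_comm, h.sq p hp]
    have : c • (1 : B) = (-(1 / 2) : ℝ) • ((-2 * c) • (1 : B)) := by module
    rw [this, ← hs]
    module
  have e2 : fderiv ℝ (halfLog f (1, 0)) p (0, 1) = (1 / 4 : ℝ) •
      (fderiv ℝ f p (1, 0) * fderiv ℝ f p (0, 1) - fderiv ℝ f p (0, 1) * fderiv ℝ f p (1, 0)) := by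
    rw [h.fderiv_halfLog hD hp, fderiv_fderiv_comm hD h.smooth hp, hc, mul_smul_comm, h.sq p hp]
    have : c • (1 : B) = (-(1 / 2) : ℝ) • ((-2 * c) • (1 : B)) := by module
    rw [this, ← hs]
    module
  have e3 : ∀ v w, fderiv ℝ f p v * f p = -(f p * fderiv ℝ f p v) →
      halfLog f v p * halfLog f w p = (-(1 / 4) : ℝ) • (fderiv ℝ f p v * fderiv ℝ f p w) := by
    intro v w hv
    rw [halfLog, halfLog, smul_mul_smul_comm, mul_assoc, ← mul_assoc (fderiv ℝ f p v), hv]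
    simp only [neg_mul, mul_neg, ← mul_assoc, h.sq p hp, one_mul]
    module
  have e4 : ∀ (a b : A) (x y : B), (ι x * b = b * ι x) →
      a * ι x * (b * ι y) = a * b * ι (x * y) := by
    intro a b x y hx
    rw [hι, mul_assoc, ← mul_assoc (ι x), hx]
    simp only [mul_assoc]
  rw [e4 _ _ _ _ (hb _), e4 _ _ _ _ (ha _), e1, e2, e3 _ _ hx, e3 _ _ hy, hcomm]
  set n := fderiv ℝ f p (1, 0) * fderiv ℝ f p (0, 1)
  set m := fderiv ℝ f p (0, 1) * fderiv ℝ f p (1, 0)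
  -- The whole curvature is -(1/4) (a + b + ab) [f_x, f_y].
  have : (-(1 / 4) : ℝ) • ((a + b + a * b) * (ι n - ι m)) = 0 := by rw [hab, zero_mul, smul_zero]
  rw [← this]
  simp only [map_smul, map_sub, mul_smul_comm, mul_sub, add_mul]
  module

end IsHarmonicInvolution

end Harmonic

/-! ### Algebras of holomorphic functions on a disc -/

section HolAlg

variable {M : Type} [NormedRing M] [NormedAlgebra ℂ M] [CompleteSpace M]

/-- Continuous functions on a closed disc that are holomorphic inside. -/
def holAlg (M : Type) [NormedRing M] [NormedAlgebra ℂ M] (z₀ : ℂ) (r : ℝ) :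
    Subalgebra ℝ C(closedBall z₀ r, M) where
  carrier := {φ | ∃ f : ℂ → M, DifferentiableOn ℂ f (ball z₀ r) ∧ ∀ w, φ w = f w}
  mul_mem' := by
    rintro φ χ ⟨f, hf, hφ⟩ ⟨g, hg, hχ⟩
    exact ⟨fun z => f z * g z, hf.mul hg, fun w => by rw [ContinuousMap.mul_apply, hφ, hχ]⟩
  add_mem' := by
    rintro φ χ ⟨f, hf, hφ⟩ ⟨g, hg, hχ⟩
    exact ⟨fun z => f z + g z, hf.add hg, fun w => by rw [ContinuousMap.add_apply, hφ, hχ]⟩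
  algebraMap_mem' c := ⟨fun _ => algebraMap ℝ M c, differentiableOn_const _, fun w => rfl⟩

/-- Uniform limits of holomorphic functions are holomorphic. -/
theorem isClosed_holAlg (z₀ : ℂ) (r : ℝ) : IsClosed (holAlg M z₀ r : Set C(closedBall z₀ r, M)) := by
  classical
  refine isSeqClosed_iff_isClosed.1 fun φ χ hφ hlim => ?_
  let ext : C(closedBall z₀ r, M) → ℂ → M := fun θ z =>
    if h : z ∈ closedBall z₀ r then θ ⟨z, h⟩ else 0
  have hext : ∀ θ (w : closedBall z₀ r), ext θ w = θ w := fun θ w => dif_pos w.2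
  have hd : ∀ n, DifferentiableOn ℂ (ext (φ n)) (ball z₀ r) := fun n => by
    obtain ⟨f, hf, h⟩ := hφ n
    refine hf.congr fun z hz => ?_
    rw [← h ⟨z, ball_subset_closedBall hz⟩]
    exact hext (φ n) ⟨z, ball_subset_closedBall hz⟩
  refine ⟨ext χ, ?_, fun w => (hext χ w).symm⟩
  refine TendstoLocallyUniformlyOn.differentiableOn (F := fun n => ext (φ n)) (φ := atTop)
    (TendstoUniformlyOn.tendstoLocallyUniformlyOn ?_) (Eventually.of_forall hd) isOpen_ball
  rw [Metric.tendstoUniformlyOn_iff]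
  intro ε hε
  filter_upwards [Metric.tendsto_nhds.1 hlim ε hε] with n hn z hz
  have h1 := hext χ ⟨z, ball_subset_closedBall hz⟩
  have h2 := hext (φ n) ⟨z, ball_subset_closedBall hz⟩
  simp only at h1 h2
  rw [h1, h2]
  refine (ContinuousMap.dist_apply_le_dist _).trans_lt ?_
  rwa [dist_comm]

/-- The Banach algebra of continuous functions on a closed disc that are holomorphic inside. -/
def HolFun (M : Type) [NormedRing M] [NormedAlgebra ℂ M] (z₀ : ℂ) (r : ℝ) : Type := holAlg M z₀ r

noncomputable instance (z₀ : ℂ) (r : ℝ) : NormedRing (HolFun M z₀ r) :=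
  inferInstanceAs (NormedRing (holAlg M z₀ r))

noncomputable instance (z₀ : ℂ) (r : ℝ) : NormedAlgebra ℝ (HolFun M z₀ r) :=
  inferInstanceAs (NormedAlgebra ℝ (holAlg M z₀ r))

/-- The underlying continuous function. -/
def HolFun.val {z₀ : ℂ} {r : ℝ} (φ : HolFun M z₀ r) : C(closedBall z₀ r, M) := Subtype.val φ

theorem HolFun.ext {z₀ : ℂ} {r : ℝ} {φ χ : HolFun M z₀ r} (h : ∀ w, φ.val w = χ.val w) : φ = χ :=
  Subtype.ext (ContinuousMap.ext h)

instance (z₀ : ℂ) (r : ℝ) : CompleteSpace (HolFun M z₀ r) :=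
  (isClosed_holAlg z₀ r).completeSpace_coe

/-- Scalar functions in the algebra. -/
def holScalar (M : Type) [NormedRing M] [NormedAlgebra ℂ M] {z₀ : ℂ} {r : ℝ} (g : ℂ → ℂ)
    (hg : DifferentiableOn ℂ g (closedBall z₀ r)) : HolFun M z₀ r :=
  ⟨⟨fun w => g w • (1 : M), (hg.continuousOn.domRestrict).smul continuous_const⟩,
    fun z => g z • 1, (hg.mono ball_subset_closedBall).smul_const 1, fun _ => rfl⟩

/-- Constant functions in the algebra. -/
noncomputable def holConst (M : Type) [NormedRing M] [NormedAlgebra ℂ M] (z₀ : ℂ) (r : ℝ) :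
    M →L[ℝ] HolFun M z₀ r :=
  LinearMap.mkContinuous
    { toFun := fun x => ⟨ContinuousMap.const _ x, fun _ => x, differentiableOn_const _,
        fun _ => rfl⟩
      map_add' := fun _ _ => rfl
      map_smul' := fun _ _ => rfl } 1 fun x => by
    rw [one_mul]
    exact (ContinuousMap.norm_le _ (norm_nonneg _)).2 fun _ => le_rfl

/-- Evaluation on the algebra. -/
noncomputable def holEval (z₀ : ℂ) (r : ℝ) (w : closedBall z₀ r) : HolFun M z₀ r →L[ℝ] M :=
  LinearMap.mkContinuous
    { toFun := fun φ => φ.val w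
      map_add' := fun _ _ => rfl
      map_smul' := fun _ _ => rfl } 1 fun φ => by
    rw [one_mul]
    exact φ.val.norm_coe_le_norm w

/-- Restriction to the boundary circle. -/
noncomputable def holRestrict (z₀ : ℂ) (r : ℝ) : HolFun M z₀ r →L[ℝ] C(sphere z₀ r, M) :=
  LinearMap.mkContinuous
    { toFun := fun φ => φ.val.comp
        ⟨fun w => ⟨w, sphere_subset_closedBall w.2⟩, by fun_prop⟩
      map_add' := fun _ _ => rfl
      map_smul' := fun _ _ => rfl } 1 fun φ => by
    rw [one_mul]
    exact (ContinuousMap.norm_le _ (norm_nonneg _)).2 fun w =>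
      φ.val.norm_coe_le_norm _

end HolAlg

/-! ### Integration of the associated family, holomorphically in the loop parameter. -/

section AssociatedFamily

variable {M : Type} [NormedRing M] [NormedAlgebra ℂ M] [CompleteSpace M]

/-- The connection form of the associated family. -/
noncomputable def assocForm (f : Plane → M) (z : ℂ) : Plane → Plane →L[ℝ] M :=
  coordForm (fun p => ((z - 1) • (1 : M)) * halfLog f (1, 0) p)
    (fun p => ((z⁻¹ - 1) • (1 : M)) * halfLog f (0, 1) p)

/-- The relation a + b + ab = 0 on which the flatness of the associated family rests. -/
theorem scalar_identity {z : ℂ} (hz : z ≠ 0) : (z - 1) + (z⁻¹ - 1) + (z - 1) * (z⁻¹ - 1) = 0 := by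
  field_simp
  ring

/-- The equation is solved for each z separately, and once more on each small disc in z with values
in the Banach algebra of holomorphic functions on it. By uniqueness the former solutions are the
values of the latter, which supplies both holomorphy in z and joint smoothness. -/
theorem exists_associatedFamily {D : Set Plane} (hD : IsOpen D) [SimplyConnectedSpace D]
    {p₀ : Plane} (hp₀ : p₀ ∈ D) {f : Plane → M} (hf : IsHarmonicInvolution D f) :
    ∃ F : Plane → ℂ → M, JointSmooth D F ∧ (∀ p ∈ D, DifferentiableOn ℂ (F p) {0}ᶜ) ∧
      ∀ z, z ≠ 0 → F p₀ z = 1 ∧ ∀ p ∈ D, IsUnit (F p z) ∧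
        SolvesAt (assocForm f z) (fun q => F q z) p := by
  have hconn : IsPreconnected D := isPreconnected_iff_preconnectedSpace.2 inferInstance
  have hX := contDiffOn_halfLog hD hf.smooth
  have hsol : ∀ z : ℂ, ∃ F : Plane → M, z ≠ 0 → F p₀ = 1 ∧ ∀ p ∈ D, IsUnit (F p) ∧
      SolvesAt (assocForm f z) F p := fun z => by
    by_cases hz : z = 0
    · exact ⟨1, fun h => absurd hz h⟩
    have hflat : IsFlatOn (assocForm f z) D := by
      refine hf.isFlatOn hD (ContinuousLinearMap.id ℝ M) (fun _ _ => rfl) (fun x => ?_)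
        (fun x => ?_) ?_ ?_
      · simp
      · simp
      · simp [smul_smul, mul_comm]
      · rw [smul_mul_smul_comm, mul_one, ← add_smul, ← add_smul, scalar_identity hz, zero_smul]
    obtain ⟨F, hF⟩ := exists_global_solution hD (contDiffOn_coordForm
      (contDiffOn_const.mul (hX _)) (contDiffOn_const.mul (hX _))) hflat hp₀
    exact ⟨F, fun _ => hF⟩
  choose F hF using hsol
  have hdisc : ∀ z₀ : ℂ, z₀ ≠ 0 → ∃ r > 0, ∃ G : Plane → HolFun M z₀ r, ContDiffOn ℝ ∞ G D ∧
      ∀ p ∈ D, ∀ w : closedBall z₀ r, F w p = (G p).val w := by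
    intro z₀ hz₀
    -- This radius keeps the closed disc away from 0, where z⁻¹ - 1 is singular.
    have hr : 0 < ‖z₀‖ / 2 := by positivity
    have hne : ∀ w ∈ closedBall z₀ (‖z₀‖ / 2), w ≠ 0 := fun w hw h => by
      rw [h, mem_closedBall, dist_zero_left] at hw
      linarith [norm_pos_iff.2 hz₀]
    have hg1 : DifferentiableOn ℂ (fun z => z - 1) (closedBall z₀ (‖z₀‖ / 2)) := by fun_prop
    have hg2 : DifferentiableOn ℂ (fun z => z⁻¹ - 1) (closedBall z₀ (‖z₀‖ / 2)) :=
      (differentiableOn_inv.mono hne).sub_const 1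
    let a := holScalar M _ hg1
    let b := holScalar M _ hg2
    let ι := holConst M z₀ (‖z₀‖ / 2)
    have hflat := hf.isFlatOn hD ι (a := a) (b := b) (fun _ _ => rfl)
      (fun x => HolFun.ext (fun w => by
        change x * ((_ : ℂ) • (1 : M)) = ((_ : ℂ) • (1 : M)) * x
        simp))
      (fun x => HolFun.ext (fun w => by
        change x * ((_ : ℂ) • (1 : M)) = ((_ : ℂ) • (1 : M)) * x
        simp))
      (HolFun.ext (fun w => by
        change ((_ : ℂ) • (1 : M)) * ((_ : ℂ) • (1 : M)) =
          ((_ : ℂ) • (1 : M)) * ((_ : ℂ) • (1 : M))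
        rw [smul_mul_smul_comm, smul_mul_smul_comm, mul_comm]))
      (HolFun.ext (fun w => by
        change ((w : ℂ) - 1) • (1 : M) + ((w : ℂ)⁻¹ - 1) • (1 : M) +
          (((w : ℂ) - 1) • (1 : M)) * (((w : ℂ)⁻¹ - 1) • (1 : M)) = 0
        rw [smul_mul_smul_comm, mul_one, ← add_smul, ← add_smul, scalar_identity (hne w w.2),
          zero_smul]))
    have hα := contDiffOn_coordForm
      (contDiffOn_const (c := a).mul (ι.contDiff.comp_contDiffOn (hX (1, 0))))
      (contDiffOn_const (c := b).mul (ι.contDiff.comp_contDiffOn (hX (0, 1))))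
    obtain ⟨G, hG0, hG⟩ := exists_global_solution hD hα hflat hp₀
    refine ⟨_, hr, G, contDiffOn_of_solvesAt hD hα fun p hp => (hG p hp).2, fun p hp w => ?_⟩
    obtain ⟨h0, h1⟩ := hF w (hne w w.2)
    -- Evaluation at w is an algebra homomorphism and carries the function-valued equation to the
    -- equation with parameter w.
    refine (SolvesAt.eq_of_eq hD hconn (fun q hq => ((hG q hq).2.map (holEval z₀ _ w)
      (fun _ _ => rfl) fun v => ?_)) (fun q hq => (h1 q hq).2) (fun q hq => (h1 q hq).1) hp₀ ?_
      hp).symm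
    · rfl
    · rw [h0, hG0]; rfl
  have hhol : ∀ z₀ : ℂ, z₀ ≠ 0 → ∃ r > 0, (∀ p ∈ D, DiffContOnCl ℂ (fun z => F z p) (ball z₀ r)) ∧
      ContDiffOn ℝ ∞ (fun q : Plane × ℂ => F q.2 q.1) (D ×ˢ ball z₀ r) := by
    intro z₀ hz₀
    obtain ⟨r, hr, G, hGs, hG⟩ := hdisc z₀ hz₀
    have h1 : ∀ p ∈ D, DiffContOnCl ℂ (fun z => F z p) (ball z₀ r) := fun p hp => by
      refine ⟨?_, ?_⟩
      · obtain ⟨g, hg, hgG⟩ := (G p).2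
        refine hg.congr fun z hz => ?_
        have := hG p hp ⟨z, ball_subset_closedBall hz⟩
        exact this.trans (hgG _)
      · rw [closure_ball z₀ hr.ne', continuousOn_iff_continuous_domRestrict]
        convert (G p).val.continuous using 1
        exact funext fun w => hG p hp w
    refine ⟨r, hr, h1, contDiffOn_of_slice (f := fun p z => F z p) hr.le
      ((holRestrict z₀ r).contDiff.comp_contDiffOn hGs) h1 fun p hp w => ?_⟩
    exact (hG p hp ⟨w, sphere_subset_closedBall w.2⟩).symm
  refine ⟨fun p z => F z p, ?_, fun p hp z hz => ?_, fun z hz => hF z hz⟩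
  · rintro ⟨p, z⟩ ⟨hp, hz⟩
    obtain ⟨r, hr, -, h⟩ := hhol z hz
    exact (h.contDiffAt ((hD.prod isOpen_ball).mem_nhds ⟨hp, mem_ball_self hr⟩)).contDiffWithinAt
  · obtain ⟨r, hr, h, -⟩ := hhol z hz
    exact ((h p hp).differentiableOn.differentiableAt
      (isOpen_ball.mem_nhds (mem_ball_self hr))).differentiableWithinAt

end AssociatedFamily

/-! ### Extended framings with values in the Banach algebra -/

theorem realB_real_smul (c : ℝ) (X : MatR) : realB (c • X) = c • realB X := realB_smul c X

theorem mem_kPart_iff {A : MatR} : A ∈ kPart ↔ A 0 1 = 0 ∧ A 1 0 = 0 ∧ A 0 0 + A 1 1 = 0 := by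
  rw [kPart, Submodule.mem_span_singleton]
  constructor
  · rintro ⟨c, rfl⟩
    simp [matK]
  · rintro ⟨h1, h2, h3⟩
    refine ⟨A 1 1, ?_⟩
    ext i j
    fin_cases i <;> fin_cases j <;> simp [matK, h1, h2]
    linarith

theorem mem_mPart_iff {B : MatR} : B ∈ mPart ↔ B 0 0 = 0 ∧ B 1 1 = 0 := by
  rw [mPart, Submodule.mem_span_pair]
  constructor
  · rintro ⟨a, b, rfl⟩
    simp [matI, matJ]
  · rintro ⟨h1, h2⟩
    refine ⟨(B 1 0 - B 0 1) / 2, (B 1 0 + B 0 1) / 2, ?_⟩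
    ext i j
    fin_cases i <;> fin_cases j <;> simp [matI, matJ, h1, h2] <;> ring

theorem mul_kB_of_mem_mPart {B : MatR} (h : B ∈ mPart) : kB * realB B * kB = -realB B := by
  rw [mem_mPart_iff] at h
  apply BMat.ext4 <;> simp [entryB_mul, entryB_kB, entryB_realB, h]

theorem mul_kB_of_mem_kPart {A : MatR} (h : A ∈ kPart) : kB * realB A * kB = realB A := by
  rw [mem_kPart_iff] at h
  apply BMat.ext4 <;> simp [entryB_mul, entryB_kB, entryB_realB, h]

theorem mem_mPart_of_mul_kB {B : MatR} (h : kB * realB B * kB = -realB B) : B ∈ mPart := by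
  have h1 := congrArg (entryB 0 0) h
  have h2 := congrArg (entryB 1 1) h
  simp [entryB_mul, entryB_kB, entryB_realB] at h1 h2
  rw [mem_mPart_iff]
  constructor
  · have : (B 0 0 : ℂ) = 0 := by linear_combination h1 / 2
    exact_mod_cast this
  · have : (B 1 1 : ℂ) = 0 := by linear_combination h2 / 2
    exact_mod_cast this

theorem mem_kPart_of_mul_kB {A : MatR} (h : kB * realB A * kB = realB A)
    (ht : entryB 0 0 (realB A) + entryB 1 1 (realB A) = 0) : A ∈ kPart := by
  have h1 := congrArg (entryB 0 1) h
  have h2 := congrArg (entryB 1 0) h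
  simp [entryB_mul, entryB_kB, entryB_realB] at h1 h2 ht
  rw [mem_kPart_iff]
  refine ⟨?_, ?_, by exact_mod_cast ht⟩
  · have : (A 0 1 : ℂ) = 0 := by linear_combination -h1 / 2
    exact_mod_cast this
  · have : (A 1 0 : ℂ) = 0 := by linear_combination -h2 / 2
    exact_mod_cast this

/-- The Maurer-Cartan form `(A + z B) dx + (C + z⁻¹ E) dy`. -/
noncomputable def mcForm (A B C E : Plane → MatR) (z : ℂ) : Plane → Plane →L[ℝ] BMat :=
  coordForm (fun p => realB (A p) + z • realB (B p)) (fun p => realB (C p) + z⁻¹ • realB (E p))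

/-- An extended framing with values in the Banach algebra. -/
structure IsFramingB (U : Set Plane) (ψ : Plane → MatR) (P : Plane → ℂ → BMat) : Prop where
  smooth : JointSmooth U P
  loop : ∀ p ∈ U, IsLoop (P p)
  base : ∀ z, z ≠ 0 → P (0, 0) z = 1
  mc : ∃ A B C E : Plane → MatR, ∀ p ∈ U, A p ∈ kPart ∧ B p ∈ mPart ∧ C p ∈ kPart ∧ E p ∈ mPart ∧
    ∀ z, z ≠ 0 → SolvesAt (mcForm A B C E z) (fun q => P q z) p
  framing : ∀ p ∈ U, realB (ψ p) * P p 1 = P p 1 * kB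

theorem isSmoothLoopMap_iff {U : Set Plane} {Ψ : Plane → Loop} :
    IsSmoothLoopMap U Ψ ↔ JointSmooth U (fun p => loopB (Ψ p)) :=
  isSmoothOn_iff (f := fun q : Plane × ℂ => Ψ q.1 q.2)

theorem JointSmooth.differentiableAt {E M : Type} [NormedAddCommGroup E] [NormedSpace ℝ E]
    [NormedAddCommGroup M] [NormedSpace ℝ M] {U : Set E} (hU : IsOpen U) {f : E → ℂ → M}
    (h : JointSmooth U f) {p : E} (hp : p ∈ U) {z : ℂ} (hz : z ≠ 0) :
    DifferentiableAt ℝ (fun q => f q z) p := by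
  have h1 : DifferentiableAt ℝ (fun q : E × ℂ => f q.1 q.2) (p, z) :=
    (ContDiffOn.contDiffAt h ((hU.prod isOpen_compl_singleton).mem_nhds
      (show (p, z) ∈ U ×ˢ ({0}ᶜ : Set ℂ) from ⟨hp, hz⟩))).differentiableAt (by simp)
  exact DifferentiableAt.comp (g := fun q : E × ℂ => f q.1 q.2) (f := fun q => (q, z)) p h1
    (by fun_prop)

theorem solvesAt_coordForm_iff {A : Type} [NormedRing A] [NormedAlgebra ℝ A] [CompleteSpace A] {P Q F : Plane → A}
    {p : Plane} (hF : DifferentiableAt ℝ F p) : SolvesAt (coordForm P Q) F p ↔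
      fderiv ℝ F p (1, 0) = F p * P p ∧ fderiv ℝ F p (0, 1) = F p * Q p := by
  constructor
  · intro h
    rw [h.fderiv_apply, h.fderiv_apply, coordForm_apply, coordForm_apply]
    simp
  · rintro ⟨h1, h2⟩
    refine hF.hasFDerivAt.congr_fderiv ?_
    ext
    · simp [h1, coordForm_apply]
    · simp [h2, coordForm_apply]

theorem eq_mul_of_adjB_mul {X Y Z : BMat} (h : detB X = 1) : adjB X * Y = Z ↔ Y = X * Z := by
  constructor
  · rintro rfl
    rw [← mul_assoc, mul_adjB h, one_mul]
  · rintro rfl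
    rw [← mul_assoc, adjB_mul h, one_mul]

/-- The determinant is 1, so conditions on logarithmic derivatives and on Ad become linear
identities free of inverses. -/
theorem isExtendedFraming_iff {U : Set Plane} (hU : IsOpen U) {ψ : Plane → MatR}
    {Ψ : Plane → Loop} :
    IsExtendedFraming U ψ Ψ ↔ IsFramingB U ψ (fun p => loopB (Ψ p)) := by
  have hmc : ∀ p ∈ U, JointSmooth U (fun p => loopB (Ψ p)) → IsLoop (loopB (Ψ p)) →
      ∀ (A B C E : Plane → MatR) (z : ℂ), z ≠ 0 →
      ((Ψ p z)⁻¹ * partialX (fun q => Ψ q z) p = toC (A p) + z • toC (B p) ∧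
      (Ψ p z)⁻¹ * partialY (fun q => Ψ q z) p = toC (C p) + z⁻¹ • toC (E p) ↔
      SolvesAt (mcForm A B C E z) (fun q => loopB (Ψ q) z) p) := by
    intro p hp hs hl A B C E z hz
    have hd := hs.differentiableAt hU hp hz
    have hdet : (Ψ p z).det = 1 := hl.det z hz
    rw [mcForm, solvesAt_coordForm_iff hd, ← eq_mul_of_adjB_mul (hl.det z hz),
      ← eq_mul_of_adjB_mul (hl.det z hz)]
    have key : ∀ (v : Plane) (Y Z : MatR) (w : ℂ),
        (Ψ p z)⁻¹ * matDeriv (fun q => Ψ q z) p v = toC Y + w • toC Z ↔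
        adjB (loopB (Ψ p) z) * fderiv ℝ (fun q => loopB (Ψ q) z) p v =
          realB Y + w • realB Z := by
      intro v Y Z w
      rw [← toB.injective.eq_iff, map_mul, toB_inv hdet, toB_matDeriv hd, map_add, map_smul]
      rfl
    exact and_congr (key _ _ _ _) (key _ _ _ _)
  have hfr : ∀ p, IsLoop (loopB (Ψ p)) → (toC (ψ p) = adAct (Ψ p 1) (toC matK) ↔
      realB (ψ p) * loopB (Ψ p) 1 = loopB (Ψ p) 1 * kB) := by
    intro p hl
    have hdet : (Ψ p 1).det = 1 := hl.det 1 one_ne_zero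
    rw [← toB.injective.eq_iff, adAct, map_mul, map_mul, toB_inv hdet]
    change realB (ψ p) = loopB (Ψ p) 1 * kB * adjB (loopB (Ψ p) 1) ↔ _
    constructor
    · intro h
      rw [h, mul_assoc, adjB_mul (hl.det 1 one_ne_zero), mul_one]
    · intro h
      rw [← h, mul_assoc, mul_adjB (hl.det 1 one_ne_zero), mul_one]
  constructor
  · rintro ⟨h1, h2, h3, ⟨A, B, C, E, h4⟩, h5⟩
    have hs := isSmoothLoopMap_iff.1 h1
    have hl := fun p hp => mem_loopGroup_iff.1 (h2 p hp)
    refine ⟨hs, hl, fun z hz => ?_, ⟨A, B, C, E, fun p hp => ?_⟩, fun p hp =>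
      (hfr p (hl p hp)).1 (h5 p hp)⟩
    · rw [loopB, h3 z hz, map_one]
    · obtain ⟨a, b, c, d, e⟩ := h4 p hp
      exact ⟨a, b, c, d, fun z hz => (hmc p hp hs (hl p hp) A B C E z hz).1 (e z hz)⟩
  · rintro ⟨hs, hl, h3, ⟨A, B, C, E, h4⟩, h5⟩
    refine ⟨isSmoothLoopMap_iff.2 hs, fun p hp => mem_loopGroup_iff.2 (hl p hp), fun z hz => ?_,
      ⟨A, B, C, E, fun p hp => ?_⟩, fun p hp => (hfr p (hl p hp)).2 (h5 p hp)⟩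
    · exact toB.injective (by rw [map_one]; exact h3 z hz)
    · obtain ⟨a, b, c, d, e⟩ := h4 p hp
      exact ⟨a, b, c, d, fun z hz => (hmc p hp hs (hl p hp) A B C E z hz).2 (e z hz)⟩

/-! ### Derivatives of determinants and symmetric maps -/

section Derivatives

variable {E : Type} [NormedAddCommGroup E] [NormedSpace ℝ E]

theorem fderiv_eq_of_map_eq {M N : Type} [NormedAddCommGroup M] [NormedSpace ℝ M]
    [NormedAddCommGroup N] [NormedSpace ℝ N] {U : Set E} (hU : IsOpen U) {f : E → M} {g : E → N}
    (T : M →L[ℝ] N) (h : ∀ q ∈ U, T (f q) = g q) {p : E} (hp : p ∈ U)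
    (hf : DifferentiableAt ℝ f p) (v : E) : T (fderiv ℝ f p v) = fderiv ℝ g p v := by
  have h1 := (T.hasFDerivAt.comp p hf.hasFDerivAt).congr_of_eventuallyEq (f₁ := g)
    (eventually_of_mem (hU.mem_nhds hp) fun q hq => (h q hq).symm)
  rw [h1.fderiv]
  rfl

/-- Jacobi's formula. -/
theorem hasFDerivAt_detB {f : E → BMat} {f' : E →L[ℝ] BMat} {p : E} (h : HasFDerivAt f f' p) :
    ∃ d : E →L[ℝ] ℂ, HasFDerivAt (fun q => detB (f q)) d p ∧ ∀ v,
      d v = entryB 0 0 (adjB (f p) * f' v) + entryB 1 1 (adjB (f p) * f' v) := by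
  have he : ∀ i j, HasFDerivAt (fun q => entryB i j (f q))
      (((entryB i j).restrictScalars ℝ).comp f') p := fun i j =>
    ((entryB i j).restrictScalars ℝ).hasFDerivAt.comp p h
  have h1 := ((he 0 0).mul (he 1 1)).sub ((he 0 1).mul (he 1 0))
  refine ⟨_, h1.congr_of_eventuallyEq (Eventually.of_forall fun q => detB_eq (f q)), fun v => ?_⟩
  simp [entryB_mul, adjB_apply, entryB_mkB]
  ring

/-- Jacobi's formula for a constant determinant. -/
theorem trace_adjB_mul_fderiv {U : Set E} (hU : IsOpen U) {f : E → BMat}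
    (h : ∀ q ∈ U, detB (f q) = 1) {p : E} (hp : p ∈ U) (hf : DifferentiableAt ℝ f p) (v : E) :
    entryB 0 0 (adjB (f p) * fderiv ℝ f p v) + entryB 1 1 (adjB (f p) * fderiv ℝ f p v) = 0 := by
  obtain ⟨d, hd, hv⟩ := hasFDerivAt_detB hf.hasFDerivAt
  have h0 : HasFDerivAt (fun q => detB (f q)) (0 : E →L[ℝ] ℂ) p :=
    (hasFDerivAt_const (1 : ℂ) p).congr_of_eventuallyEq
      (eventually_of_mem (hU.mem_nhds hp) fun q hq => h q hq)
  have h1 := hv v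
  rw [hd.unique h0] at h1
  exact h1.symm

end Derivatives

/-- The Maurer-Cartan form has real, trace-free coefficients, even in z on 𝔨 and odd on 𝔪. So both
sides of each symmetry solve the same linear equation and agree at the base point. -/
theorem isLoop_of_solvesAt {U : Set Plane} (hU : IsOpen U) (hc : IsPreconnected U) {p₀ : Plane}
    (hp₀ : p₀ ∈ U) {P : Plane → ℂ → BMat} (hhol : ∀ p ∈ U, DifferentiableOn ℂ (P p) {0}ᶜ)
    (hu : ∀ p ∈ U, ∀ z, z ≠ 0 → IsUnit (P p z)) (h0 : ∀ z, z ≠ 0 → P p₀ z = 1)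
    {A B C E : Plane → MatR}
    (hmc : ∀ p ∈ U, A p ∈ kPart ∧ B p ∈ mPart ∧ C p ∈ kPart ∧ E p ∈ mPart ∧
      ∀ z, z ≠ 0 → SolvesAt (mcForm A B C E z) (fun q => P q z) p) {p : Plane} (hp : p ∈ U) :
    IsLoop (P p) where
  hol := hhol p hp
  real z hz := by
    have hz' : star z ≠ 0 := star_ne_zero.2 hz
    refine (SolvesAt.eq_of_eq hU hc (fun q hq => ((hmc q hq).2.2.2.2 z hz).map conjB conjB_mul
      fun v => ?_) (fun q hq => (hmc q hq).2.2.2.2 _ hz') (fun q hq => hu q hq _ hz') hp₀ ?_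
      hp).symm
    · simp only [mcForm, coordForm_apply, map_add, map_smul, conjB_smul, conjB_realB, star_inv₀]
    · rw [h0 z hz, h0 _ hz', conjB_one]
  det z hz := by
    -- By Jacobi's formula the logarithmic derivative of det P is the trace of the form, which is 0;
    -- the constant 1 solves the same equation.
    refine SolvesAt.eq_of_eq (α := fun _ => (0 : Plane →L[ℝ] ℂ)) (F := fun q => detB (P q z))
      (G := fun _ => 1) hU hc (fun q hq => ?_) (fun q hq => ?_) (fun _ _ => isUnit_one) hp₀
      (by rw [h0 z hz, detB_one]) hp
    · obtain ⟨hA, hB, hC, hE, hs⟩ := hmc q hq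
      obtain ⟨d, hd, hv⟩ := hasFDerivAt_detB (hs z hz)
      refine HasFDerivAt.congr_fderiv hd ?_
      refine ContinuousLinearMap.ext fun v => (hv v).trans ?_
      rw [mem_kPart_iff] at hA hC
      rw [mem_mPart_iff] at hB hE
      have hA' : (A q 0 0 : ℂ) + A q 1 1 = 0 := by exact_mod_cast hA.2.2
      have hC' : (C q 0 0 : ℂ) + C q 1 1 = 0 := by exact_mod_cast hC.2.2
      have hr : ∀ i j (a : ℝ) (X : BMat), entryB i j (a • X) = (a : ℂ) * entryB i j X :=
        fun i j a X => (entryB i j).map_smul (a : ℂ) X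
      change entryB 0 0 (adjB (P q z) * (P q z * mcForm A B C E z q v)) +
        entryB 1 1 (adjB (P q z) * (P q z * mcForm A B C E z q v)) =
          detB (P q z) * (0 : Plane →L[ℝ] ℂ) v
      simp [mcForm, coordForm_apply, entryB_mul, adjB_apply, entryB_mkB, entryB_realB, hA, hB, hC,
        hE, hr]
      linear_combination (entryB 0 0 (P q z) * entryB 1 1 (P q z) -
        entryB 0 1 (P q z) * entryB 1 0 (P q z)) * (v.1 * hA' + v.2 * hC')
    · refine (hasFDerivAt_const (1 : ℂ) q).congr_fderiv ?_
      refine ContinuousLinearMap.ext fun v => ?_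
      simp
  twist z hz := by
    have hz' : -z ≠ 0 := neg_ne_zero.2 hz
    let T : BMat →L[ℝ] BMat := ((ContinuousLinearMap.mul ℝ BMat).flip kB).comp
      (ContinuousLinearMap.mul ℝ BMat kB)
    have hT : ∀ X, T X = kB * X * kB := fun X => rfl
    refine SolvesAt.eq_of_eq (F := fun q => T (P q z)) hU hc
      (fun q hq => ((hmc q hq).2.2.2.2 z hz).map T (fun x y => ?_)
      fun v => ?_) (fun q hq => (hmc q hq).2.2.2.2 _ hz') (fun q hq => hu q hq _ hz') hp₀ ?_ hp
    · rw [hT, hT, hT]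
      calc _ = kB * x * (1 * y) * kB := by simp only [one_mul, mul_assoc]
        _ = _ := by rw [← kB_mul_kB]; simp only [mul_assoc]
    · obtain ⟨hA, hB, hC, hE, -⟩ := hmc q hq
      have hTs : ∀ (c : ℂ) X, T (c • X) = c • T X := fun c X => by
        simp [hT]
      simp only [mcForm, coordForm_apply, map_add, map_smul, hTs]
      rw [hT, hT, hT, hT, mul_kB_of_mem_kPart hA, mul_kB_of_mem_kPart hC, mul_kB_of_mem_mPart hB,
        mul_kB_of_mem_mPart hE, inv_neg]
      simp
    · change kB * P p₀ z * kB = _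
      rw [h0 z hz, h0 _ hz', mul_one, kB_mul_kB]

/-! ### Existence of extended framings -/

/-- By Cayley-Hamilton, trace 0 and ⟨X, X⟩ = 1 give X² = 1. Vanishing tension says that ψ_xy has no
tangential part, hence is a multiple of ψ. -/
theorem isHarmonicInvolution_realB {D : Set Plane} (hD : IsOpen D) {ψ : Plane → MatR}
    (h : IsHarmonicMap D ψ) : IsHarmonicInvolution D (fun p => realB (ψ p)) := by
  have hs := isSmoothOn_real_iff.1 h.smooth
  have hd : ∀ p ∈ D, DifferentiableAt ℝ (fun q => realB (ψ q)) p := fun p hp =>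
    (hs.contDiffAt (hD.mem_nhds hp)).differentiableAt (by simp)
  refine ⟨hs, fun p hp => ?_, fun p hp => ?_⟩
  · obtain ⟨h1, h2⟩ := h.mem p hp
    rw [← realB_mul, ← realB_one]
    congr 1
    rw [scalarProd, Matrix.trace_fin_two, Matrix.mul_apply, Matrix.mul_apply, Fin.sum_univ_two,
      Fin.sum_univ_two] at h2
    rw [Matrix.trace_fin_two] at h1
    ext i j
    fin_cases i <;> fin_cases j <;> simp [Matrix.mul_apply]
    · linear_combination h2 + (1 / 2) * (ψ p 0 0 - ψ p 1 1) * h1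
    · linear_combination ψ p 0 1 * h1
    · linear_combination ψ p 1 0 * h1
    · linear_combination h2 - (1 / 2) * (ψ p 0 0 - ψ p 1 1) * h1
  · have h1 : partialX (partialY ψ) p =
        scalarProd (partialX (partialY ψ) p) (ψ p) • ψ p := by
      have := h.harmonic p hp
      rw [tension, smul_eq_zero_iff_right (by norm_num), tangentProj, sub_eq_zero] at this
      exact this
    refine ⟨scalarProd (partialX (partialY ψ) p) (ψ p), ?_⟩
    have h2 : ∀ q ∈ D, realB (partialY ψ q) = fderiv ℝ (fun q => realB (ψ q)) q (0, 1) :=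
      fun q hq => realB_matDeriv (hd q hq) _
    have h3 : (fun q => realB (partialY ψ q)) =ᶠ[𝓝 p]
        fun q => fderiv ℝ (fun q => realB (ψ q)) q (0, 1) :=
      eventually_of_mem (hD.mem_nhds hp) h2
    have h4 : DifferentiableAt ℝ (fun q => fderiv ℝ (fun q => realB (ψ q)) q (0, 1)) p :=
      ((contDiffOn_fderiv_apply hD hs _).contDiffAt (hD.mem_nhds hp)).differentiableAt (by simp)
    have h5 := h3.fderiv_eq (𝕜 := ℝ)
    have h6 := realB_matDeriv (h4.congr_of_eventuallyEq h3) (1, 0)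
    have h7 : realB (partialX (partialY ψ) p) =
        fderiv ℝ (fun q => fderiv ℝ (fun q => realB (ψ q)) q (0, 1)) p (1, 0) :=
      h6.trans (congrArg (fun T : Plane →L[ℝ] BMat => T (1, 0)) h5)
    have h8 := congrArg realB h1
    rw [realB_real_smul] at h8
    exact h7.symm.trans h8

/-- The form du / (2u) is closed, so dρ = ρ du / (2u) has a global solution; ρ² then solves the
equation dw = w du / u of u itself. -/
theorem exists_sqrt {D : Set Plane} (hD : IsOpen D) [SimplyConnectedSpace D] {p₀ : Plane}
    (hp₀ : p₀ ∈ D) {u : Plane → ℂ} (hu : ContDiffOn ℝ ∞ u D) (h0 : ∀ p ∈ D, u p ≠ 0)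
    (h1 : u p₀ = 1) :
    ∃ ρ : Plane → ℂ, ContDiffOn ℝ ∞ ρ D ∧ ρ p₀ = 1 ∧ ∀ p ∈ D, ρ p * ρ p = u p := by
  have hconn : IsPreconnected D := isPreconnected_iff_preconnectedSpace.2 inferInstance
  let β : Plane → Plane →L[ℝ] ℂ := fun p => (u p)⁻¹ • fderiv ℝ u p
  let α : Plane → Plane →L[ℝ] ℂ := fun p => (1 / 2 : ℂ) • β p
  have hu' : ContDiffOn ℝ ∞ (fderiv ℝ u) D := hu.fderiv_of_isOpen hD (by simp)
  have hi : ContDiffOn ℝ ∞ (fun p => (u p)⁻¹) D := hu.inv h0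
  have hβ : ContDiffOn ℝ ∞ β D := hi.smul hu'
  have hα : ContDiffOn ℝ ∞ α D := hβ.const_smul (1 / 2 : ℂ)
  have hd : ∀ p ∈ D, DifferentiableAt ℝ u p := fun p hp =>
    (hu.contDiffAt (hD.mem_nhds hp)).differentiableAt (by simp)
  have hflat : IsFlatOn α D := by
    intro p hp v w
    have e1 : HasFDerivAt (fun p => (u p)⁻¹) _ p :=
      ((hi.contDiffAt (hD.mem_nhds hp)).differentiableAt (by simp)).hasFDerivAt
    have e2 : HasFDerivAt (fderiv ℝ u) _ p :=
      ((hu'.contDiffAt (hD.mem_nhds hp)).differentiableAt (by simp)).hasFDerivAt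
    have e3 : ∀ v, fderiv ℝ (fun p => (u p)⁻¹) p v = -(u p)⁻¹ * (u p)⁻¹ * fderiv ℝ u p v := by
      intro v
      have e4 := e1.mul (hd p hp).hasFDerivAt
      have e5 := e4.unique ((hasFDerivAt_const (1 : ℂ) p).congr_of_eventuallyEq
        (eventually_of_mem (hD.mem_nhds hp) fun q hq => inv_mul_cancel₀ (h0 q hq)))
      have e6 : (u p)⁻¹ * fderiv ℝ u p v + u p * fderiv ℝ (fun p => (u p)⁻¹) p v = 0 :=
        DFunLike.congr_fun e5 v
      field_simp [h0 p hp] at e6 ⊢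
      linear_combination e6
    have e7 := (e1.smul e2).const_smul (1 / 2 : ℂ)
    rw [HasFDerivAt.fderiv (f := α) e7]
    have hsymm := (hu.contDiffAt (hD.mem_nhds hp)).isSymmSndFDerivAt (by
      rw [minSmoothness_of_isRCLikeNormedField]; exact ENat.LEInfty.out) v w
    simp [α, β, e3]
    rw [hsymm]
    ring
  obtain ⟨ρ, hρ0, hρ⟩ := exists_global_solution hD hα hflat hp₀
  refine ⟨ρ, contDiffOn_of_solvesAt hD hα fun p hp => (hρ p hp).2, hρ0, fun p hp => ?_⟩
  refine SolvesAt.eq_of_eq (α := β) (F := fun p => ρ p * ρ p) hD hconn (fun q hq => ?_)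
    (fun q hq => ?_) (fun q hq => (h0 q hq).isUnit) hp₀ (by rw [hρ0, h1, one_mul]) hp
  · have h2 := HasFDerivAt.mul (hρ q hq).2 (hρ q hq).2
    refine h2.congr_fderiv (ContinuousLinearMap.ext fun v => ?_)
    change ρ q * (ρ q * α q v) + ρ q * (ρ q * α q v) = ρ q * ρ q * β q v
    change ρ q * (ρ q * ((1 / 2 : ℂ) * β q v)) + ρ q * (ρ q * ((1 / 2 : ℂ) * β q v)) = _
    ring
  · refine (hd q hq).hasFDerivAt.congr_fderiv (ContinuousLinearMap.ext fun v => ?_)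
    change fderiv ℝ u q v = u q * ((u q)⁻¹ * fderiv ℝ u q v)
    rw [mul_inv_cancel_left₀ (h0 q hq)]

/-- Take Φ to be a rotation times the unipotent matrix !![1, s; 0, 1]. Rotations preserve the skew
part of Φ 𝐤' Φ⁻¹, which fixes s, and turn its symmetric part by twice their angle. The required
double angle is a smooth unit complex number u on D, and half of it is available through a square
root of u. -/
theorem exists_frame {D : Set Plane} (hD : IsOpen D) [SimplyConnectedSpace D] {p₀ : Plane}
    (hp₀ : p₀ ∈ D) {ψ : Plane → MatR} (hs : IsSmoothOn ψ D) (hm : ∀ p ∈ D, ψ p ∈ pseudosphere)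
    (h0 : ψ p₀ = matK) :
    ∃ Φ : Plane → MatR, IsSmoothOn Φ D ∧ Φ p₀ = 1 ∧
      ∀ p ∈ D, (Φ p).det = 1 ∧ ψ p * Φ p = Φ p * matK := by
  obtain ⟨s, hsd⟩ : ∃ s : Plane → ℝ, s = fun p => (ψ p 0 1 - ψ p 1 0) / 2 := ⟨_, rfl⟩
  obtain ⟨σ, hσd⟩ : ∃ σ : Plane → ℝ, σ = fun p => (ψ p 0 1 + ψ p 1 0) / 2 := ⟨_, rfl⟩
  have hss : ContDiffOn ℝ ∞ s D := hsd ▸ ((hs 0 1).sub (hs 1 0)).div_const 2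
  have hσs : ContDiffOn ℝ ∞ σ D := hσd ▸ ((hs 0 1).add (hs 1 0)).div_const 2
  have hpos : ∀ p, 1 + s p ^ 2 ≠ 0 := fun p => by positivity
  -- C + i S = (-ψ₀₀ - iσ)(1 + is) / (1 + s²). It has modulus 1 on D because ψ₀₀² + σ² = 1 + s² on
  -- the pseudosphere.
  let C : Plane → ℝ := fun p => (-ψ p 0 0 + s p * σ p) / (1 + s p ^ 2)
  let S : Plane → ℝ := fun p => (-σ p - s p * ψ p 0 0) / (1 + s p ^ 2)
  have hCs : ContDiffOn ℝ ∞ C D :=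
    ((hs 0 0).neg.add (hss.mul hσs)).div (contDiffOn_const.add (hss.pow 2)) fun p _ => hpos p
  have hSs : ContDiffOn ℝ ∞ S D :=
    (hσs.neg.sub (hss.mul (hs 0 0))).div (contDiffOn_const.add (hss.pow 2)) fun p _ => hpos p
  have e1 : ∀ p, ψ p 0 0 = -C p - s p * S p := fun p => by
    simp only [C, S]; field_simp [hpos p]; ring
  have e2 : ∀ p, σ p = s p * C p - S p := fun p => by
    simp only [C, S]; field_simp [hpos p]; ring
  have e3 : ∀ p ∈ D, ψ p 1 1 = -ψ p 0 0 := fun p hp => by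
    have := (hm p hp).1
    rw [Matrix.trace_fin_two] at this
    linarith
  have e4 : ∀ p, ψ p 0 1 = σ p + s p := fun p => by simp only [hσd, hsd]; ring
  have e5 : ∀ p, ψ p 1 0 = σ p - s p := fun p => by simp only [hσd, hsd]; ring
  have e6 : ∀ p ∈ D, C p ^ 2 + S p ^ 2 = 1 := fun p hp => by
    have h2 := (hm p hp).2
    rw [scalarProd, Matrix.trace_fin_two, Matrix.mul_apply, Matrix.mul_apply, Fin.sum_univ_two,
      Fin.sum_univ_two, e3 p hp, e4, e5, e1, e2] at h2
    have : (1 + s p ^ 2) * (C p ^ 2 + S p ^ 2 - 1) = 0 := by linear_combination h2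
    have := (mul_eq_zero.1 this).resolve_left (hpos p)
    linarith
  let u : Plane → ℂ := fun p => C p + S p * Complex.I
  have hus : ContDiffOn ℝ ∞ u D := (Complex.ofRealCLM.contDiff.comp_contDiffOn hCs).add
    ((Complex.ofRealCLM.contDiff.comp_contDiffOn hSs).mul contDiffOn_const)
  have hre : ∀ p, (u p).re = C p := fun p => by simp [u]
  have him : ∀ p, (u p).im = S p := fun p => by simp [u]
  have hu0 : ∀ p ∈ D, u p ≠ 0 := fun p hp h => by
    have h1 := e6 p hp
    rw [← hre, ← him, h] at h1
    norm_num at h1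
  have hs0 : s p₀ = 0 ∧ σ p₀ = 0 := by simp [hsd, hσd, h0, matK]
  have hu1 : u p₀ = 1 := by
    have hC : C p₀ = 1 := by simp [C, hs0, h0, matK]
    have hS : S p₀ = 0 := by simp [S, hs0]
    simp [u, hC, hS]
  obtain ⟨ρ, hρs, hρ0, hρ⟩ := exists_sqrt hD hp₀ hus hu0 hu1
  have hcs : ContDiffOn ℝ ∞ (fun p => (ρ p).re) D := Complex.reCLM.contDiff.comp_contDiffOn hρs
  have hts : ContDiffOn ℝ ∞ (fun p => (ρ p).im) D := Complex.imCLM.contDiff.comp_contDiffOn hρs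
  -- The product of the rotation by the argument of ρ and !![1, s; 0, 1].
  refine ⟨fun p => !![(ρ p).re, (ρ p).re * s p - (ρ p).im; (ρ p).im, (ρ p).im * s p + (ρ p).re],
    fun i j => ?_, ?_, fun p hp => ?_⟩
  · fin_cases i <;> fin_cases j
    · exact hcs
    · exact (hcs.mul hss).sub hts
    · exact hts
    · exact (hts.mul hss).add hcs
  · beta_reduce
    rw [hρ0, hs0.1]
    ext i j
    fin_cases i <;> fin_cases j <;> simp
  · have hC : C p = (ρ p).re ^ 2 - (ρ p).im ^ 2 := by
      rw [← hre, ← hρ p hp, Complex.mul_re]; ring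
    have hS : S p = 2 * (ρ p).re * (ρ p).im := by
      rw [← him, ← hρ p hp, Complex.mul_im]; ring
    have h1 : (ρ p).re ^ 2 + (ρ p).im ^ 2 = 1 := by
      have h2 := e6 p hp
      rw [hC, hS] at h2
      have h3 : ((ρ p).re ^ 2 + (ρ p).im ^ 2) ^ 2 = 1 := by linear_combination h2
      exact (pow_eq_one_iff_of_nonneg (by positivity) two_ne_zero).1 h3
    refine ⟨?_, ?_⟩
    · rw [Matrix.det_fin_two_of]
      linear_combination h1
    · have a1 := e1 p
      have a2 := e2 p
      rw [hC, hS] at a1 a2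
      set c := (ρ p).re
      set t := (ρ p).im
      ext i j
      fin_cases i <;> fin_cases j <;>
        simp [Matrix.mul_apply, Fin.sum_univ_two, matK, e3 p hp, e4, e5, a1, a2]
      · linear_combination (-c - s p * t) * h1
      · linear_combination (-t * (1 + s p ^ 2)) * h1
      · linear_combination (-t + s p * c) * h1
      · linear_combination (c * (1 + s p ^ 2)) * h1

theorem fderiv_mulB {E : Type} [NormedAddCommGroup E] [NormedSpace ℝ E] {F G : E → BMat} {p : E}
    (hF : DifferentiableAt ℝ F p) (hG : DifferentiableAt ℝ G p) (v : E) :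
    fderiv ℝ (fun q => F q * G q) p v = F p * fderiv ℝ G p v + fderiv ℝ F p v * G p := by
  have h := HasFDerivAt.mul' hF.hasFDerivAt hG.hasFDerivAt
  exact congrArg (fun T : E →L[ℝ] BMat => T v) (HasFDerivAt.fderiv h)

/-- From f = φ 𝐤' φ⁻¹ one gets φ⁻¹ (∂f) φ = [W, 𝐤']. Hence -(1/2) f ∂f, seen in the frame, is the
projection of W to the (-1)-eigenspace of Ad 𝐤', the 𝔪-part of W. -/
theorem halfLog_eq_of_frame {U : Set Plane} (hU : IsOpen U) {f φ : Plane → BMat} {p : Plane}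
    (hp : p ∈ U) (hfd : DifferentiableAt ℝ f p) (hφd : DifferentiableAt ℝ φ p)
    (hdet : ∀ p ∈ U, detB (φ p) = 1) (hfφ : ∀ p ∈ U, f p * φ p = φ p * kB) {v : Plane} {W : BMat}
    (hW : fderiv ℝ φ p v = φ p * W) :
    adjB (φ p) * halfLog f v p * φ p = (1 / 2 : ℝ) • (W - kB * W * kB) := by
  have hφ1 := mul_adjB (hdet p hp)
  have hφ2 := adjB_mul (hdet p hp)
  have hhl : halfLog f v p = (-(1 / 2) : ℝ) • (f p * fderiv ℝ f p v) := rfl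
  have hf : f p = φ p * kB * adjB (φ p) := by
    rw [← hfφ p hp, mul_assoc, hφ1, mul_one]
  have hdf : fderiv ℝ f p v = φ p * (W * kB - kB * W) * adjB (φ p) := by
    have h1 := fderiv_mulB hfd hφd v
    have h2 := fderiv_mulB hφd (differentiableAt_const kB) v
    have h3 : f p * fderiv ℝ φ p v + fderiv ℝ f p v * φ p = fderiv ℝ φ p v * kB := by
      rw [← h1, Filter.EventuallyEq.fderiv_eq (𝕜 := ℝ)
        (eventually_of_mem (hU.mem_nhds hp) hfφ), h2, fderiv_fun_const]
      simp
    have h5 : fderiv ℝ f p v * φ p = φ p * (W * kB - kB * W) := by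
      rw [eq_sub_of_add_eq' h3, hW, hf]
      have : φ p * kB * adjB (φ p) * (φ p * W) = φ p * kB * (adjB (φ p) * φ p) * W := by
        simp only [mul_assoc]
      rw [this, hφ2]
      noncomm_ring
    rw [← h5, mul_assoc, hφ1, mul_one]
  rw [hhl, hdf, hf, mul_smul_comm, smul_mul_assoc]
  have : adjB (φ p) * (φ p * kB * adjB (φ p) * (φ p * (W * kB - kB * W) * adjB (φ p))) * φ p =
      (adjB (φ p) * φ p) * kB * (adjB (φ p) * φ p) * (W * kB - kB * W) * (adjB (φ p) * φ p) := by
    simp only [mul_assoc]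
  rw [this, hφ2, one_mul, mul_one, mul_one, mul_sub, ← mul_assoc, ← mul_assoc, kB_mul_kB, one_mul]
  module

/-- The Maurer-Cartan components of a frame. -/
theorem exists_frame_components {U : Set Plane} (hU : IsOpen U) {f φ : Plane → BMat}
    (hfs : ContDiffOn ℝ ∞ f U) (hφs : ContDiffOn ℝ ∞ φ U)
    (hφr : ∀ p ∈ U, conjB (φ p) = φ p) (hdet : ∀ p ∈ U, detB (φ p) = 1)
    (hfφ : ∀ p ∈ U, f p * φ p = φ p * kB) {p : Plane} (hp : p ∈ U)
    (v : Plane) : ∃ A ∈ kPart, ∃ B ∈ mPart, realB B = adjB (φ p) * halfLog f v p * φ p ∧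
      realB A = adjB (φ p) * fderiv ℝ φ p v - realB B := by
  have hfd : DifferentiableAt ℝ f p := (hfs.contDiffAt (hU.mem_nhds hp)).differentiableAt (by simp)
  have hφd : DifferentiableAt ℝ φ p := (hφs.contDiffAt (hU.mem_nhds hp)).differentiableAt (by simp)
  have r2 : conjB (fderiv ℝ φ p v) = fderiv ℝ φ p v := fderiv_eq_of_map_eq hU conjB hφr hp hφd v
  obtain ⟨W, hW⟩ : ∃ W, W = adjB (φ p) * fderiv ℝ φ p v := ⟨_, rfl⟩
  have hB := halfLog_eq_of_frame hU hp hfd hφd hdet hfφ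
    ((eq_mul_of_adjB_mul (hdet p hp)).1 hW.symm)
  have hWr : conjB W = W := by rw [hW, conjB_mul, conjB_adjB, hφr p hp, r2]
  have hBr : conjB (adjB (φ p) * halfLog f v p * φ p) = adjB (φ p) * halfLog f v p * φ p := by
    rw [hB, map_smul, map_sub, conjB_mul, conjB_mul, conjB_kB, hWr]
  obtain ⟨B, hBB⟩ := exists_realB hBr
  have hAr : conjB (W - realB B) = W - realB B := by rw [map_sub, conjB_realB, hWr]
  obtain ⟨A, hAA⟩ := exists_realB hAr
  have kk : kB * (kB * W * kB) * kB = W := by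
    calc _ = (kB * kB) * W * (kB * kB) := by simp only [mul_assoc]
      _ = _ := by rw [kB_mul_kB, one_mul, mul_one]
  have hBk : kB * realB B * kB = -realB B := by
    rw [hBB, hB, mul_smul_comm, smul_mul_assoc, mul_sub, sub_mul, kk]
    module
  have hBm := mem_mPart_of_mul_kB hBk
  refine ⟨A, mem_kPart_of_mul_kB ?_ ?_, B, hBm, hBB, hAA.trans (by rw [hW])⟩
  · rw [hAA, mul_sub, sub_mul, hBk, hBB, hB]
    module
  · have ht := trace_adjB_mul_fderiv hU hdet hp hφd v
    rw [mem_mPart_iff] at hBm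
    rw [hAA, hW, map_sub, map_sub, entryB_realB, entryB_realB, hBm.1, hBm.2]
    simpa using ht

theorem fderiv_mul_of_solvesAt_assocForm {M : Type} [NormedRing M] [NormedAlgebra ℂ M]
    [CompleteSpace M] {f F G : Plane → M} {z : ℂ} {p : Plane}
    (h : SolvesAt (assocForm f z) F p) (hG : DifferentiableAt ℝ G p) :
    fderiv ℝ (fun q => F q * G q) p (1, 0) =
      F p * fderiv ℝ G p (1, 0) + (z - 1) • (F p * halfLog f (1, 0) p * G p) ∧
    fderiv ℝ (fun q => F q * G q) p (0, 1) =
      F p * fderiv ℝ G p (0, 1) + (z⁻¹ - 1) • (F p * halfLog f (0, 1) p * G p) := by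
  have h1 := HasFDerivAt.mul' h hG.hasFDerivAt
  have h2 : ∀ v, fderiv ℝ (fun q => F q * G q) p v =
      F p * fderiv ℝ G p v + F p * assocForm f z p v * G p := fun v => by
    rw [HasFDerivAt.fderiv (f := fun q => F q * G q) h1]; rfl
  constructor <;> rw [h2, assocForm, coordForm_apply] <;> simp

theorem one_mul_assocForm_one {M : Type} [NormedRing M] [NormedAlgebra ℂ M]
    [CompleteSpace M] (f : Plane → M) (q v : Plane) : 1 * assocForm f 1 q v = 0 := by
  rw [assocForm, coordForm_apply]
  simp

/-- X is the associated family, Y the frame, T the derivative of Y and H the form -(1/2) f ∂f. Then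
Y⁻¹ T = A + B and Y⁻¹ H Y = B, so adding (z - 1) B gives A + z B. -/
theorem frame_mul_identity {Y T H A B : BMat} (hY : Y * adjB Y = 1) (hB : B = adjB Y * H * Y)
    (hA : A = adjB Y * T - B) (z : ℂ) (X : BMat) :
    X * Y * (A + z • B) = X * T + (z - 1) • (X * H * Y) := by
  have e : X * Y * (adjB Y * T - adjB Y * H * Y + z • (adjB Y * H * Y)) =
      X * (Y * adjB Y) * T + (z - 1) • (X * (Y * adjB Y) * H * Y) := by
    simp only [mul_add, mul_sub, mul_smul_comm, mul_assoc]
    module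
  rw [hA, hB, e, hY, mul_one]

/-- The framing is the associated family times the classical frame: the frame turns the family's
connection form into the required shape. -/
theorem exists_isFramingB {D : Set Plane} (hD : IsOpen D) [SimplyConnectedSpace D]
    (h0 : ((0, 0) : Plane) ∈ D) {ψ : Plane → MatR} (h : IsHarmonicMap D ψ) (hψ0 : ψ (0, 0) = matK) :
    ∃ P, IsFramingB D ψ P := by
  have hconn : IsPreconnected D := isPreconnected_iff_preconnectedSpace.2 inferInstance
  have hinv := isHarmonicInvolution_realB hD h
  obtain ⟨F, hFs, hFhol, hF⟩ := exists_associatedFamily hD h0 hinv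
  obtain ⟨Φ, hΦs, hΦ0, hΦ⟩ := exists_frame hD h0 h.smooth h.mem hψ0
  have hφs := isSmoothOn_real_iff.1 hΦs
  have hφd : ∀ p ∈ D, DifferentiableAt ℝ (fun q => realB (Φ q)) p := fun p hp =>
    (hφs.contDiffAt (hD.mem_nhds hp)).differentiableAt (by simp)
  have hdet : ∀ p ∈ D, detB (realB (Φ p)) = 1 := fun p hp => by
    have := (hΦ p hp).1
    rw [Matrix.det_fin_two] at this
    rw [detB_eq]
    simp only [entryB_realB]
    exact_mod_cast this
  have hfφ : ∀ p ∈ D, realB (ψ p) * realB (Φ p) = realB (Φ p) * kB := fun p hp => by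
    rw [← realB_mul, (hΦ p hp).2, realB_mul]; rfl
  have hcomp : ∀ v p, ∃ A B : MatR, p ∈ D → A ∈ kPart ∧ B ∈ mPart ∧
      realB B = adjB (realB (Φ p)) * halfLog (fun q => realB (ψ q)) v p * realB (Φ p) ∧
      realB A = adjB (realB (Φ p)) * fderiv ℝ (fun q => realB (Φ q)) p v - realB B := by
    intro v p
    by_cases hp : p ∈ D
    · obtain ⟨A, hA, B, hB, h1, h2⟩ := exists_frame_components hD hinv.smooth hφs
        (fun _ _ => conjB_realB _) hdet hfφ hp v
      exact ⟨A, B, fun _ => ⟨hA, hB, h1, h2⟩⟩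
    · exact ⟨0, 0, fun h => absurd h hp⟩
  choose A B hAB using hcomp
  have hmc : ∀ p ∈ D, A (1, 0) p ∈ kPart ∧ B (1, 0) p ∈ mPart ∧ A (0, 1) p ∈ kPart ∧
      B (0, 1) p ∈ mPart ∧ ∀ z, z ≠ 0 →
      SolvesAt (mcForm (A (1, 0)) (B (1, 0)) (A (0, 1)) (B (0, 1)) z)
        (fun q => F q z * realB (Φ q)) p := by
    intro p hp
    obtain ⟨x1, x2, x3, x4⟩ := hAB (1, 0) p hp
    obtain ⟨y1, y2, y3, y4⟩ := hAB (0, 1) p hp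
    refine ⟨x1, x2, y1, y2, fun z hz => ?_⟩
    have hφ1 := mul_adjB (hdet p hp)
    have h1 : DifferentiableAt ℝ (fun q => F q z * realB (Φ q)) p :=
      ((hF z hz).2 p hp).2.differentiableAt.mul (hφd p hp)
    obtain ⟨h2, h3⟩ := fderiv_mul_of_solvesAt_assocForm ((hF z hz).2 p hp).2 (hφd p hp)
    refine (solvesAt_coordForm_iff (F := fun q => F q z * realB (Φ q)) h1).2
      ⟨h2.trans ?_, h3.trans ?_⟩
    · exact (frame_mul_identity hφ1 x3 x4 _ _).symm
    · exact (frame_mul_identity hφ1 y3 y4 _ _).symm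
  have hbase : ∀ z, z ≠ 0 → F (0, 0) z * realB (Φ (0, 0)) = 1 := fun z hz => by
    rw [(hF z hz).1, hΦ0, realB_one, one_mul]
  refine ⟨fun p z => F p z * realB (Φ p), hFs.mul ?_, fun p hp => ?_, hbase,
    ⟨_, _, _, _, hmc⟩, fun p hp => ?_⟩
  · exact hφs.comp contDiffOn_fst fun q hq => hq.1
  · exact isLoop_of_solvesAt hD hconn h0 (fun p hp => (hFhol p hp).mul_const _)
      (fun p hp z hz => ((hF z hz).2 p hp).1.mul (isUnit_of_detB (hdet p hp))) hbase hmc hp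
  · have hF1 : F p 1 = 1 := by
      refine SolvesAt.eq_of_eq (F := fun q => F q 1) (G := fun _ => 1) hD hconn
        (fun q hq => ((hF 1 one_ne_zero).2 q hq).2) (fun q hq => ?_) (fun _ _ => isUnit_one) h0
        (hF 1 one_ne_zero).1 hp
      refine (hasFDerivAt_const (1 : BMat) q).congr_fderiv (ContinuousLinearMap.ext fun v => ?_)
      exact (one_mul_assocForm_one _ q v).symm
    rw [hF1, one_mul, hfφ p hp]

/-! ### Logarithmic derivatives -/

theorem hasFDerivAt_adjB {E : Type} [NormedAddCommGroup E] [NormedSpace ℝ E] {F : E → BMat} {p : E}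
    (hF : DifferentiableAt ℝ F p) :
    HasFDerivAt (fun q => adjB (F q)) ((adjB.restrictScalars ℝ).comp (fderiv ℝ F p)) p :=
  (adjB.restrictScalars ℝ).hasFDerivAt.comp p hF.hasFDerivAt

theorem fderiv_mul_adjB {E : Type} [NormedAddCommGroup E] [NormedSpace ℝ E] {U : Set E}
    (hU : IsOpen U) {F G : E → BMat} (hdet : ∀ q ∈ U, detB (G q) = 1) {p : E} (hp : p ∈ U)
    (hF : DifferentiableAt ℝ F p) (hG : DifferentiableAt ℝ G p) {v : E} {X Y : BMat}
    (hX : fderiv ℝ F p v = F p * X) (hY : fderiv ℝ G p v = G p * Y) :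
    fderiv ℝ (fun q => F q * adjB (G q)) p v = F p * (X - Y) * adjB (G p) := by
  have hA : DifferentiableAt ℝ (fun q => adjB (G q)) p := (hasFDerivAt_adjB hG).differentiableAt
  have h1 := fderiv_mulB hG hA v
  have h2 : fderiv ℝ (fun q => G q * adjB (G q)) p = 0 := by
    rw [Filter.EventuallyEq.fderiv_eq (𝕜 := ℝ) (eventually_of_mem (hU.mem_nhds hp)
      fun q hq => mul_adjB (hdet q hq)), fderiv_fun_const]
    rfl
  rw [h2, hY] at h1
  have h3 : fderiv ℝ (fun q => adjB (G q)) p v = -(Y * adjB (G p)) := by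
    have h4 := congrArg (adjB (G p) * ·) h1
    simp only [mul_add, ← mul_assoc, adjB_mul (hdet p hp), one_mul] at h4
    rw [eq_neg_iff_add_eq_zero, ← h4]
    simp
  rw [fderiv_mulB hF hA, h3, hX]
  noncomm_ring

/-! ### Uniqueness of extended framings up to gauge -/

theorem IsFramingB.det {U : Set Plane} {ψ : Plane → MatR} {P : Plane → ℂ → BMat}
    (h : IsFramingB U ψ P) {p : Plane} (hp : p ∈ U) {z : ℂ} (hz : z ≠ 0) : detB (P p z) = 1 :=
  (h.loop p hp).det z hz

theorem IsFramingB.differentiableAt {U : Set Plane} (hU : IsOpen U) {ψ : Plane → MatR}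
    {P : Plane → ℂ → BMat}
    (h : IsFramingB U ψ P) {p : Plane} (hp : p ∈ U) {z : ℂ} (hz : z ≠ 0) :
    DifferentiableAt ℝ (fun q => P q z) p :=
  h.smooth.differentiableAt hU hp hz

theorem solvesAt_assocForm {M : Type} [NormedRing M] [NormedAlgebra ℂ M]
    [CompleteSpace M] {f F : Plane → M} {z : ℂ} {p : Plane} (hF : DifferentiableAt ℝ F p)
    (h1 : fderiv ℝ F p (1, 0) = (z - 1) • (F p * halfLog f (1, 0) p))
    (h2 : fderiv ℝ F p (0, 1) = (z⁻¹ - 1) • (F p * halfLog f (0, 1) p)) :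
    SolvesAt (assocForm f z) F p := by
  refine (solvesAt_coordForm_iff hF).2 ⟨?_, ?_⟩
  · rw [h1]; simp
  · rw [h2]; simp

/-- Division by the value at z = 1 removes the gauge freedom: the 𝔨-parts cancel, and what remains
is an equation that only involves ψ. -/
theorem IsFramingB.solvesAt_mul_adjB {U : Set Plane} (hU : IsOpen U) {ψ : Plane → MatR}
    {P : Plane → ℂ → BMat} (h : IsFramingB U ψ P) {p : Plane} (hp : p ∈ U) {z : ℂ} (hz : z ≠ 0) :
    SolvesAt (assocForm (fun q => realB (ψ q)) z) (fun q => P q z * adjB (P q 1)) p := by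
  obtain ⟨A, B, C, E, hmc⟩ := h.mc
  obtain ⟨hA, hB, hC, hE, hs⟩ := hmc p hp
  have hdet : ∀ q ∈ U, detB (P q 1) = 1 := fun q hq => h.det hq one_ne_zero
  have hd := h.differentiableAt hU hp hz
  have hd1 := h.differentiableAt hU hp one_ne_zero
  have hda : DifferentiableAt ℝ (fun q => adjB (P q 1)) p := (hasFDerivAt_adjB hd1).differentiableAt
  have hdm : DifferentiableAt ℝ (fun q => P q z * adjB (P q 1)) p :=
    (HasFDerivAt.mul' hd.hasFDerivAt hda.hasFDerivAt).differentiableAt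
  have hfd : DifferentiableAt ℝ (fun q => realB (ψ q)) p := by
    have h1 : DifferentiableAt ℝ (fun q => P q 1 * kB * adjB (P q 1)) p :=
      (HasFDerivAt.mul' (HasFDerivAt.mul' hd1.hasFDerivAt
        (hasFDerivAt_const kB p)) hda.hasFDerivAt).differentiableAt
    refine h1.congr_of_eventuallyEq (eventually_of_mem (hU.mem_nhds hp) fun q hq => ?_)
    change realB (ψ q) = P q 1 * kB * adjB (P q 1)
    rw [← h.framing q hq, mul_assoc, mul_adjB (hdet q hq), mul_one]
  have key : ∀ (v : Plane) (w : ℂ) (X Y : MatR), X ∈ kPart → Y ∈ mPart →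
      fderiv ℝ (fun q => P q z) p v = P p z * (realB X + w • realB Y) →
      fderiv ℝ (fun q => P q 1) p v = P p 1 * (realB X + realB Y) →
      fderiv ℝ (fun q => P q z * adjB (P q 1)) p v =
        (w - 1) • (P p z * adjB (P p 1) * halfLog (fun q => realB (ψ q)) v p) := by
    intro v w X Y hX hY e1 e2
    have e3 := halfLog_eq_of_frame hU hp hfd hd1 hdet h.framing e2
    have e4 : (1 / 2 : ℝ) • (realB X + realB Y - kB * (realB X + realB Y) * kB) = realB Y := by
      rw [mul_add, add_mul, mul_kB_of_mem_kPart hX, mul_kB_of_mem_mPart hY]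
      module
    rw [e4] at e3
    have e5 : halfLog (fun q => realB (ψ q)) v p * P p 1 = P p 1 * realB Y :=
      (eq_mul_of_adjB_mul (hdet p hp)).1 (by rw [← mul_assoc]; exact e3)
    have e6 : halfLog (fun q => realB (ψ q)) v p = P p 1 * realB Y * adjB (P p 1) := by
      rw [← e5, mul_assoc, mul_adjB (hdet p hp), mul_one]
    rw [fderiv_mul_adjB hU hdet hp hd hd1 e1 e2, e6]
    have e7 : P p z * adjB (P p 1) * (P p 1 * realB Y * adjB (P p 1)) =
        P p z * (adjB (P p 1) * P p 1) * realB Y * adjB (P p 1) := by simp only [mul_assoc]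
    rw [e7, adjB_mul (hdet p hp), mul_one]
    have e8 : realB X + w • realB Y - (realB X + realB Y) = (w - 1) • realB Y := by module
    rw [e8, mul_smul_comm, smul_mul_assoc]
  have h1 := (solvesAt_coordForm_iff hd).1 (hs z hz)
  have h2 := (solvesAt_coordForm_iff hd1).1 (hs 1 one_ne_zero)
  simp only [one_smul, inv_one] at h2
  exact solvesAt_assocForm hdm (key _ _ _ _ hA hB h1.1 h2.1) (key _ _ _ _ hC hE h1.2 h2.2)

/-- Two extended framings of the same map differ by a map that does not depend on the loop
parameter. -/
theorem IsFramingB.eq_mul {U : Set Plane} (hU : IsOpen U) (hc : IsPreconnected U)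
    (h0 : ((0, 0) : Plane) ∈ U) {ψ : Plane → MatR} {P P' : Plane → ℂ → BMat}
    (h : IsFramingB U ψ P) (h' : IsFramingB U ψ P') {p : Plane} (hp : p ∈ U) {z : ℂ} (hz : z ≠ 0) :
    P' p z = P p z * (adjB (P p 1) * P' p 1) := by
  have key : P' p z * adjB (P' p 1) = P p z * adjB (P p 1) := by
    refine SolvesAt.eq_of_eq (F := fun q => P' q z * adjB (P' q 1))
      (G := fun q => P q z * adjB (P q 1)) hU hc (fun q hq => h'.solvesAt_mul_adjB hU hq hz)
      (fun q hq => h.solvesAt_mul_adjB hU hq hz) (fun q hq => isUnit_of_detB ?_) h0 ?_ hp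
    · rw [detB_mul, detB_adjB, h.det hq hz, h.det hq one_ne_zero, one_mul]
    · rw [h.base z hz, h'.base z hz, h.base 1 one_ne_zero, h'.base 1 one_ne_zero]
  rw [← mul_assoc, ← key, mul_assoc, adjB_mul (h'.det hp one_ne_zero), mul_one]

theorem mul_realB_comm_of_kPart {A : MatR} (hA : A ∈ kPart) {X : BMat} (hX : X * kB = kB * X) :
    X * realB A = realB A * X := by
  rw [kPart, Submodule.mem_span_singleton] at hA
  obtain ⟨a, rfl⟩ := hA
  rw [realB_real_smul, mul_smul_comm, smul_mul_assoc]
  exact congrArg (a • ·) hX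

/-- Gauge transformations of extended framings. -/
theorem IsFramingB.mul_right {U : Set Plane} (hU : IsOpen U) {ψ : Plane → MatR}
    {P : Plane → ℂ → BMat} (h : IsFramingB U ψ P) {κ : Plane → BMat} (hκ : ContDiffOn ℝ ∞ κ U)
    (hr : ∀ p ∈ U, conjB (κ p) = κ p) (hdet : ∀ p ∈ U, detB (κ p) = 1)
    (hk : ∀ p ∈ U, κ p * kB = kB * κ p) (h0 : κ (0, 0) = 1) :
    IsFramingB U ψ (fun p z => P p z * κ p) := by
  have hκd : ∀ p ∈ U, DifferentiableAt ℝ κ p := fun p hp =>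
    (hκ.contDiffAt (hU.mem_nhds hp)).differentiableAt (by simp)
  have hJ : JointSmooth U (fun p _ => κ p) := hκ.comp contDiffOn_fst fun q hq => hq.1
  obtain ⟨A, B, C, E, hmc⟩ := h.mc
  have hkp : ∀ p ∈ U, kB * κ p * kB = κ p := fun p hp => by
    rw [mul_assoc, hk p hp, ← mul_assoc, kB_mul_kB, one_mul]
  have hkap : ∀ p ∈ U, kB * adjB (κ p) * kB = adjB (κ p) := fun p hp => by
    rw [← adjB_kB_mul_mul, hkp p hp]
  have hA : ∀ (v : Plane) (p : Plane), ∃ K : MatR, p ∈ U → K ∈ kPart ∧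
      realB K = adjB (κ p) * fderiv ℝ κ p v := by
    intro v p
    by_cases hp : p ∈ U
    · have h1 : conjB (fderiv ℝ κ p v) = fderiv ℝ κ p v :=
        fderiv_eq_of_map_eq hU conjB hr hp (hκd p hp) v
      have h2 : conjB (adjB (κ p) * fderiv ℝ κ p v) = adjB (κ p) * fderiv ℝ κ p v := by
        rw [conjB_mul, conjB_adjB, hr p hp]
        exact congrArg (adjB (κ p) * ·) h1
      obtain ⟨K, hK⟩ := exists_realB h2
      refine ⟨K, fun _ => ⟨mem_kPart_of_mul_kB ?_ ?_, hK⟩⟩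
      · let T : BMat →L[ℝ] BMat := ((ContinuousLinearMap.mul ℝ BMat).flip kB).comp
          (ContinuousLinearMap.mul ℝ BMat kB)
        have h3 : kB * fderiv ℝ κ p v * kB = fderiv ℝ κ p v :=
          fderiv_eq_of_map_eq hU T hkp hp (hκd p hp) v
        rw [hK]
        calc kB * (adjB (κ p) * fderiv ℝ κ p v) * kB
            = kB * adjB (κ p) * 1 * fderiv ℝ κ p v * kB := by simp only [mul_assoc, one_mul]
          _ = (kB * adjB (κ p) * kB) * (kB * fderiv ℝ κ p v * kB) := by
            rw [← kB_mul_kB]; simp only [mul_assoc]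
          _ = _ := by rw [hkap p hp, h3]
      · rw [hK]
        exact trace_adjB_mul_fderiv hU hdet hp (hκd p hp) v
    · exact ⟨0, fun h => absurd h hp⟩
  have hB : ∀ (B : Plane → MatR) (p : Plane), ∃ K : MatR, p ∈ U → B p ∈ mPart → K ∈ mPart ∧
      realB K = adjB (κ p) * realB (B p) * κ p := by
    intro B p
    by_cases hp : p ∈ U
    · have h2 : conjB (adjB (κ p) * realB (B p) * κ p) = adjB (κ p) * realB (B p) * κ p := by
        rw [conjB_mul, conjB_mul, conjB_adjB, hr p hp, conjB_realB]
      obtain ⟨K, hK⟩ := exists_realB h2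
      refine ⟨K, fun _ hB => ⟨mem_mPart_of_mul_kB ?_, hK⟩⟩
      rw [hK]
      calc kB * (adjB (κ p) * realB (B p) * κ p) * kB
          = kB * adjB (κ p) * 1 * realB (B p) * 1 * κ p * kB := by
            simp only [mul_assoc, one_mul]
        _ = (kB * adjB (κ p) * kB) * (kB * realB (B p) * kB) * (kB * κ p * kB) := by
            rw [← kB_mul_kB]; simp only [mul_assoc]
        _ = _ := by rw [hkap p hp, hkp p hp, mul_kB_of_mem_mPart hB, mul_neg, neg_mul]
    · exact ⟨0, fun h => absurd h hp⟩
  -- A' is κ⁻¹ ∂κ, which lies in 𝔨, and B' is κ⁻¹ B κ, which lies in 𝔪. The old 𝔨-part is unchanged,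
  -- since κ commutes with 𝐤' and 𝔨 is spanned by 𝐤'.
  choose A' hA' using hA
  choose B' hB' using hB
  have key : ∀ p ∈ U, ∀ z, z ≠ 0 → ∀ (v : Plane) (w : ℂ) (X : MatR) (Y : Plane → MatR),
      X ∈ kPart → Y p ∈ mPart → fderiv ℝ (fun q => P q z) p v = P p z * (realB X + w • realB (Y p)) →
      fderiv ℝ (fun q => P q z * κ q) p v =
        P p z * κ p * (realB (X + A' v p) + w • realB (B' Y p)) := by
    intro p hp z hz v w X Y hX hY e
    rw [fderiv_mulB (h.differentiableAt hU hp hz) (hκd p hp), e, realB_add, (hA' v p hp).2,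
      (hB' Y p hp hY).2]
    have e1 := mul_realB_comm_of_kPart hX (hk p hp)
    have e2 : P p z * κ p * (realB X + adjB (κ p) * fderiv ℝ κ p v +
        w • (adjB (κ p) * realB (Y p) * κ p)) = P p z * (κ p * realB X) +
        P p z * (κ p * adjB (κ p)) * fderiv ℝ κ p v +
        w • (P p z * (κ p * adjB (κ p)) * realB (Y p) * κ p) := by
      simp only [mul_add, mul_smul_comm, mul_assoc]
    rw [e2, mul_adjB (hdet p hp), e1]
    simp only [mul_add, add_mul, mul_smul_comm, smul_mul_assoc, mul_assoc, one_mul]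
    abel
  have hloop : ∀ p ∈ U, IsLoop (fun _ => κ p) := fun p hp =>
    ⟨differentiableOn_const _, fun _ _ => (hr p hp).symm, fun _ _ => hdet p hp,
      fun _ _ => hkp p hp⟩
  refine ⟨h.smooth.mul hJ, fun p hp => (h.loop p hp).mul (hloop p hp), fun z hz => ?_,
    ⟨fun p => A p + A' (1, 0) p, B' B, fun p => C p + A' (0, 1) p, B' E, fun p hp => ?_⟩,
    fun p hp => ?_⟩
  · rw [h.base z hz, h0, one_mul]
  · obtain ⟨x1, x2, x3, x4, hs⟩ := hmc p hp
    refine ⟨add_mem x1 (hA' _ p hp).1, (hB' B p hp x2).1, add_mem x3 (hA' _ p hp).1,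
      (hB' E p hp x4).1, fun z hz => ?_⟩
    obtain ⟨e1, e2⟩ := (solvesAt_coordForm_iff (h.differentiableAt hU hp hz)).1 (hs z hz)
    have hd : DifferentiableAt ℝ (fun q => P q z * κ q) p :=
      (HasFDerivAt.mul' (h.differentiableAt hU hp hz).hasFDerivAt
        (hκd p hp).hasFDerivAt).differentiableAt
    exact (solvesAt_coordForm_iff (F := fun q => P q z * κ q) hd).2
      ⟨key p hp z hz _ _ _ _ x1 x2 e1, key p hp z hz _ _ _ _ x3 x4 e2⟩
  · rw [← mul_assoc, h.framing p hp, mul_assoc, ← hk p hp, mul_assoc]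

/-! ### Derivatives of holomorphic families -/

section HolomorphicFamilies

variable {E M : Type} [NormedAddCommGroup E] [NormedSpace ℝ E] [NormedAddCommGroup M]
  [NormedSpace ℂ M]

/-- Parameter derivatives of a smooth family of holomorphic functions are holomorphic. -/
theorem differentiableOn_fderiv_family {U : Set E} {Ω : Set ℂ} (hU : IsOpen U) (hΩ : IsOpen Ω)
    {f : E → ℂ → M} (hf : ContDiffOn ℝ ∞ (fun q : E × ℂ => f q.1 q.2) (U ×ˢ Ω))
    (hhol : ∀ p ∈ U, DifferentiableOn ℂ (f p) Ω) {p : E} (hp : p ∈ U) (v : E) :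
    DifferentiableOn ℂ (fun z => fderiv ℝ (fun q => f q z) p v) Ω := by
  have hUΩ : IsOpen (U ×ˢ Ω) := hU.prod hΩ
  have hd : ∀ q ∈ U, ∀ z ∈ Ω, DifferentiableAt ℝ (fun q : E × ℂ => f q.1 q.2) (q, z) :=
    fun q hq z hz => (hf.contDiffAt (hUΩ.mem_nhds ⟨hq, hz⟩)).differentiableAt (by simp)
  have h1 : ∀ q ∈ U, ∀ z ∈ Ω, ∀ w : E, fderiv ℝ (fun q => f q z) q w =
      fderiv ℝ (fun q : E × ℂ => f q.1 q.2) (q, z) (w, 0) := by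
    intro q hq z hz w
    have h2 : HasFDerivAt (fun q : E => (q, z)) (ContinuousLinearMap.inl ℝ E ℂ) q :=
      hasFDerivAt_prodMk_left q z
    have h3 := (hd q hq z hz).hasFDerivAt.comp q h2
    rw [HasFDerivAt.fderiv (f := fun q => f q z) h3]
    rfl
  have h4 : ∀ q ∈ U, ∀ z ∈ Ω, ∀ w : ℂ, fderiv ℝ (fun q : E × ℂ => f q.1 q.2) (q, z) (0, w) =
      w • deriv (f q) z := by
    intro q hq z hz w
    have h2 : HasFDerivAt (fun z : ℂ => (q, z)) (ContinuousLinearMap.inr ℝ E ℂ) z :=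
      hasFDerivAt_prodMk_right q z
    have h3 := (hd q hq z hz).hasFDerivAt.comp z h2
    have h5 := (((hhol q hq).differentiableAt (hΩ.mem_nhds hz)).hasDerivAt.hasFDerivAt).restrictScalars ℝ
    have h6 := congrArg (fun T : ℂ →L[ℝ] M => T w) (h3.unique h5)
    simpa using h6
  intro z hz
  refine DifferentiableAt.differentiableWithinAt ?_
  have hsm : ContDiffOn ℝ ∞ (fun q => fderiv ℝ (fun q : E × ℂ => f q.1 q.2) q (v, 0)) (U ×ˢ Ω) :=
    contDiffOn_fderiv_apply hUΩ hf _
  have hsd : DifferentiableAt ℝ (fun q => fderiv ℝ (fun q : E × ℂ => f q.1 q.2) q (v, 0)) (p, z) :=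
    (hsm.contDiffAt (hUΩ.mem_nhds ⟨hp, hz⟩)).differentiableAt (by simp)
  have h2 : HasFDerivAt (fun z : ℂ => (p, z)) (ContinuousLinearMap.inr ℝ E ℂ) z :=
    hasFDerivAt_prodMk_right p z
  have h3 := (hsd.hasFDerivAt.comp z h2).congr_of_eventuallyEq
    (f₁ := fun z => fderiv ℝ (fun q => f q z) p v)
    (eventually_of_mem (hΩ.mem_nhds hz) fun w hw => h1 p hp w hw v)
  rw [differentiableAt_complex_iff_differentiableAt_real]
  refine ⟨h3.differentiableAt, ?_⟩
  -- Exchanging the parameter derivative with the z-derivative shows that the real differential in z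
  -- is complex linear, which is the Cauchy-Riemann condition.
  have key : ∀ w : ℂ, fderiv ℝ (fun z => fderiv ℝ (fun q => f q z) p v) z w =
      w • fderiv ℝ (fun q => deriv (f q) z) p v := by
    intro w
    rw [h3.fderiv]
    change fderiv ℝ (fun q => fderiv ℝ (fun q : E × ℂ => f q.1 q.2) q (v, 0)) (p, z) (0, w) = _
    rw [fderiv_fderiv_comm hUΩ hf ⟨hp, hz⟩]
    have hsw : DifferentiableAt ℝ (fun q => fderiv ℝ (fun q : E × ℂ => f q.1 q.2) q (0, w)) (p, z) :=
      ((contDiffOn_fderiv_apply hUΩ hf _).contDiffAt (hUΩ.mem_nhds ⟨hp, hz⟩)).differentiableAt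
        (by simp)
    have hs1 : DifferentiableAt ℝ
        (fun q => fderiv ℝ (fun q : E × ℂ => f q.1 q.2) q (0, (1 : ℂ))) (p, z) :=
      ((contDiffOn_fderiv_apply hUΩ hf _).contDiffAt (hUΩ.mem_nhds ⟨hp, hz⟩)).differentiableAt
        (by simp)
    have h5 : HasFDerivAt (fun q : E => (q, z)) (ContinuousLinearMap.inl ℝ E ℂ) p :=
      hasFDerivAt_prodMk_left p z
    have h6 := (hs1.hasFDerivAt.comp p h5).congr_of_eventuallyEq (f₁ := fun q => deriv (f q) z)
      (eventually_of_mem (hU.mem_nhds hp) fun q hq => by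
        have := h4 q hq z hz 1
        rw [one_smul] at this
        exact this.symm)
    have h7 := (hsw.hasFDerivAt.comp p h5).congr_of_eventuallyEq (f₁ := fun q => w • deriv (f q) z)
      (eventually_of_mem (hU.mem_nhds hp) fun q hq => (h4 q hq z hz w).symm)
    have h8 := h6.const_smul w
    have h9 := congrArg (fun T : E →L[ℝ] M => T v) (h7.unique h8)
    rw [h6.fderiv]
    exact h9
  rw [key, key, one_smul]

/-- Extension of a smooth family across the origin. -/
theorem JointSmooth.exists_extension [CompleteSpace M] [FiniteDimensional ℝ E] {V : Set E}
    (hV : IsOpen V) {f : E → ℂ → M}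
    (hf : JointSmooth V f) (hhol : ∀ p ∈ V, DifferentiableOn ℂ (f p) {0}ᶜ)
    (hlim : ∀ p ∈ V, ∃ x, LimAt (f p) x) :
    ∃ g : E → ℂ → M, ContDiffOn ℝ ∞ (fun q : E × ℂ => g q.1 q.2) (V ×ˢ univ) ∧
      (∀ p ∈ V, Differentiable ℂ (g p)) ∧ (∀ p ∈ V, ∀ z, z ≠ 0 → g p z = f p z) ∧
      ∀ p ∈ V, LimAt (f p) (g p 0) := by
  have h : ∀ p, ∃ g : ℂ → M, p ∈ V → Differentiable ℂ g ∧ (∀ z, z ≠ 0 → g z = f p z) ∧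
      LimAt (f p) (g 0) := by
    intro p
    by_cases hp : p ∈ V
    · obtain ⟨x, hx⟩ := hlim p hp
      obtain ⟨g, h1, h2, h3⟩ := exists_entire (hhol p hp) hx
      exact ⟨g, fun _ => ⟨h1, h2, h3 ▸ hx⟩⟩
    · exact ⟨0, fun h => absurd h hp⟩
  choose g hg using h
  exact ⟨g, contDiffOn_of_limAt hV hf (fun p hp => (hg p hp).1) fun p hp => (hg p hp).2.1,
    fun p hp => (hg p hp).1, fun p hp => (hg p hp).2.1, fun p hp => (hg p hp).2.2⟩

end HolomorphicFamilies

theorem LimAt.eq {M : Type} [TopologicalSpace M] [T2Space M] {γ : ℂ → M} {x y : M}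
    (h : LimAt γ x) (h' : LimAt γ y) : x = y :=
  tendsto_nhds_unique h h'

theorem Continuous.limAt {M : Type} [TopologicalSpace M] {γ : ℂ → M} (h : Continuous γ) :
    LimAt γ (γ 0) :=
  (h.tendsto 0).mono_left nhdsWithin_le_nhds

/-- If `P = a b` with `a → 1` at `∞` and `P⁻¹ ∂P` has a simple pole at `0`, then `z a⁻¹ ∂a` does not
depend on `z`. -/
theorem logDeriv_of_isNegPos {V : Set Plane} (hV : IsOpen V) {P a b : Plane → ℂ → BMat}
    (ha : JointSmooth V a) (hb : JointSmooth V b)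
    (h : ∀ p ∈ V, IsNegPos (P p) (a p) (b p)) {p : Plane} (hp : p ∈ V) {v : Plane} {Q : BMat}
    (hQ : LimAt (fun z => z • (adjB (P p z) * fderiv ℝ (fun q => P q z) p v)) Q) {b₀ : BMat}
    (hb₀ : LimAt (b p) b₀) {z : ℂ} (hz : z ≠ 0) :
    z • (adjB (a p z) * fderiv ℝ (fun q => a q z) p v) = b₀ * Q * adjB b₀ := by
  obtain ⟨b', hb's, hb'd, hb'e, hb'l⟩ := hb.exists_extension hV
    (fun q hq => (h q hq).right.hol) (fun q hq => (h q hq).lim_right)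
  obtain ⟨a', ha's, ha'd, ha'e, ha'l⟩ := ha.flip.exists_extension hV
    (fun q hq => (h q hq).left.flip.hol) (fun q hq => ⟨1, (h q hq).lim_left⟩)
  have ha'1 : ∀ q ∈ V, a' q 0 = 1 := fun q hq => (ha'l q hq).eq (h q hq).lim_left
  have hca : Continuous fun z => adjB z := adjB.continuous
  have hdb := differentiableOn_fderiv_family hV isOpen_univ hb's
    (fun q hq => (hb'd q hq).differentiableOn) hp v
  have hda := differentiableOn_fderiv_family hV isOpen_univ ha's
    (fun q hq => (ha'd q hq).differentiableOn) hp v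
  rw [differentiableOn_univ] at hdb hda
  have hX := differentiableOn_fderiv_family hV isOpen_compl_singleton ha
    (fun q hq => (h q hq).left.hol) hp v
  -- the limit at zero
  have l0 : LimAt (fun z => z • (adjB (a p z) * fderiv ℝ (fun q => a q z) p v))
      (b₀ * Q * adjB b₀) := by
    -- P = a b gives a⁻¹ ∂a = b (P⁻¹ ∂P) b⁻¹ - (∂b) b⁻¹. The last term has a limit at 0, so the
    -- factor z removes it.
    have e : ∀ z, z ≠ 0 → z • (adjB (a p z) * fderiv ℝ (fun q => a q z) p v) =
        b p z * (z • (adjB (P p z) * fderiv ℝ (fun q => P q z) p v)) * adjB (b p z) -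
        z • (fderiv ℝ (fun q => b' q z) p v * adjB (b p z)) := by
      intro z hz
      have e1 : fderiv ℝ (fun q => P q z) p = fderiv ℝ (fun q => a q z * b q z) p :=
        Filter.EventuallyEq.fderiv_eq (eventually_of_mem (hV.mem_nhds hp)
          fun q hq => (h q hq).eq z hz)
      have e2 : fderiv ℝ (fun q => b' q z) p = fderiv ℝ (fun q => b q z) p :=
        Filter.EventuallyEq.fderiv_eq (eventually_of_mem (hV.mem_nhds hp)
          fun q hq => hb'e q hq z hz)
      have da := (h p hp).left.det z hz
      have db := (h p hp).right.det z hz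
      rw [e1, e2, fderiv_mulB (ha.differentiableAt hV hp hz) (hb.differentiableAt hV hp hz),
        (h p hp).eq z hz, adjB_mul_rev, mul_smul_comm, smul_mul_assoc, ← smul_sub]
      congr 1
      have e3 : b p z * (adjB (b p z) * adjB (a p z) * (a p z * fderiv ℝ (fun q => b q z) p v +
          fderiv ℝ (fun q => a q z) p v * b p z)) * adjB (b p z) =
          (b p z * adjB (b p z)) * (adjB (a p z) * a p z) * fderiv ℝ (fun q => b q z) p v *
            adjB (b p z) +
          (b p z * adjB (b p z)) * (adjB (a p z) * fderiv ℝ (fun q => a q z) p v) *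
            (b p z * adjB (b p z)) := by
        simp only [mul_add, add_mul, mul_assoc]
      rw [e3, mul_adjB db, adjB_mul da]
      simp only [one_mul, mul_one]
      abel
    have h1 := (hb₀.mul hQ).mul ((hca.tendsto b₀).comp hb₀)
    have h2 : LimAt (fun z => fderiv ℝ (fun q => b' q z) p v * adjB (b p z)) _ :=
      Tendsto.mul hdb.continuous.limAt ((hca.tendsto b₀).comp hb₀)
    have h3 := h1.sub (tendsto_smul_zero h2)
    rw [sub_zero] at h3
    exact LimAt.congr h3 e
  -- the limit at infinity
  have l1 : ∃ c, Tendsto (fun z => z⁻¹ • (adjB (a p z⁻¹) * fderiv ℝ (fun q => a q z⁻¹) p v))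
      (𝓝[≠] 0) (𝓝 c) := by
    let G : ℂ → BMat := fun w => adjB (a' p w) * fderiv ℝ (fun q => a' q w) p v
    have hG : Differentiable ℂ G := (adjB.differentiable.comp (ha'd p hp)).mul hda
    -- a' is a in the coordinate 1/z at ∞ and equals 1 there for all parameters, so its parameter
    -- derivative vanishes at 0 and G(w) / w has a limit.
    have hG0 : G 0 = 0 := by
      have : fderiv ℝ (fun q => a' q 0) p = 0 := by
        rw [Filter.EventuallyEq.fderiv_eq (𝕜 := ℝ) (eventually_of_mem (hV.mem_nhds hp) ha'1),
          fderiv_fun_const]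
        rfl
      change adjB (a' p 0) * fderiv ℝ (fun q => a' q 0) p v = 0
      rw [this]
      exact mul_zero _
    refine ⟨deriv G 0, ?_⟩
    have h1 := hasDerivAt_iff_tendsto_slope.1 (hG 0).hasDerivAt
    refine h1.congr' (eventually_ne_zero.mono fun w hw => ?_)
    rw [slope_def_module, hG0, sub_zero, sub_zero]
    have e1 : fderiv ℝ (fun q => a' q w) p = fderiv ℝ (fun q => a q w⁻¹) p :=
      Filter.EventuallyEq.fderiv_eq (eventually_of_mem (hV.mem_nhds hp)
        fun q hq => ha'e q hq w hw)
    change w⁻¹ • (adjB (a' p w) * fderiv ℝ (fun q => a' q w) p v) = _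
    rw [e1, ha'e p hp w hw]
    rfl
  obtain ⟨c, hc⟩ := l1
  have hhol : DifferentiableOn ℂ
      (fun z => z • (adjB (a p z) * fderiv ℝ (fun q => a q z) p v)) {0}ᶜ :=
    differentiableOn_id.smul ((h p hp).left.inv.hol.mul hX)
  have hconst : ∀ z, z ≠ 0 → z • (adjB (a p z) * fderiv ℝ (fun q => a q z) p v) = c :=
    fun z hz => eq_of_tendsto_inv hhol (tendsto_smul_zero l0) hc hz
  rw [hconst z hz]
  exact LimAt.eq (LimAt.congr (γ := fun _ => c) tendsto_const_nhds hconst) l0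

/-- Mixed derivatives commute, so ∂_w annihilates both f⁻¹ and ∂_v f. -/
theorem fderiv_logDeriv_eq_zero {U : Set Plane} (hU : IsOpen U) {f : Plane → BMat}
    (hf : ContDiffOn ℝ ∞ f U) {v w : Plane} (h : ∀ p ∈ U, fderiv ℝ f p w = 0) {p : Plane}
    (hp : p ∈ U) : fderiv ℝ (fun q => adjB (f q) * fderiv ℝ f q v) p w = 0 := by
  have hd : DifferentiableAt ℝ f p := (hf.contDiffAt (hU.mem_nhds hp)).differentiableAt (by simp)
  have hd2 : DifferentiableAt ℝ (fun q => fderiv ℝ f q v) p :=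
    ((contDiffOn_fderiv_apply hU hf v).contDiffAt (hU.mem_nhds hp)).differentiableAt (by simp)
  have hA := hasFDerivAt_adjB hd
  have h1 : fderiv ℝ (fun q => adjB (f q)) p w = adjB (fderiv ℝ f p w) :=
    congrArg (fun T : Plane →L[ℝ] BMat => T w) hA.fderiv
  have h2 : fderiv ℝ (fun q => fderiv ℝ f q w) p = 0 := by
    rw [Filter.EventuallyEq.fderiv_eq (𝕜 := ℝ) (eventually_of_mem (hU.mem_nhds hp) h),
      fderiv_fun_const]
    rfl
  rw [fderiv_mulB hA.differentiableAt hd2, h1, h p hp, fderiv_fderiv_comm hU hf hp, h2, map_zero]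
  simp

/-! ### Solutions for one-sided potentials -/

/-- Solutions of `dF = F z β` tend to `1` at `z = 0`. -/
theorem limAt_of_solvesAt {M : Type} [NormedRing M] [NormedAlgebra ℂ M] [CompleteSpace M]
    {U : Set Plane} (hU : IsOpen U) (hc : IsPreconnected U) {p₀ : Plane} (hp₀ : p₀ ∈ U)
    {β : Plane → Plane →L[ℝ] M} (hβ : ContDiffOn ℝ ∞ β U)
    (hclosed : ∀ p ∈ U, ∀ v w, fderiv ℝ β p v w = fderiv ℝ β p w v)
    (hcomm : ∀ p ∈ U, ∀ v w, β p v * β p w = β p w * β p v) {F : Plane → ℂ → M}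
    (hu : ∀ p ∈ U, ∀ z, z ≠ 0 → IsUnit (F p z)) (h0 : ∀ z, z ≠ 0 → F p₀ z = 1)
    (hF : ∀ p ∈ U, ∀ z : ℂ, z ≠ 0 → SolvesAt (fun p => z • β p) (fun q => F q z) p) {p : Plane}
    (hp : p ∈ U) : LimAt (F p) 1 := by
  -- As a form with values in functions on the closed unit disc, z β vanishes at z = 0. A local
  -- solution of that equation is thus continuous in z with constant value at 0.
  let K := C(closedBall (0 : ℂ) 1, M)
  let m : M →L[ℝ] K := LinearMap.mkContinuous
    { toFun := fun x => ⟨fun w => (w : ℂ) • x, by fun_prop⟩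
      map_add' := fun x y => ContinuousMap.ext fun w => smul_add (w : ℂ) x y
      map_smul' := fun c x => ContinuousMap.ext fun w => smul_comm (w : ℂ) c x } 1 fun x => by
    rw [one_mul]
    refine (ContinuousMap.norm_le _ (norm_nonneg _)).2 fun w => ?_
    change ‖(w : ℂ) • x‖ ≤ _
    rw [norm_smul]
    exact mul_le_of_le_one_left (norm_nonneg _) (mem_closedBall_zero_iff.1 w.2)
  let α : Plane → Plane →L[ℝ] K := fun p => m.comp (β p)
  have hα : ContDiffOn ℝ ∞ α U := contDiffOn_const.clm_comp hβ
  have hflat : IsFlatOn α U := by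
    intro p hp v w
    have hd : DifferentiableAt ℝ β p := (hβ.contDiffAt (hU.mem_nhds hp)).differentiableAt (by simp)
    have h1 := ((ContinuousLinearMap.compL ℝ Plane M K) m).hasFDerivAt.comp p hd.hasFDerivAt
    rw [HasFDerivAt.fderiv (f := α) h1]
    change m (fderiv ℝ β p v w) - m (fderiv ℝ β p w v) + m (β p v) * m (β p w) -
      m (β p w) * m (β p v) = 0
    rw [hclosed p hp v w, sub_self, zero_add, sub_eq_zero]
    refine ContinuousMap.ext fun x => ?_
    change ((x : ℂ) • β p v) * ((x : ℂ) • β p w) = ((x : ℂ) • β p w) * ((x : ℂ) • β p v)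
    rw [smul_mul_smul_comm, smul_mul_smul_comm, hcomm p hp v w]
  -- U need not be simply connected, so instead of a global solution the property of having limit 1
  -- is carried from point to point.
  have hloc : ∀ p ∈ U, ∀ᶠ q in 𝓝[U] p, LimAt (F p) 1 ↔ LimAt (F q) 1 := by
    intro p hp
    obtain ⟨r, hr, hball, G, hG0, hG⟩ := exists_local_solution hU hα hflat hp
    refine mem_nhdsWithin_of_mem_nhds (mem_of_superset (ball_mem_nhds p hr) fun q hq => ?_)
    have hpc : IsPreconnected (ball p r) := (convex_ball p r).isPreconnected
    have h1 : ∀ w : closedBall (0 : ℂ) 1, (w : ℂ) ≠ 0 → F q w = F p w * G q w := by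
      intro w hw
      refine SolvesAt.eq_of_eq (F := fun q => F q w) (G := fun q => F p w * G q w)
        (α := fun p => (w : ℂ) • β p) isOpen_ball hpc
        (fun x hx => hF x (hball hx) w hw) (fun x hx => ?_) (fun x hx => ?_) (mem_ball_self hr)
        ?_ hq
      · refine SolvesAt.const_mul (F := fun q => G q w) ?_ _
        have h2 := (ContinuousMap.evalCLM ℝ w : K →L[ℝ] M).hasFDerivAt.comp x (hG x hx).2
        exact h2.congr_fderiv (ContinuousLinearMap.ext fun v => rfl)
      · exact (hu p hp w hw).mul ((hG x hx).1.map
          ((Pi.evalMonoidHom _ w).comp ContinuousMap.coeFnMonoidHom))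
      · rw [hG0, ContinuousMap.one_apply, mul_one]
    let o : closedBall (0 : ℂ) 1 := ⟨0, by simp⟩
    have h2 : G q o = 1 := by
      refine SolvesAt.eq_of_eq (F := fun q => G q o) (G := fun _ => 1)
        (α := fun p => (0 : ℂ) • β p) isOpen_ball hpc
        (fun x hx => ?_) (fun x hx => ?_) (fun _ _ => isUnit_one) (mem_ball_self hr)
        (by rw [hG0]; rfl) hq
      · have h2 := (ContinuousMap.evalCLM ℝ o : K →L[ℝ] M).hasFDerivAt.comp x (hG x hx).2
        exact h2.congr_fderiv (ContinuousLinearMap.ext fun v => rfl)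
      · refine (hasFDerivAt_const (1 : M) x).congr_fderiv (ContinuousLinearMap.ext fun v => ?_)
        simp
    obtain ⟨u, hu'⟩ := (hG q hq).1
    have hlim : ∀ g : K, g o = 1 → ∃ g' : ℂ → M, LimAt g' 1 ∧
        ∀ w : closedBall (0 : ℂ) 1, g' w = g w := by
      intro g hg
      classical
      refine ⟨fun z => if hz : z ∈ closedBall (0 : ℂ) 1 then g ⟨z, hz⟩ else 0, ?_,
        fun w => dif_pos w.2⟩
      have hcont : ContinuousOn (fun z => if hz : z ∈ closedBall (0 : ℂ) 1 then g ⟨z, hz⟩ else 0)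
          (closedBall (0 : ℂ) 1) := by
        rw [continuousOn_iff_continuous_domRestrict]
        convert g.continuous using 1
        exact funext fun w => dif_pos w.2
      have h3 := (hcont.continuousAt (closedBall_mem_nhds 0 one_pos)).tendsto
      rw [dif_pos o.2] at h3
      have h4 : g ⟨0, o.2⟩ = 1 := hg
      rw [h4] at h3
      exact h3.mono_left nhdsWithin_le_nhds
    have hev : ∀ᶠ z in 𝓝[≠] (0 : ℂ), z ∈ closedBall (0 : ℂ) 1 ∧ z ≠ 0 :=
      Filter.Eventually.and (mem_nhdsWithin_of_mem_nhds (closedBall_mem_nhds 0 one_pos))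
        eventually_ne_zero
    have hinv : (↑u⁻¹ : K) o = 1 := by
      have h3 := congrArg (fun g : K => g o) u.inv_mul
      have h4 : (↑u⁻¹ : K) o * G q o = 1 := by rw [← hu']; exact h3
      rwa [h2, mul_one] at h4
    obtain ⟨g, hg, hge⟩ := hlim _ h2
    obtain ⟨g', hg', hge'⟩ := hlim _ hinv
    constructor
    · intro h
      have h3 := Tendsto.mul h hg
      rw [mul_one] at h3
      refine h3.congr' (hev.mono fun z hz => ?_)
      rw [hge ⟨z, hz.1⟩]
      exact (h1 ⟨z, hz.1⟩ hz.2).symm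
    · intro h
      have h3 := Tendsto.mul h hg'
      rw [mul_one] at h3
      refine h3.congr' (hev.mono fun z hz => ?_)
      rw [hge' ⟨z, hz.1⟩]
      have h4 := h1 ⟨z, hz.1⟩ hz.2
      have h5 := congrArg (fun g : K => g ⟨z, hz.1⟩) u.mul_inv
      have h6 : G q ⟨z, hz.1⟩ * (↑u⁻¹ : K) ⟨z, hz.1⟩ = 1 := by rw [← hu']; exact h5
      simp only at h4
      rw [h4, mul_assoc, h6, mul_one]
  have hbase : LimAt (F p₀) 1 := LimAt.congr (γ := fun _ => 1) tendsto_const_nhds h0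
  exact (hc.induction₂ (fun p q => LimAt (F p) 1 ↔ LimAt (F q) 1) hloc
    (fun _ _ _ _ _ _ h h' => h.trans h') (fun _ _ _ _ h => h.symm) hp₀ hp).1 hbase

/-! ### Normalized potentials -/

theorem JointSmooth.slice {E M : Type} [NormedAddCommGroup E] [NormedSpace ℝ E]
    [NormedAddCommGroup M] [NormedSpace ℝ M] {V : Set E} {f : E → ℂ → M} (hf : JointSmooth V f)
    {z : ℂ} (hz : z ≠ 0) : ContDiffOn ℝ ∞ (fun p => f p z) V :=
  ContDiffOn.comp (g := fun q : E × ℂ => f q.1 q.2) hf (f := fun p => (p, z))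
    (contDiffOn_id.prodMk contDiffOn_const) fun _ hp => ⟨hp, hz⟩

theorem detB_eq_one_of_limAt {γ : ℂ → BMat} (h : ∀ z, z ≠ 0 → detB (γ z) = 1) {x : BMat}
    (hx : LimAt γ x) : detB x = 1 :=
  LimAt.eq (γ := fun z => detB (γ z)) ((continuous_detB.tendsto x).comp hx)
    (LimAt.congr (γ := fun _ => 1) tendsto_const_nhds h)

theorem IsLoop.conjB_limAt {γ : ℂ → BMat} (h : IsLoop γ) {x : BMat} (hx : LimAt γ x) :
    conjB x = x :=
  hx.conj.eq (hx.congr fun z hz => by rw [h.real z hz, conjB_conjB])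

theorem IsLoop.twist_limAt {γ : ℂ → BMat} (h : IsLoop γ) {x : BMat} (hx : LimAt γ x) :
    kB * x * kB = x :=
  hx.twist.eq (hx.congr fun z hz => by rw [h.twist _ (neg_ne_zero.2 hz), neg_neg])

/-- P⁻¹ dP has its pole at 0 in the direction e and none in the direction e'. Keeping the directions
general serves dy directly and dx after z ↦ z⁻¹. Then z a⁻¹ ∂_e a = b₀ E b₀⁻¹ is independent of z;
as b₀ is real and fixed by Ad 𝐤', this value is real and lies in 𝔪. Since ∂_{e'} a = 0, it does not
vary along e'. -/
theorem exists_normalizedPotential {V : Set Plane} (hV : IsOpen V) {P a b : Plane → ℂ → BMat}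
    (ha : JointSmooth V a) (hb : JointSmooth V b) (hP : ∀ p ∈ V, IsLoop (P p))
    (h : ∀ p ∈ V, IsNegPos (P p) (a p) (b p)) {e e' : Plane} {l l' : Plane →ₗ[ℝ] ℝ}
    (hl : ∀ v, v = l v • e + l' v • e') (hle : l e = 1) (hle' : l e' = 0) {E : Plane → MatR}
    (hE : ∀ p ∈ V, E p ∈ mPart)
    (hQ : ∀ p ∈ V,
      LimAt (fun z => z • (adjB (P p z) * fderiv ℝ (fun q => P q z) p e)) (realB (E p)))
    (hQ' : ∀ p ∈ V, LimAt (fun z => z • (adjB (P p z) * fderiv ℝ (fun q => P q z) p e')) 0) :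
    ∃ η : Form, (∀ v, IsSmoothOn (fun q => η q v) V) ∧ (∀ p ∈ V, ∀ v, η p v ∈ mPart) ∧
      (∀ p ∈ V, η p e' = 0) ∧ (∀ p ∈ V, matDeriv (fun q => η q e) p e' = 0) ∧
      ∀ p ∈ V, ∀ v z, z ≠ 0 →
        fderiv ℝ (fun q => a q z) p v = a p z * (z⁻¹ • realB (η p v)) := by
  have hH : ∀ p, ∃ H : MatR, p ∈ V → H ∈ mPart ∧ ∀ z : ℂ, z ≠ 0 →
      z • (adjB (a p z) * fderiv ℝ (fun q => a q z) p e) = realB H := by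
    intro p
    by_cases hp : p ∈ V
    · obtain ⟨b₀, hb₀⟩ := (h p hp).lim_right
      have hlb := ((h p hp).isLoop (hP p hp)).2
      have r1 := hlb.conjB_limAt hb₀
      have r2 := hlb.twist_limAt hb₀
      have r3 : kB * adjB b₀ * kB = adjB b₀ := by rw [← adjB_kB_mul_mul, r2]
      obtain ⟨H, hH⟩ := exists_realB (X := b₀ * realB (E p) * adjB b₀) (by
        rw [conjB_mul, conjB_mul, conjB_adjB, r1, conjB_realB])
      refine ⟨H, fun _ => ⟨mem_mPart_of_mul_kB ?_, fun z hz => ?_⟩⟩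
      · rw [hH]
        calc kB * (b₀ * realB (E p) * adjB b₀) * kB
            = kB * b₀ * 1 * realB (E p) * 1 * adjB b₀ * kB := by simp only [mul_assoc, one_mul]
          _ = (kB * b₀ * kB) * (kB * realB (E p) * kB) * (kB * adjB b₀ * kB) := by
            rw [← kB_mul_kB]; simp only [mul_assoc]
          _ = _ := by rw [r2, r3, mul_kB_of_mem_mPart (hE p hp), mul_neg, neg_mul]
      · rw [hH]
        exact logDeriv_of_isNegPos hV ha hb h hp (hQ p hp) hb₀ hz
    · exact ⟨0, fun h => absurd h hp⟩
  choose H hH using hH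
  have hx : ∀ p ∈ V, ∀ z, z ≠ 0 → fderiv ℝ (fun q => a q z) p e = a p z * (z⁻¹ • realB (H p)) := by
    intro p hp z hz
    refine (eq_mul_of_adjB_mul ((h p hp).left.det z hz)).1 ?_
    rw [← (hH p hp).2 z hz, smul_smul, inv_mul_cancel₀ hz, one_smul]
  have hx' : ∀ p ∈ V, ∀ z, z ≠ 0 → fderiv ℝ (fun q => a q z) p e' = 0 := by
    intro p hp z hz
    obtain ⟨b₀, hb₀⟩ := (h p hp).lim_right
    have h1 := logDeriv_of_isNegPos hV ha hb h hp (hQ' p hp) hb₀ hz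
    rw [mul_zero, zero_mul, smul_eq_zero_iff_right hz] at h1
    have h2 := (eq_mul_of_adjB_mul ((h p hp).left.det z hz)).1 h1
    rwa [mul_zero] at h2
  have hH1 : ∀ p ∈ V, realB (H p) = adjB (a p 1) * fderiv ℝ (fun q => a q 1) p e := fun p hp => by
    rw [← (hH p hp).2 1 one_ne_zero, one_smul]
  have ha1 : ContDiffOn ℝ ∞ (fun p => a p 1) V := ha.slice one_ne_zero
  have hHs : ContDiffOn ℝ ∞ (fun p => realB (H p)) V := by
    refine ContDiffOn.congr ?_ hH1
    exact ((adjB.restrictScalars ℝ).contDiff.comp_contDiffOn ha1).mul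
      (contDiffOn_fderiv_apply hV ha1 e)
  have hHd : ∀ p ∈ V, matDeriv H p e' = 0 := by
    intro p hp
    refine realB_injective ?_
    rw [realB_matDeriv ((hHs.contDiffAt (hV.mem_nhds hp)).differentiableAt (by simp))]
    have h1 : fderiv ℝ (fun q => realB (H q)) p =
        fderiv ℝ (fun q => adjB (a q 1) * fderiv ℝ (fun q => a q 1) q e) p :=
      Filter.EventuallyEq.fderiv_eq (𝕜 := ℝ) (eventually_of_mem (hV.mem_nhds hp) hH1)
    rw [h1, fderiv_logDeriv_eq_zero hV ha1 (fun q hq => hx' q hq 1 one_ne_zero) hp]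
    exact (by simpa using (realB_real_smul 0 0).symm)
  refine ⟨fun p => l.smulRight (H p), fun v => ?_, fun p hp v => ?_, fun p _ => ?_,
    fun p hp => ?_, fun p hp v z hz => ?_⟩
  · rw [isSmoothOn_real_iff]
    have h1 : ContDiffOn ℝ ∞ (fun p => l v • realB (H p)) V := contDiffOn_const.smul hHs
    exact h1.congr fun p _ => realB_real_smul _ _
  · exact Submodule.smul_mem _ _ (hH p hp).1
  · rw [LinearMap.smulRight_apply, hle', zero_smul]
  · simp only [LinearMap.smulRight_apply, hle, one_smul]
    exact hHd p hp
  · have h1 : fderiv ℝ (fun q => a q z) p v =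
        l v • fderiv ℝ (fun q => a q z) p e + l' v • fderiv ℝ (fun q => a q z) p e' := by
      rw [← map_smul, ← map_smul, ← map_add, ← hl v]
    rw [h1, hx p hp z hz, hx' p hp z hz, smul_zero, add_zero, LinearMap.smulRight_apply,
      realB_real_smul, ← mul_smul_comm]
    congr 1
    exact smul_comm _ _ _

/-- The factorizations and the potentials of an extended framing. -/
structure HasNormalizedPotentials (D R : Set Plane) (ψ : Plane → MatR)
    (P a b a' b' : Plane → ℂ → BMat) (η' η'' : Form) : Prop where
  isOpen : IsOpen R
  zero_mem : ((0, 0) : Plane) ∈ R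
  subset : R ⊆ D
  framing : IsFramingB D ψ P
  mem_iff : ∀ p ∈ D, p ∈ R ↔ (∃ x y, IsNegPos (P p) x y) ∧ ∃ x y, IsNegPos (flipB (P p)) x y
  smooth_a : JointSmooth R a
  smooth_a' : JointSmooth R a'
  smooth_b' : JointSmooth R b'
  negPos : ∀ p ∈ R, IsNegPos (P p) (a p) (b p)
  posNeg : ∀ p ∈ R, IsNegPos (flipB (P p)) (a' p) (b' p)
  holo : IsHolomorphicForm R η'
  antiholo : IsAntiholomorphicForm R η''
  deriv_a : ∀ p ∈ R, ∀ v z, z ≠ 0 →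
    fderiv ℝ (fun q => a q z) p v = a p z * (z⁻¹ • realB (η'' p v))
  deriv_a' : ∀ p ∈ R, ∀ v z, z ≠ 0 →
    fderiv ℝ (fun q => a' q z) p v = a' p z * (z⁻¹ • realB (η' p v))

theorem isNegPos_one {γ : ℂ → BMat} (h : ∀ z, z ≠ 0 → γ z = 1) :
    IsNegPos γ (fun _ => 1) (fun _ => 1) :=
  ⟨⟨differentiableOn_const _, fun _ _ => detB_one⟩, ⟨differentiableOn_const _, fun _ _ => detB_one⟩,
    tendsto_const_nhds, ⟨1, tendsto_const_nhds⟩, fun z hz => by rw [h z hz, one_mul]⟩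

theorem IsFramingB.exists_hasNormalizedPotentials {D : Set Plane} (hD : IsOpen D)
    (h0 : ((0, 0) : Plane) ∈ D) {ψ : Plane → MatR} {P : Plane → ℂ → BMat}
    (hP : IsFramingB D ψ P) :
    ∃ R a b a' b' η' η'', HasNormalizedPotentials D R ψ P a b a' b' η' η'' := by
  obtain ⟨o1, a, b, sa, sb, hab⟩ := exists_negPos hD hP.smooth
    (fun p hp => (hP.loop p hp).isHolSL)
  obtain ⟨o2, a', b', sa', sb', hab'⟩ := exists_negPos hD hP.smooth.flip
    (fun p hp => (hP.loop p hp).isHolSL.flip)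
  let R : Set Plane := {p | p ∈ D ∧ ∃ x y, IsNegPos (P p) x y} ∩
    {p | p ∈ D ∧ ∃ x y, IsNegPos (flipB (P p)) x y}
  have hR : IsOpen R := o1.inter o2
  have hRD : R ⊆ D := fun p hp => hp.1.1
  obtain ⟨A, B, C, E, hmc⟩ := hP.mc
  have hmx : ∀ p ∈ R, ∀ z, z ≠ 0 → adjB (P p z) * fderiv ℝ (fun q => P q z) p (1, 0) =
      realB (A p) + z • realB (B p) := fun p hp z hz =>
    (eq_mul_of_adjB_mul (hP.det (hRD hp) hz)).2 ((solvesAt_coordForm_iff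
      (hP.differentiableAt hD (hRD hp) hz)).1 ((hmc p (hRD hp)).2.2.2.2 z hz)).1
  have hmy : ∀ p ∈ R, ∀ z, z ≠ 0 → adjB (P p z) * fderiv ℝ (fun q => P q z) p (0, 1) =
      realB (C p) + z⁻¹ • realB (E p) := fun p hp z hz =>
    (eq_mul_of_adjB_mul (hP.det (hRD hp) hz)).2 ((solvesAt_coordForm_iff
      (hP.differentiableAt hD (hRD hp) hz)).1 ((hmc p (hRD hp)).2.2.2.2 z hz)).2
  have lim1 : ∀ X Y : BMat, LimAt (fun z : ℂ => z • X + Y) Y := fun X Y => by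
    have h1 : Continuous fun z : ℂ => z • X + Y := by fun_prop
    have h2 := h1.limAt
    rwa [zero_smul, zero_add] at h2
  have lim2 : ∀ X Y : BMat, LimAt (fun z : ℂ => z • (X + z • Y)) 0 := fun X Y => by
    have h1 : Continuous fun z : ℂ => z • (X + z • Y) := by fun_prop
    have h2 := h1.limAt
    rwa [zero_smul] at h2
  -- The component C + z⁻¹ E along dy has the pole at 0 with coefficient E, while A + z B along dx
  -- is regular there.
  obtain ⟨η'', s1, s2, s3, s4, s5⟩ := exists_normalizedPotential hR
    (sa.mono inter_subset_left) (sb.mono inter_subset_left)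
    (fun p hp => hP.loop p (hRD hp)) (fun p hp => hab p hp.1.1 hp.1.2)
    (e := (0, 1)) (e' := (1, 0)) (l := LinearMap.snd ℝ ℝ ℝ) (l' := LinearMap.fst ℝ ℝ ℝ)
    (fun v => by simp) rfl rfl (fun p hp => (hmc p (hRD hp)).2.2.2.1)
    (fun p hp => (lim1 (realB (C p)) (realB (E p))).congr fun z hz => by
      rw [hmy p hp z hz, smul_add, smul_smul, mul_inv_cancel₀ hz, one_smul])
    (fun p hp => (lim2 (realB (A p)) (realB (B p))).congr fun z hz => by rw [hmx p hp z hz])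
  -- After z ↦ z⁻¹ the two directions exchange roles, and B becomes the coefficient of the pole.
  obtain ⟨η', t1, t2, t3, t4, t5⟩ := exists_normalizedPotential hR (P := fun p => flipB (P p))
    (sa'.mono inter_subset_right) (sb'.mono inter_subset_right)
    (fun p hp => (hP.loop p (hRD hp)).flip) (fun p hp => hab' p hp.2.1 hp.2.2)
    (e := (1, 0)) (e' := (0, 1)) (l := LinearMap.fst ℝ ℝ ℝ) (l' := LinearMap.snd ℝ ℝ ℝ)
    (fun v => by simp) rfl rfl (fun p hp => (hmc p (hRD hp)).2.1)
    (fun p hp => (lim1 (realB (A p)) (realB (B p))).congr fun z hz => by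
      have := hmx p hp z⁻¹ (inv_ne_zero hz)
      simp only [flipB_apply]
      rw [this, smul_add, smul_smul, mul_inv_cancel₀ hz, one_smul])
    (fun p hp => (lim2 (realB (C p)) (realB (E p))).congr fun z hz => by
      have := hmy p hp z⁻¹ (inv_ne_zero hz)
      simp only [flipB_apply]
      rw [this, inv_inv])
  refine ⟨R, a, b, a', b', η', η'', hR, ⟨⟨h0, _, _, isNegPos_one hP.base⟩, h0, _, _,
    isNegPos_one fun z hz => hP.base _ (inv_ne_zero hz)⟩, hRD, hP, fun p hp => ?_,
    sa.mono inter_subset_left, sa'.mono inter_subset_right,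
    sb'.mono inter_subset_right, fun p hp => hab p hp.1.1 hp.1.2,
    fun p hp => hab' p hp.2.1 hp.2.2, ⟨t1, t2, t3, t4⟩, ⟨s1, s2, s3, s4⟩, s5, t5⟩
  exact ⟨fun h => ⟨h.1.2, h.2.2⟩, fun h => ⟨⟨hp, h.1⟩, hp, h.2⟩⟩

/-! ### Loops and their factorizations -/

/-- The loop with given values in the Banach algebra. -/
noncomputable def unloopB (γ : ℂ → BMat) : Loop := fun z => toB.symm (γ z)

theorem loopB_unloopB (γ : ℂ → BMat) : loopB (unloopB γ) = γ :=
  funext fun z => toB.apply_symm_apply (γ z)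

theorem splits_iff {γ a b : Loop} :
    Splits γ a b ↔ ∀ z, z ≠ 0 → loopB γ z = loopB a z * loopB b z :=
  forall₂_congr fun _ _ => by
    rw [loopB, loopB, loopB, ← map_mul, toB.injective.eq_iff]

theorem loopEq_iff {γ δ : Loop} : LoopEq γ δ ↔ ∀ z, z ≠ 0 → loopB γ z = loopB δ z :=
  forall₂_congr fun _ _ => toB.injective.eq_iff.symm

theorem isNegPos_loopB_iff {γ a b : Loop} (hγ : IsLoop (loopB γ)) :
    IsNegPos (loopB γ) (loopB a) (loopB b) ↔ a ∈ loopNegStar ∧ b ∈ loopPos ∧ Splits γ a b := by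
  rw [mem_loopNegStar_iff, mem_loopPos_iff, splits_iff]
  constructor
  · intro h
    obtain ⟨h1, h2⟩ := h.isLoop hγ
    exact ⟨⟨h1, h.lim_left⟩, ⟨h2, h.lim_right⟩, h.eq⟩
  · rintro ⟨⟨h1, h2⟩, ⟨h3, h4⟩, h5⟩
    exact ⟨h1.isHolSL, h3.isHolSL, h2, h4, h5⟩

theorem splits_flip_iff {γ a b : Loop} : Splits (flipB γ) (flipB a) (flipB b) ↔ Splits γ a b := by
  constructor
  · intro h z hz
    have := h z⁻¹ (inv_ne_zero hz)
    simpa [flipB] using this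
  · exact fun h z hz => h _ (inv_ne_zero hz)

theorem isNegPos_flipB_iff {γ a b : Loop} (hγ : IsLoop (loopB γ)) :
    IsNegPos (flipB (loopB γ)) (flipB (loopB a)) (flipB (loopB b)) ↔
      a ∈ loopPosStar ∧ b ∈ loopNeg ∧ Splits γ a b := by
  rw [← flip_mem_loopPos_iff (γ := b), ← splits_flip_iff, ← flipB_flipB a,
    flip_mem_loopPosStar_iff, flipB_flipB]
  exact isNegPos_loopB_iff (γ := flipB γ) hγ.flip

theorem mem_bigCellNegPos_iff {γ : Loop} (hγ : IsLoop (loopB γ)) :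
    γ ∈ bigCellNegPos ↔ ∃ a b, IsNegPos (loopB γ) a b := by
  constructor
  · rintro ⟨a, ha, b, hb, h⟩
    exact ⟨_, _, (isNegPos_loopB_iff hγ).2 ⟨ha, hb, h⟩⟩
  · rintro ⟨a, b, h⟩
    rw [← loopB_unloopB a, ← loopB_unloopB b, isNegPos_loopB_iff hγ] at h
    exact ⟨_, h.1, _, h.2⟩

theorem mem_bigCellPosNeg_iff {γ : Loop} (hγ : IsLoop (loopB γ)) :
    γ ∈ bigCellPosNeg ↔ ∃ a b, IsNegPos (flipB (loopB γ)) a b := by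
  constructor
  · rintro ⟨a, ha, b, hb, h⟩
    exact ⟨_, _, (isNegPos_flipB_iff hγ).2 ⟨ha, hb, h⟩⟩
  · rintro ⟨a, b, h⟩
    rw [← flipB_flipB a, ← flipB_flipB b, ← loopB_unloopB (flipB a), ← loopB_unloopB (flipB b),
      isNegPos_flipB_iff hγ] at h
    exact ⟨_, h.1, _, h.2⟩

/-- A constant right factor is absorbed by b, so the left factor, and with it the potential, does
not see the gauge. -/
theorem IsNegPos.mul_const {γ δ a b : ℂ → BMat} (h : IsNegPos γ a b) {κ : BMat}
    (hκ : detB κ = 1) (hδ : ∀ z, z ≠ 0 → δ z = γ z * κ) :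
    IsNegPos δ a (fun z => adjB (a z) * δ z) := by
  have e : ∀ z, z ≠ 0 → adjB (a z) * δ z = b z * κ := fun z hz => by
    rw [hδ z hz, h.eq z hz, mul_assoc, ← mul_assoc (adjB (a z)), adjB_mul (h.left.det z hz),
      one_mul]
  obtain ⟨x, hx⟩ := h.lim_right
  refine ⟨h.left, ⟨(h.right.hol.mul_const κ).congr e, fun z hz => ?_⟩, h.lim_left,
    ⟨x * κ, (Tendsto.mul_const κ hx).congr' (eventually_ne_zero.mono fun z hz => (e z hz).symm)⟩,
    fun z hz => ?_⟩
  · rw [e z hz, detB_mul, h.right.det z hz, hκ, one_mul]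
  · rw [← mul_assoc, mul_adjB (h.left.det z hz), one_mul]

theorem exists_isNegPos_iff {γ δ : ℂ → BMat} {κ : BMat} (hκ : detB κ = 1)
    (hδ : ∀ z, z ≠ 0 → δ z = γ z * κ) :
    (∃ a b, IsNegPos δ a b) ↔ ∃ a b, IsNegPos γ a b := by
  constructor
  · rintro ⟨a, b, h⟩
    refine ⟨a, _, h.mul_const (κ := adjB κ) (by rw [detB_adjB, hκ]) fun z hz => ?_⟩
    rw [hδ z hz, mul_assoc, mul_adjB hκ, mul_one]
  · rintro ⟨a, b, h⟩
    exact ⟨a, _, h.mul_const hκ hδ⟩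

theorem IsFramingB.mono {U V : Set Plane} (hUV : U ⊆ V) {ψ : Plane → MatR} {P : Plane → ℂ → BMat}
    (h : IsFramingB V ψ P) : IsFramingB U ψ P := by
  obtain ⟨A, B, C, E, hmc⟩ := h.mc
  exact ⟨h.smooth.mono hUV, fun p hp => h.loop p (hUV hp), h.base,
    ⟨A, B, C, E, fun p hp => hmc p (hUV hp)⟩, fun p hp => h.framing p (hUV hp)⟩

theorem matDeriv_eq_iff {U : Set Plane} (hU : IsOpen U) {Ψ : Plane → Loop}
    (hΨ : JointSmooth U (fun p => loopB (Ψ p))) {p : Plane} (hp : p ∈ U) {z : ℂ} (hz : z ≠ 0)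
    {v : Plane} {X : MatC} : matDeriv (fun q => Ψ q z) p v = Ψ p z * X ↔
      fderiv ℝ (fun q => loopB (Ψ q) z) p v = loopB (Ψ p) z * toB X := by
  rw [← toB.injective.eq_iff, toB_matDeriv (hΨ.differentiableAt hU hp hz), map_mul]
  rfl

namespace HasNormalizedPotentials

variable {D R : Set Plane} {ψ : Plane → MatR} {P a b a' b' : Plane → ℂ → BMat} {η' η'' : Form}

theorem deriv_flip (h : HasNormalizedPotentials D R ψ P a b a' b' η' η'') {p : Plane}
    (hp : p ∈ R) (v : Plane) {z : ℂ} (hz : z ≠ 0) :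
    fderiv ℝ (fun q => flipB (a' q) z) p v = flipB (a' p) z * (z • realB (η' p v)) := by
  have := h.deriv_a' p hp v z⁻¹ (inv_ne_zero hz)
  rw [inv_inv] at this
  exact this

/-- An arbitrary extended framing is P times a factor independent of z, hence lies in the same big
cells as P and has the same left factors. -/
theorem isBirkhoffSplitting (hD : IsOpen D) (hc : IsPreconnected D)
    (h0 : ((0, 0) : Plane) ∈ D) (h : HasNormalizedPotentials D R ψ P a b a' b' η' η'')
    {Ψ : Plane → Loop} (hΨ : IsFramingB D ψ (fun p => loopB (Ψ p))) :
    regularSet D Ψ = R ∧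
    IsBirkhoffSplitting R Ψ (fun p => unloopB (a p))
      (fun p => unloopB fun z => adjB (a p z) * loopB (Ψ p) z) (fun p => unloopB (flipB (a' p)))
      (fun p => unloopB fun z => adjB (flipB (a' p) z) * loopB (Ψ p) z) := by
  have hκ : ∀ p ∈ D, detB (adjB (P p 1) * loopB (Ψ p) 1) = 1 := fun p hp => by
    rw [detB_mul, detB_adjB, h.framing.det hp one_ne_zero, hΨ.det hp one_ne_zero, one_mul]
  have hPΨ : ∀ p ∈ D, ∀ z, z ≠ 0 → loopB (Ψ p) z = P p z * (adjB (P p 1) * loopB (Ψ p) 1) :=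
    fun p hp z hz => h.framing.eq_mul hD hc h0 hΨ hp hz
  have hPΨ' : ∀ p ∈ D, ∀ z, z ≠ 0 →
      flipB (loopB (Ψ p)) z = flipB (P p) z * (adjB (P p 1) * loopB (Ψ p) 1) :=
    fun p hp z hz => hPΨ p hp _ (inv_ne_zero hz)
  refine ⟨Set.ext fun p => ?_, ?_⟩
  · by_cases hp : p ∈ D
    · rw [h.mem_iff p hp, ← exists_isNegPos_iff (hκ p hp) (hPΨ p hp),
        ← exists_isNegPos_iff (hκ p hp) (hPΨ' p hp), ← mem_bigCellNegPos_iff (hΨ.loop p hp),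
        ← mem_bigCellPosNeg_iff (hΨ.loop p hp)]
      exact ⟨fun h => h.2, fun h => ⟨hp, h⟩⟩
    · exact ⟨fun h => absurd h.1 hp, fun hR => absurd (h.subset hR) hp⟩
  have hnp : ∀ p ∈ R, IsNegPos (loopB (Ψ p)) (a p) (fun z => adjB (a p z) * loopB (Ψ p) z) :=
    fun p hp => (h.negPos p hp).mul_const (hκ p (h.subset hp)) (hPΨ p (h.subset hp))
  have hpn : ∀ p ∈ R, IsNegPos (flipB (loopB (Ψ p))) (a' p)
      (fun z => adjB (a' p z) * flipB (loopB (Ψ p)) z) :=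
    fun p hp => (h.posNeg p hp).mul_const (hκ p (h.subset hp)) (hPΨ' p (h.subset hp))
  have hnp' : ∀ p ∈ R, IsNegPos (loopB (Ψ p)) (loopB (unloopB (a p)))
      (loopB (unloopB fun z => adjB (a p z) * loopB (Ψ p) z)) := fun p hp => by
    rw [loopB_unloopB, loopB_unloopB]
    exact hnp p hp
  have hpn' : ∀ p ∈ R, IsNegPos (flipB (loopB (Ψ p))) (flipB (loopB (unloopB (flipB (a' p)))))
      (flipB (loopB (unloopB fun z => adjB (flipB (a' p) z) * loopB (Ψ p) z))) := fun p hp => by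
    have h1 : flipB (fun z => adjB (flipB (a' p) z) * loopB (Ψ p) z) =
        fun z => adjB (a' p z) * flipB (loopB (Ψ p)) z := funext fun z => by
      simp [flipB]
    rw [loopB_unloopB, loopB_unloopB, flipB_flipB, h1]
    exact hpn p hp
  have hs := hΨ.smooth.mono h.subset
  have hl : ∀ p ∈ R, IsLoop (loopB (Ψ p)) := fun p hp => hΨ.loop p (h.subset hp)
  refine ⟨?_, ?_, ?_, ?_, fun p hp => ?_, fun p hp => ?_, fun p hp x hx y hy hxy => ?_,
    fun p hp x hx y hy hxy => ?_⟩
  · simp only [isSmoothLoopMap_iff, loopB_unloopB]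
    exact h.smooth_a
  · simp only [isSmoothLoopMap_iff, loopB_unloopB]
    exact h.smooth_a.inv.mul hs
  · simp only [isSmoothLoopMap_iff, loopB_unloopB]
    exact h.smooth_a'.flip
  · simp only [isSmoothLoopMap_iff, loopB_unloopB]
    exact h.smooth_a'.flip.inv.mul hs
  · have h1 := (isNegPos_loopB_iff (hl p hp)).1 (hnp' p hp)
    have h2 := (isNegPos_flipB_iff (hl p hp)).1 (hpn' p hp)
    exact ⟨h1.1, h1.2.1, h2.1, h2.2.1⟩
  · exact ⟨((isNegPos_loopB_iff (hl p hp)).1 (hnp' p hp)).2.2,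
      ((isNegPos_flipB_iff (hl p hp)).1 (hpn' p hp)).2.2⟩
  · have h1 := (isNegPos_loopB_iff (hl p hp)).2 ⟨hx, hy, hxy⟩
    exact ⟨loopEq_iff.2 fun z hz => (h1.unique (hnp' p hp) hz).1,
      loopEq_iff.2 fun z hz => (h1.unique (hnp' p hp) hz).2⟩
  · have h1 := (isNegPos_flipB_iff (hl p hp)).2 ⟨hx, hy, hxy⟩
    refine ⟨loopEq_iff.2 fun z hz => ?_, loopEq_iff.2 fun z hz => ?_⟩
    · have := (h1.unique (hpn' p hp) (inv_ne_zero hz)).1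
      simpa only [flipB_apply, inv_inv] using this
    · have := (h1.unique (hpn' p hp) (inv_ne_zero hz)).2
      simpa only [flipB_apply, inv_inv] using this

theorem potentials_eq (h : HasNormalizedPotentials D R ψ P a b a' b' η' η'') {p : Plane}
    (hp : p ∈ R) (v : Plane) {z : ℂ} (hz : z ≠ 0) :
    toC (η' p v) = z⁻¹ • ((unloopB (flipB (a' p)) z)⁻¹ *
      matDeriv (fun q => unloopB (flipB (a' q)) z) p v) ∧
    toC (η'' p v) = z • ((unloopB (a p) z)⁻¹ * matDeriv (fun q => unloopB (a q) z) p v) := by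
  have key : ∀ (f : Plane → ℂ → BMat) (w : ℂ) (X : MatR), JointSmooth R f → detB (f p z) = 1 →
      w ≠ 0 → fderiv ℝ (fun q => f q z) p v = f p z * (w • realB X) →
      toC X = w⁻¹ • ((unloopB (f p) z)⁻¹ * matDeriv (fun q => unloopB (f q) z) p v) := by
    intro f w X hf hd hw e
    have e1 : matDeriv (fun q => unloopB (f q) z) p v = unloopB (f p) z * (w • toC X) := by
      refine (matDeriv_eq_iff (Ψ := fun p => unloopB (f p)) h.isOpen
        (by simpa only [loopB_unloopB] using hf) hp hz).2 ?_
      simp only [loopB_unloopB]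
      rw [map_smul]
      exact e
    have e2 : IsUnit (unloopB (f p) z).det := by
      have : (unloopB (f p) z).det = detB (f p z) := rfl
      rw [this, hd]
      exact isUnit_one
    rw [e1, Matrix.nonsing_inv_mul_cancel_left _ _ e2, smul_smul, inv_mul_cancel₀ hw, one_smul]
  constructor
  · exact key (fun p => flipB (a' p)) z (η' p v) h.smooth_a'.flip ((h.posNeg p hp).left.flip.det z hz) hz (h.deriv_flip hp v hz)
  · have := key a z⁻¹ (η'' p v) h.smooth_a ((h.negPos p hp).left.det z hz) (inv_ne_zero hz)
      (h.deriv_a p hp v z hz)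
    rwa [inv_inv] at this

end HasNormalizedPotentials

/-! ### The Weierstraß representation -/

theorem inv_apply_eq {γ : Loop} (h : IsLoop (loopB γ)) {z : ℂ} (hz : z ≠ 0) :
    toB (γ z)⁻¹ = adjB (loopB γ z) :=
  toB_inv (h.det z hz)

theorem splits_inv_iff {γ δ L : Loop} (hL : IsLoop (loopB L)) :
    Splits γ δ (fun z => (L z)⁻¹) ↔ Splits δ γ L := by
  rw [splits_iff, splits_iff]
  refine forall₂_congr fun z hz => ?_
  have h1 : loopB (fun z => (L z)⁻¹) z = adjB (loopB L z) := inv_apply_eq hL hz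
  rw [h1]
  constructor
  · intro h
    rw [h, mul_assoc, adjB_mul (hL.det z hz), mul_one]
  · intro h
    rw [h, mul_assoc, mul_adjB (hL.det z hz), mul_one]

theorem isIntegral_iff {U : Set Plane} (hU : IsOpen U) {ξ : LoopForm} {F : Plane → Loop} :
    IsIntegral U ξ F ↔ JointSmooth U (fun p => loopB (F p)) ∧ (∀ p ∈ U, IsLoop (loopB (F p))) ∧
      (∀ z, z ≠ 0 → loopB (F (0, 0)) z = 1) ∧ ∀ p ∈ U, ∀ v z, z ≠ 0 →
        fderiv ℝ (fun q => loopB (F q) z) p v = loopB (F p) z * toB (ξ p v z) := by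
  constructor
  · rintro ⟨h1, h2, h3, h4⟩
    have hs := isSmoothLoopMap_iff.1 h1
    exact ⟨hs, fun p hp => mem_loopGroup_iff.1 (h2 p hp),
      fun z hz => by rw [loopB, h3 z hz, map_one],
      fun p hp v z hz => (matDeriv_eq_iff hU hs hp hz).1 (h4 p hp v z hz)⟩
  · rintro ⟨h1, h2, h3, h4⟩
    exact ⟨isSmoothLoopMap_iff.2 h1, fun p hp => mem_loopGroup_iff.2 (h2 p hp),
      fun z hz => toB.injective (by rw [map_one]; exact h3 z hz),
      fun p hp v z hz => (matDeriv_eq_iff hU h1 hp hz).2 (h4 p hp v z hz)⟩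

/-- Solutions for a form `z X l`, where `X` is constant on the kernel of the functional `l`. -/
theorem limAt_of_fderiv_eq_smul {M : Type} [NormedRing M] [NormedAlgebra ℂ M] [CompleteSpace M]
    {U : Set Plane} (hU : IsOpen U) (hc : IsPreconnected U) {p₀ : Plane} (hp₀ : p₀ ∈ U)
    {X : Plane → M} (hX : ContDiffOn ℝ ∞ X U) {l : Plane →L[ℝ] ℝ} {e : Plane}
    (hX' : ∀ q ∈ U, ∀ v, fderiv ℝ X q v = l v • fderiv ℝ X q e) {F : Plane → ℂ → M}
    (hu : ∀ p ∈ U, ∀ z, z ≠ 0 → IsUnit (F p z)) (h0 : ∀ z, z ≠ 0 → F p₀ z = 1)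
    (hF : ∀ p ∈ U, ∀ z : ℂ, z ≠ 0 → DifferentiableAt ℝ (fun q => F q z) p)
    (heq : ∀ p ∈ U, ∀ v z, z ≠ 0 → fderiv ℝ (fun q => F q z) p v = F p z * (z • (l v • X p)))
    {p : Plane} (hp : p ∈ U) : LimAt (F p) 1 := by
  let β : Plane → Plane →L[ℝ] M := fun q => l.smulRight (X q)
  have hβ' : ∀ q ∈ U, ∀ v w, fderiv ℝ β q v w = l w • (l v • fderiv ℝ X q e) := by
    intro q hq v w
    have hd : DifferentiableAt ℝ X q := (hX.contDiffAt (hU.mem_nhds hq)).differentiableAt (by simp)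
    have h1 := (ContinuousLinearMap.smulRightL ℝ Plane M l).hasFDerivAt.comp q hd.hasFDerivAt
    rw [HasFDerivAt.fderiv (f := β) h1, ← hX' q hq v]
    rfl
  refine limAt_of_solvesAt (β := β) hU hc hp₀ (contDiffOn_const.smulRight hX)
    (fun q hq v w => ?_) (fun q hq v w => ?_) hu h0 (fun q hq z hz => ?_) hp
  · rw [hβ' q hq, hβ' q hq, smul_comm]
  · change (l v • X q) * (l w • X q) = (l w • X q) * (l v • X q)
    rw [smul_mul_smul_comm, smul_mul_smul_comm, mul_comm]
  · exact (hF q hq z hz).hasFDerivAt.congr_fderiv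
      (ContinuousLinearMap.ext fun v => heq q hq v z hz)

/-- A form h l with h constant along the kernel of l is closed, and its values at a point are
multiples of one matrix. This is what places the solutions of the two initial value problems in the
normalized subgroups. -/
theorem limAt_of_fderiv_eq {U : Set Plane} (hU : IsOpen U) (hc : IsPreconnected U)
    (h0 : ((0, 0) : Plane) ∈ U) {F : Plane → ℂ → BMat} (hF : JointSmooth U F)
    (hloop : ∀ p ∈ U, IsLoop (F p)) (hbase : ∀ z, z ≠ 0 → F (0, 0) z = 1) {e e' : Plane}
    {l l' : Plane →L[ℝ] ℝ} (hl : ∀ v, v = l v • e + l' v • e') {η : Form}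
    (hs : IsSmoothOn (fun q => η q e) U) (hη' : ∀ p ∈ U, η p e' = 0)
    (hη : ∀ p ∈ U, matDeriv (fun q => η q e) p e' = 0)
    (heq : ∀ p ∈ U, ∀ v z, z ≠ 0 →
      fderiv ℝ (fun q => F q z) p v = F p z * (z • realB (η p v))) {p : Plane} (hp : p ∈ U) :
    LimAt (F p) 1 := by
  have hs' := isSmoothOn_real_iff.1 hs
  have hd : ∀ q ∈ U, DifferentiableAt ℝ (fun q => realB (η q e)) q := fun q hq =>
    (hs'.contDiffAt (hU.mem_nhds hq)).differentiableAt (by simp)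
  have hr0 : realB 0 = 0 := by simpa using realB_real_smul 0 0
  have hη0 : ∀ q ∈ U, fderiv ℝ (fun q => realB (η q e)) q e' = 0 := fun q hq => by
    rw [← realB_matDeriv (hd q hq), hη q hq, hr0]
  have hηv : ∀ q ∈ U, ∀ v, realB (η q v) = l v • realB (η q e) := fun q hq v => by
    conv_lhs => rw [hl v]
    rw [map_add, map_smul, map_smul, hη' q hq, smul_zero, add_zero, realB_real_smul]
  refine limAt_of_fderiv_eq_smul hU hc h0 hs' (l := l) (e := e) (fun q hq v => ?_)
    (fun q hq z hz => isUnit_of_detB ((hloop q hq).det z hz)) hbase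
    (fun q hq z hz => hF.differentiableAt hU hq hz) (fun q hq v z hz => ?_) hp
  · conv_lhs => rw [hl v]
    rw [map_add, map_smul, map_smul, hη0 q hq, smul_zero, add_zero]
  · refine (heq q hq v z hz).trans ?_
    rw [hηv q hq]

namespace HasNormalizedPotentials

variable {D R : Set Plane} {ψ : Plane → MatR} {P a b a' b' : Plane → ℂ → BMat} {η' η'' : Form}

/-- Ψ' = Ψ₊ and Ψ'' = Ψ₋ solve the initial value problems. In P = Ψ₊ L₋ the factor L₋ need not be
normalized; the gauge κ, the inverse of its value at ∞, repairs this. As κ is real, unimodular and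
commutes with 𝐤', P κ is again an extended framing. -/
theorem weierstrassConstructs (h : HasNormalizedPotentials D R ψ P a b a' b' η' η'')
    {U : Set Plane} (hU : IsOpen U) (h0 : ((0, 0) : Plane) ∈ U) (hUR : U ⊆ R) :
    WeierstrassConstructs U (potentialX η') (potentialY η'') ψ := by
  have hP := h.framing.mono (hUR.trans h.subset)
  -- The smooth extension of b' to 0 makes the value of L₋ at ∞ a smooth function of the point.
  obtain ⟨g, gs, -, -, gl⟩ := (h.smooth_b'.mono hUR).exists_extension hU
    (fun q hq => (h.posNeg q (hUR hq)).right.hol) (fun q hq => (h.posNeg q (hUR hq)).lim_right)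
  have hl1 : ∀ p ∈ U, IsLoop (a p) ∧ IsLoop (b p) := fun p hp =>
    (h.negPos p (hUR hp)).isLoop (hP.loop p hp)
  have hl2 : ∀ p ∈ U, IsLoop (a' p) ∧ IsLoop (b' p) := fun p hp =>
    (h.posNeg p (hUR hp)).isLoop (hP.loop p hp).flip
  have gs' : ContDiffOn ℝ ∞ (fun p => g p 0) U :=
    ContDiffOn.comp (g := fun q : Plane × ℂ => g q.1 q.2) gs (f := fun p => (p, 0))
      (contDiffOn_id.prodMk contDiffOn_const) fun _ hp => ⟨hp, mem_univ _⟩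
  have gr : ∀ p ∈ U, conjB (g p 0) = g p 0 := fun p hp => (hl2 p hp).2.conjB_limAt (gl p hp)
  have gk : ∀ p ∈ U, kB * g p 0 * kB = g p 0 := fun p hp => (hl2 p hp).2.twist_limAt (gl p hp)
  have gd : ∀ p ∈ U, detB (g p 0) = 1 := fun p hp =>
    detB_eq_one_of_limAt (hl2 p hp).2.det (gl p hp)
  have one_a : ∀ z, z ≠ 0 → a (0, 0) z = 1 := fun z hz =>
    ((h.negPos _ (hUR h0)).unique (isNegPos_one hP.base) hz).1
  have one_a' : ∀ z, z ≠ 0 → a' (0, 0) z = 1 ∧ b' (0, 0) z = 1 := fun z hz =>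
    (h.posNeg _ (hUR h0)).unique (isNegPos_one fun z hz => hP.base _ (inv_ne_zero hz)) hz
  have g0 : g (0, 0) 0 = 1 := (gl _ h0).eq
    (LimAt.congr (γ := fun _ => 1) tendsto_const_nhds fun z hz => (one_a' z hz).2)
  obtain ⟨κ, hκ⟩ : ∃ κ : Plane → BMat, κ = fun p => adjB (g p 0) := ⟨_, rfl⟩
  have κs : ContDiffOn ℝ ∞ κ U := by
    rw [hκ]
    exact (adjB.restrictScalars ℝ).contDiff.comp_contDiffOn gs'
  have κr : ∀ p ∈ U, conjB (κ p) = κ p := fun p hp => by rw [hκ, conjB_adjB, gr p hp]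
  have κd : ∀ p ∈ U, detB (κ p) = 1 := fun p hp => by rw [hκ, detB_adjB, gd p hp]
  have κk' : ∀ p ∈ U, kB * κ p * kB = κ p := fun p hp => by
    rw [hκ, ← adjB_kB_mul_mul, gk p hp]
  have κk : ∀ p ∈ U, κ p * kB = kB * κ p := fun p hp => by
    conv_rhs => rw [← κk' p hp]
    rw [← mul_assoc, ← mul_assoc, kB_mul_kB, one_mul]
  have κ0 : κ (0, 0) = 1 := by
    rw [hκ]
    exact (congrArg adjB g0).trans adjB_one
  have κl : ∀ p ∈ U, IsLoop (fun _ => κ p) := fun p hp =>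
    ⟨differentiableOn_const _, fun _ _ => (κr p hp).symm, fun _ _ => κd p hp,
      fun _ _ => κk' p hp⟩
  have hΨ := hP.mul_right hU κs κr κd κk κ0
  have sX : JointSmooth U fun p => flipB (a' p) := (h.smooth_a'.mono hUR).flip
  have sY : JointSmooth U a := h.smooth_a.mono hUR
  have lLm : ∀ p ∈ U, IsLoop fun z => b' p z * κ p := fun p hp => (hl2 p hp).2.mul (κl p hp)
  have lLp : ∀ p ∈ U, IsLoop fun z => b p z * κ p := fun p hp => (hl1 p hp).2.mul (κl p hp)
  refine ⟨fun p => unloopB (flipB (a' p)), fun p => unloopB (a p), ?_, ?_,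
    fun p => unloopB fun z => P p z * κ p, fun p => unloopB (flipB fun z => b' p z * κ p),
    fun p => unloopB fun z => b p z * κ p, fun p hp => ⟨?_, ?_, ?_, ?_⟩, ?_⟩
  · rw [isIntegral_iff hU]
    simp only [loopB_unloopB]
    refine ⟨sX, fun p hp => (hl2 p hp).1.flip, fun z hz => (one_a' _ (inv_ne_zero hz)).1,
      fun p hp v z hz => ?_⟩
    rw [h.deriv_flip (hUR hp) v hz, potentialX, map_smul]
    rfl
  · rw [isIntegral_iff hU]
    simp only [loopB_unloopB]
    refine ⟨sY, fun p hp => (hl1 p hp).1, one_a, fun p hp v z hz => ?_⟩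
    rw [h.deriv_a p (hUR hp) v z hz, potentialY, map_smul]
    rfl
  · rw [mem_loopNegStar_iff, loopB_unloopB, flipB_flipB]
    refine ⟨(lLm p hp).flip, ?_⟩
    have h1 := (gl p hp).mul_const (κ p)
    rw [hκ, mul_adjB (gd p hp)] at h1
    rw [hκ]
    exact h1
  · rw [mem_loopPos_iff, loopB_unloopB]
    obtain ⟨x, hx⟩ := (h.negPos p (hUR hp)).lim_right
    exact ⟨lLp p hp, _, hx.mul_const (κ p)⟩
  · rw [splits_inv_iff (by rw [loopB_unloopB]; exact (lLm p hp).flip), splits_iff]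
    simp only [loopB_unloopB]
    intro z hz
    have h1 := (h.posNeg p (hUR hp)).eq z⁻¹ (inv_ne_zero hz)
    rw [flipB_apply, inv_inv] at h1
    rw [h1, flipB_apply, flipB_apply, mul_assoc]
  · rw [splits_inv_iff (by rw [loopB_unloopB]; exact lLp p hp), splits_iff]
    simp only [loopB_unloopB]
    intro z hz
    rw [(h.negPos p (hUR hp)).eq z hz, mul_assoc]
  · rw [isExtendedFraming_iff hU]
    simp only [loopB_unloopB]
    exact hΨ

/-- Once Ψ' → 1 at 0 and Ψ'' → 1 at ∞, the decompositions Ψ = Ψ' L₋ = Ψ'' L₊ are Birkhoff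
splittings. Uniqueness and independence of the gauge give Ψ' = Ψ₊ and Ψ'' = Ψ₋, and comparing
logarithmic derivatives at z = 1 identifies the potentials. -/
theorem eq_of_weierstrassConstructs (h : HasNormalizedPotentials D R ψ P a b a' b' η' η'')
    {U : Set Plane} (hU : IsOpen U) (hc : IsPreconnected U) (h0 : ((0, 0) : Plane) ∈ U)
    (hUR : U ⊆ R) {β' β'' : Form} (hβ' : IsHolomorphicForm U β') (hβ'' : IsAntiholomorphicForm U β'')
    (hW : WeierstrassConstructs U (potentialX β') (potentialY β'') ψ) {p : Plane} (hp : p ∈ U) :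
    β' p = η' p ∧ β'' p = η'' p := by
  obtain ⟨Ψ', Ψ'', hΨ', hΨ'', Ψ, Lm, Lp, hdec, hΨ⟩ := hW
  rw [isIntegral_iff hU] at hΨ' hΨ''
  rw [isExtendedFraming_iff hU] at hΨ
  obtain ⟨s1, l1, b1, e1⟩ := hΨ'
  obtain ⟨s2, l2, b2, e2⟩ := hΨ''
  have hP := h.framing.mono (hUR.trans h.subset)
  have e1' : ∀ q ∈ U, ∀ v z, z ≠ 0 → fderiv ℝ (fun q => loopB (Ψ' q) z) q v =
      loopB (Ψ' q) z * (z • realB (β' q v)) := fun q hq v z hz => by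
    rw [e1 q hq v z hz, potentialX, map_smul]; rfl
  have e2' : ∀ q ∈ U, ∀ v z, z ≠ 0 → fderiv ℝ (fun q => loopB (Ψ'' q) z) q v =
      loopB (Ψ'' q) z * (z⁻¹ • realB (β'' q v)) := fun q hq v z hz => by
    rw [e2 q hq v z hz, potentialY, map_smul]; rfl
  have lim1 : ∀ q ∈ U, LimAt (loopB (Ψ' q)) 1 := fun q hq =>
    limAt_of_fderiv_eq hU hc h0 s1 l1 b1 (e := (1, 0)) (e' := (0, 1))
      (l := ContinuousLinearMap.fst ℝ ℝ ℝ) (l' := ContinuousLinearMap.snd ℝ ℝ ℝ)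
      (fun v => by simp) (hβ'.smooth _) hβ'.type hβ'.holo e1' hq
  have lim2 : ∀ q ∈ U, LimAt (flipB (loopB (Ψ'' q))) 1 := fun q hq =>
    limAt_of_fderiv_eq hU hc h0 s2.flip (fun p hp => (l2 p hp).flip)
      (fun z hz => b2 _ (inv_ne_zero hz)) (e := (0, 1)) (e' := (1, 0))
      (l := ContinuousLinearMap.snd ℝ ℝ ℝ) (l' := ContinuousLinearMap.fst ℝ ℝ ℝ)
      (fun v => by simp) (hβ''.smooth _) hβ''.type hβ''.antiholo (fun q hq v z hz => by
        have := e2' q hq v z⁻¹ (inv_ne_zero hz)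
        rwa [inv_inv] at this) hq
  have hκ : ∀ q ∈ U, detB (adjB (P q 1) * loopB (Ψ q) 1) = 1 := fun q hq => by
    rw [detB_mul, detB_adjB, hP.det hq one_ne_zero, hΨ.det hq one_ne_zero, one_mul]
  have hPΨ : ∀ q ∈ U, ∀ z, z ≠ 0 → loopB (Ψ q) z = P q z * (adjB (P q 1) * loopB (Ψ q) 1) :=
    fun q hq z hz => hP.eq_mul hU hc h0 hΨ hq hz
  have k1 : ∀ q ∈ U, ∀ z, z ≠ 0 → loopB (Ψ' q) z = flipB (a' q) z := by
    intro q hq z hz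
    obtain ⟨d1, -, d3, -⟩ := hdec q hq
    rw [splits_inv_iff (mem_loopNegStar_iff.1 d1).1] at d3
    have n1 := (isNegPos_flipB_iff (hΨ.loop q hq)).2
      ⟨mem_loopPosStar_iff.2 ⟨l1 q hq, lim1 q hq⟩, mem_loopNeg_iff.2
        ⟨(mem_loopNegStar_iff.1 d1).1, 1, (mem_loopNegStar_iff.1 d1).2⟩, d3⟩
    have n2 := (h.posNeg q (hUR hq)).mul_const (hκ q hq) (δ := flipB (loopB (Ψ q)))
      fun z hz => hPΨ q hq _ (inv_ne_zero hz)
    have := (n1.unique n2 (inv_ne_zero hz)).1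
    rwa [flipB_apply, inv_inv] at this
  have k2 : ∀ q ∈ U, ∀ z, z ≠ 0 → loopB (Ψ'' q) z = a q z := by
    intro q hq z hz
    obtain ⟨-, d2, -, d4⟩ := hdec q hq
    rw [splits_inv_iff (mem_loopPos_iff.1 d2).1] at d4
    have n1 := (isNegPos_loopB_iff (hΨ.loop q hq)).2
      ⟨mem_loopNegStar_iff.2 ⟨l2 q hq, lim2 q hq⟩, d2, d4⟩
    exact (n1.unique ((h.negPos q (hUR hq)).mul_const (hκ q hq) (hPΨ q hq)) hz).1
  have cancel : ∀ {X Y Z : BMat}, detB X = 1 → X * Y = X * Z → Y = Z := fun {X Y Z} hX he => by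
    have := congrArg (adjB X * ·) he
    simpa only [← mul_assoc, adjB_mul hX, one_mul] using this
  constructor
  · refine LinearMap.ext fun v => realB_injective ?_
    have f1 := e1' p hp v 1 one_ne_zero
    have f2 : fderiv ℝ (fun q => loopB (Ψ' q) 1) p = fderiv ℝ (fun q => flipB (a' q) 1) p :=
      Filter.EventuallyEq.fderiv_eq (𝕜 := ℝ) (eventually_of_mem (hU.mem_nhds hp)
        fun q hq => k1 q hq 1 one_ne_zero)
    rw [f2, h.deriv_flip (hUR hp) v one_ne_zero, k1 p hp 1 one_ne_zero, one_smul, one_smul] at f1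
    exact (cancel ((h.posNeg p (hUR hp)).left.flip.det 1 one_ne_zero) f1).symm
  · refine LinearMap.ext fun v => realB_injective ?_
    have f1 := e2' p hp v 1 one_ne_zero
    have f2 : fderiv ℝ (fun q => loopB (Ψ'' q) 1) p = fderiv ℝ (fun q => a q 1) p :=
      Filter.EventuallyEq.fderiv_eq (𝕜 := ℝ) (eventually_of_mem (hU.mem_nhds hp)
        fun q hq => k2 q hq 1 one_ne_zero)
    rw [f2, h.deriv_a p (hUR hp) v 1 one_ne_zero, k2 p hp 1 one_ne_zero, inv_one, one_smul,
      one_smul] at f1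
    exact (cancel ((h.negPos p (hUR hp)).left.det 1 one_ne_zero) f1).symm

end HasNormalizedPotentials

theorem theorem4p4 (D : Set Plane) (hD : IsOpen D)
    (hsc : SimplyConnectedSpace D) (h0 : ((0, 0) : Plane) ∈ D)
    (ψ : Plane → MatR)
    (hψ : IsHarmonicMap D ψ) (hψ0 : ψ (0, 0) = matK) :
    ∃ (R : Set Plane) (η' η'' : Form),
      IsOpen R ∧ ((0, 0) : Plane) ∈ R ∧ R ⊆ D ∧
      IsHolomorphicForm R η' ∧ IsAntiholomorphicForm R η'' ∧
      (∀ Ψ : Plane → Loop,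
        IsExtendedFraming D ψ Ψ →
        regularSet D Ψ = R ∧
        ∃ Ψm Lp Ψp Lm : Plane → Loop,
          IsBirkhoffSplitting R Ψ Ψm Lp Ψp Lm ∧
          ∀ p ∈ R, ∀ v : Plane, ∀ z : ℂ, z ≠ 0 →
            toC (η' p v) =
              z⁻¹ • ((Ψp p z)⁻¹ * matDeriv (fun q => Ψp q z) p v) ∧
            toC (η'' p v) =
              z • ((Ψm p z)⁻¹ * matDeriv (fun q => Ψm q z) p v)) ∧
      ∀ U : Set Plane, IsOpen U → IsConnected U →
        ((0, 0) : Plane) ∈ U → U ⊆ R →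
        WeierstrassConstructs U
          (potentialX η') (potentialY η'') ψ ∧
        ∀ β' β'' : Form,
          IsHolomorphicForm U β' → IsAntiholomorphicForm U β'' →
          WeierstrassConstructs U
            (potentialX β') (potentialY β'') ψ →
          ∀ p ∈ U, β' p = η' p ∧ β'' p = η'' p := by
  have hc : IsPreconnected D := isPreconnected_iff_preconnectedSpace.2 inferInstance
  -- R and the potentials are read off from one framing; gauge independence extends them to every
  -- other one.
  obtain ⟨P, hP⟩ := exists_isFramingB hD h0 hψ hψ0
  obtain ⟨R, a, b, a', b', η', η'', h⟩ := hP.exists_hasNormalizedPotentials hD h0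
  refine ⟨R, η', η'', h.isOpen, h.zero_mem, h.subset, h.holo, h.antiholo, fun Ψ hΨ => ?_,
    fun U hU hUc hU0 hUR => ⟨h.weierstrassConstructs hU hU0 hUR, fun β' β'' hβ' hβ'' hW p hp =>
      h.eq_of_weierstrassConstructs hU hUc.isPreconnected hU0 hUR hβ' hβ'' hW hp⟩⟩
  obtain ⟨h1, h2⟩ := h.isBirkhoffSplitting hD hc h0 ((isExtendedFraming_iff hD).1 hΨ)
  exact ⟨h1, _, _, _, _, h2, fun p hp v z hz => h.potentials_eq hp v hz⟩
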